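/- Let $d\ge 1$, $\alpha=(\alpha_1,\dots,\alpha_d)\in[-1/2,\infty)^d$, and let $\mu$ be the measure on $X=(0,\infty)^d$ given by $d\mu(x)=\prod_{i=1}^d x_i^{2\alpha_i+1}\,dx_i$; write $L^p=L^p(X,\mu)$ (real-valued functions). For $k\in\mathbb N^d$ (with $0\in\mathbb N$) let $\ell_k^\alpha(x)=\prod_{i=1}^d\ell_{k_i}^{\alpha_i}(x_i)$, where $$\ell_n^{a}(x)=\Big(\frac{2\,n!}{\Gamma(n+a+1)}\Big)^{1/2}L_n^{a}(x^2)\,e^{-x^2/2},\qquad L_n^a(u)=\sum_{j=0}^n(-1)^j\,\frac{\Gamma(n+a+1)}{\Gamma(j+a+1)\,(n-j)!}\,\frac{u^j}{j!},$$ are the $L^2((0,\infty),x^{2a+1}dx)$-normalized Laguerre functions of convolution type. These are eigenfunctions of $L=-\Delta+|x|^2-\sum_{i=1}^d\frac{2\alpha_i+1}{x_i}\partial_{x_i}$ with eigenvalues $\lambda_k=\sum_{i=1}^d(4k_i+2\alpha_i+2)$. Put $\delta_i=\partial_{x_i}+x_i$ and, for $f\in L^2$, $$R_if=\sum_{k\in\mathbb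 N^d}\lambda_k^{-1/2}\,\langle f,\ell_k^\alpha\rangle_{L^2}\,\delta_i\ell_k^\alpha,\qquad i=1,\dots,d .$$ Then these series converge unconditionally in $L^2$ for every $f\in L^2$. Moreover, for every $1<p<\infty$, the vector of Riesz transforms $\mathbf Rf=(R_1f,\dots,R_df)$, initially defined on $L^p\cap L^2$, extends uniquely to a bounded linear operator $\mathbf R$ from $L^p$ to $L^p(X,\mu;\mathbb R^d)$, and $$\|\mathbf Rf\|_p\le 48\,(p^*-1)\,\|f\|_p,\qquad f\in L^p,$$ where $p^*=\max\big(p,\tfrac{p}{p-1}\big)$ and $\|\mathbf Rf\|_p=\Big(\int_X\Big(\sum_{i=1}^d|R_if|^2\Big)^{p/2}d\mu\Big)^{1/p}$. -/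

import Mathlib

open MeasureTheory Filter Topology
open scoped ENNReal

noncomputable section

/-- The (unnormalized) Laguerre polynomial of degree `n` and type `a > -1`,
`L_n^a(u) = ∑_{j ≤ n} (-1)^j * binom (n + a) (n - j) * u^j / j!`, the binomial coefficient being
`Γ(n + a + 1) / (Γ(j + a + 1) (n - j)!)`. -/
def laguerrePoly (a : ℝ) (n : ℕ) (u : ℝ) : ℝ :=
  ∑ j ∈ Finset.range (n + 1),
    (-1 : ℝ) ^ j * (Real.Gamma (n + a + 1) / (Real.Gamma (j + a + 1) * (n - j).factorial)) *
      u ^ j / j.factorial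

/-- The one-dimensional Laguerre function of convolution type,
`ℓ_n^a(x) = (2 n! / Γ(n + a + 1))^{1/2} L_n^a(x²) e^{-x²/2}`; the factor in front makes it a unit
vector of `L²((0,∞), x^{2a+1} dx)`. -/
def laguerreFun (a : ℝ) (n : ℕ) (x : ℝ) : ℝ :=
  Real.sqrt (2 * n.factorial / Real.Gamma (n + a + 1)) * laguerrePoly a n (x ^ 2) *
    Real.exp (-x ^ 2 / 2)

variable {d : ℕ}

/-- The product measure `⨂ x_i^{2 α_i + 1} dx_i` on `(0,∞)^d`, as a measure on `ℝ^d` which is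
carried by `(0,∞)^d`. -/
def laguerreMeasure (α : Fin d → ℝ) : Measure (Fin d → ℝ) :=
  Measure.pi fun i =>
    ((volume : Measure ℝ).restrict (Set.Ioi 0)).withDensity
      fun x => ENNReal.ofReal (x ^ (2 * α i + 1))

/-- The tensor product `ℓ_k^α = ℓ_{k_1}^{α_1} ⊗ ⋯ ⊗ ℓ_{k_d}^{α_d}`. -/
def laguerreTensor (α : Fin d → ℝ) (k : Fin d → ℕ) (x : Fin d → ℝ) : ℝ :=
  ∏ i, laguerreFun (α i) (k i) (x i)

/-- The derivative `δ_i = ∂_{x_i} + x_i`. -/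
def laguerreDelta (i : Fin d) (g : (Fin d → ℝ) → ℝ) (x : Fin d → ℝ) : ℝ :=
  deriv (fun t : ℝ => g (Function.update x i t)) (x i) + x i * g x

/-- The eigenvalue `λ_k = 4|k| + 2|α| + 2d` of
`L = -Δ + |x|² - ∑ i, ((2 α_i + 1) / x_i) ∂_{x_i}` at `ℓ_k^α`. -/
def laguerreEigenvalue (α : Fin d → ℝ) (k : Fin d → ℕ) : ℝ :=
  ∑ i, (4 * (k i : ℝ) + 2 * α i + 2)

/-- The term `λ_k^{-1/2} ⟨f, ℓ_k^α⟩ δ_i ℓ_k^α` of the series of the `i`-th Riesz transform. -/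
def rieszTerm (α : Fin d → ℝ) (i : Fin d) (f : (Fin d → ℝ) → ℝ) (k : Fin d → ℕ)
    (x : Fin d → ℝ) : ℝ :=
  laguerreEigenvalue α k ^ (-(1 / 2) : ℝ) *
    (∫ y, f y * laguerreTensor α k y ∂(laguerreMeasure α)) *
      laguerreDelta i (laguerreTensor α k) x

/-- `g = R_i f` for `f ∈ L²`: the series `∑_k λ_k^{-1/2} ⟨f, ℓ_k^α⟩ δ_i ℓ_k^α` converges
(unconditionally) to `g` in `L²`. -/
def IsRieszTransform (α : Fin d → ℝ) (i : Fin d) (f g : (Fin d → ℝ) → ℝ) : Prop :=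
  MemLp g 2 (laguerreMeasure α) ∧
    Tendsto
      (fun s : Finset (Fin d → ℕ) =>
        eLpNorm (fun x => g x - ∑ k ∈ s, rieszTerm α i f k x) 2 (laguerreMeasure α))
      atTop (𝓝 0)

/-- `T` is the vector `R = (R_1, …, R_d)` of Riesz transforms on `L^p`: a bounded operator from
scalar `L^p` to `ℝ^d`-valued `L^p` (with the Euclidean norm on `ℝ^d`) which on the dense subspace
`L^p ∩ L²` is given by the `L²`-convergent series. -/
def IsVectorRieszTransform (α : Fin d → ℝ) (p : ℝ≥0∞) [Fact (1 ≤ p)]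
    (T : Lp ℝ p (laguerreMeasure α) →L[ℝ]
      Lp (EuclideanSpace ℝ (Fin d)) p (laguerreMeasure α)) : Prop :=
  ∀ f : Lp ℝ p (laguerreMeasure α), MemLp f 2 (laguerreMeasure α) →
    ∀ i, IsRieszTransform α i f (fun x => T f x i)

end

/-!
The proof is a Bellman function argument of Nazarov–Treil type and gives the bound
`27 * (p* - 1)`.

For finite sums `f = ∑ k, c_k ℓ_k` and `g_i = ∑ k, e_{i,k} δ_i ℓ_k` let `u` and `v_i` be the
Poisson extensions, in which the `k`-th term acquires the factor `e^{-t √λ_k}`. Orthogonality of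
the `δ_i ℓ_k` and `∫ t e^{-2 t √λ} dt = 1 / (4 λ)` give
`∑ i, ⟨R_i f, g_i⟩ = -4 ∑ i, ∫∫ t δ_i u ∂_t v_i dμ dt` (`integral_pairing`). The extensions
satisfy `(∂_t² + ∑ j, ∂_j² + (2 α_j + 1) / x_j ∂_j) w = (|x|² + V) w` with `V = 0` for `u` and
`V = 2 + (2 α_i + 1) / x_i²` for `v_i`, and `V ≥ 0` because `α_i ≥ -1 / 2`. For the exponent
`q ≤ 2` conjugate to `p`, compose with `u` and `v` a function `b`, comparable to `|u|^p + |v|^q`,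
whose second derivative dominates `(q - 1) / 8 * N^r |du|² + (q - 1) / 2 * |v|^(q-2) |dv|²`, where
`N = |u|^p + |v|^q` and `r = (2 - q) / q` (`bellman`, `bellmanQuad_lower`). For `q > 2` the roles
of `u` and `v` are exchanged. Since `N^r |v|^(q-2) ≥ 1`, the operator above, applied to `b(u, v)`,
gives at least `(q - 1) / 3 * |∑ i, δ_i u ∂_t v_i|` (`bellmanLap_lower`). Integrating against
`t dμ dt`, by parts, leaves `∫ b(u, v)` at `t = 0` (`bilinear_embedding`); this and homogeneity
bound the pairing by `27 * (p* - 1) ‖f‖_p ‖g‖_q` (`abs_rieszForm_le`).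

The function `b` is smooth only where `u` and `v` do not vanish. Therefore `ε` times the ground
state is adjoined to both families as a further component. It also bounds all extensions and their
derivatives up to factors `e^{A |x|}`, which makes every integral converge and every boundary term
vanish; at the walls `x_j = 0` the boundary terms vanish because each component is even or odd in
`x_j`.

The passage to `L^p` rests on the density of the finite sums of the `ℓ_k`, and of those of the
`δ_i ℓ_k`, in every `L^p` with `1 ≤ p < ∞` (`exists_tensorSum_close`). These sums are the even
polynomials times the Gaussian, in the second case times `x_i` as well, so this is a weighted
approximation theorem: the Taylor series of the cosine approximates polynomials in `cos (x_i / M)`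
by even polynomials, and the former approximate bounded continuous functions by Stone–Weierstrass
(`evenPolyLimit_of_memLp`). The same theorem shows that the pairings with the `δ_i ℓ_k` determine
a function (`ae_eq_zero_of_integral_tensorFun`), which identifies the extension from finite sums
with the series on `L^p ∩ L²` (`isVectorRieszTransform_rieszLp`). The series converges in `L²`
because its terms are orthogonal and `‖δ_i ℓ_k‖² = 4 k_i ≤ λ_k` (`summable_riesz`).
-/

noncomputable section

variable {d : ℕ}

/-! ### Laguerre functions and their first-order system -/

/-- The coefficient of `u ^ j` in `L_n^a(u)`. -/
def laguerreCoeff (a : ℝ) (n j : ℕ) : ℝ :=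
  (-1 : ℝ) ^ j * (Real.Gamma (n + a + 1) / (Real.Gamma (j + a + 1) * (n - j).factorial)) /
    j.factorial

theorem laguerrePoly_eq_sum (a : ℝ) (n : ℕ) (u : ℝ) :
    laguerrePoly a n u = ∑ j ∈ Finset.range (n + 1), laguerreCoeff a n j * u ^ j := by
  unfold laguerrePoly laguerreCoeff
  exact Finset.sum_congr rfl fun j _ => by ring

theorem laguerreCoeff_succ_succ (a : ℝ) (n j : ℕ) :
    laguerreCoeff a (n + 1) (j + 1) * (j + 1) = -laguerreCoeff (a + 1) n j := by
  have h1 : (((n + 1 : ℕ) : ℝ) + a + 1) = n + (a + 1) + 1 := by push_cast; ring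
  have h2 : (((j + 1 : ℕ) : ℝ) + a + 1) = j + (a + 1) + 1 := by push_cast; ring
  have h3 : (n + 1) - (j + 1) = n - j := by omega
  unfold laguerreCoeff
  rw [h1, h2, h3, Nat.factorial_succ]
  have : (j : ℝ) + 1 ≠ 0 := by positivity
  have : (j.factorial : ℝ) ≠ 0 := by positivity
  push_cast
  field_simp
  ring

theorem hasDerivAt_laguerrePoly (a : ℝ) (n : ℕ) (u : ℝ) :
    HasDerivAt (laguerrePoly a n)
      (∑ j ∈ Finset.range (n + 1), laguerreCoeff a n j * (j * u ^ (j - 1))) u := by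
  have : laguerrePoly a n = fun u => ∑ j ∈ Finset.range (n + 1), laguerreCoeff a n j * u ^ j :=
    funext fun u => laguerrePoly_eq_sum a n u
  rw [this]
  exact HasDerivAt.fun_sum fun j _ => (hasDerivAt_pow j u).const_mul _

theorem hasDerivAt_laguerrePoly_zero (a : ℝ) (u : ℝ) : HasDerivAt (laguerrePoly a 0) 0 u := by
  simpa using hasDerivAt_laguerrePoly a 0 u

theorem hasDerivAt_laguerrePoly_succ (a : ℝ) (n : ℕ) (u : ℝ) :
    HasDerivAt (laguerrePoly a (n + 1)) (-laguerrePoly (a + 1) n u) u := by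
  convert hasDerivAt_laguerrePoly a (n + 1) u using 1
  rw [Finset.sum_range_succ', laguerrePoly_eq_sum, ← Finset.sum_neg_distrib]
  simp only [Nat.cast_zero, zero_mul, mul_zero, add_zero, Nat.add_sub_cancel]
  refine Finset.sum_congr rfl fun j _ => ?_
  rw [← neg_mul, ← laguerreCoeff_succ_succ]
  push_cast
  ring

/-- Comparison of the coefficients of `L_n^{a+1}` and `L_{n+1}^a`, which carries the raising
relation. -/
theorem laguerreCoeff_raise {a : ℝ} (ha : -1 < a) {n j : ℕ} (hj : j ≤ n) :
    laguerreCoeff (a + 1) n j * (j + a + 1) = laguerreCoeff a (n + 1) j * ((n + 1 : ℝ) - j) := by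
  have h1 : (((n + 1 : ℕ) : ℝ) + a + 1) = n + (a + 1) + 1 := by push_cast; ring
  have hp : 0 < (j : ℝ) + a + 1 := by have := Nat.cast_nonneg (α := ℝ) j; linarith
  have h2 : (j : ℝ) + (a + 1) + 1 = (j + a + 1) + 1 := by ring
  have h3 : (n + 1) - j = (n - j) + 1 := by omega
  have h4 : ((n - j : ℕ) : ℝ) = n - j := by rw [Nat.cast_sub hj]
  unfold laguerreCoeff
  rw [h1, h2, Real.Gamma_add_one hp.ne', h3, Nat.factorial_succ]
  have hG := (Real.Gamma_pos_of_pos hp).ne'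
  have h5 : (((n - j + 1 : ℕ)) : ℝ) = n + 1 - j := by push_cast; rw [h4]; ring
  have h6 : (n : ℝ) + 1 - j ≠ 0 := by rw [← h5]; positivity
  have : (j.factorial : ℝ) ≠ 0 := by positivity
  have : ((n - j).factorial : ℝ) ≠ 0 := by positivity
  rw [Nat.cast_mul, h5]
  field_simp

/-- The raising relation `u (L_n^{a+1})' + (a + 1 - u) L_n^{a+1} = (n + 1) L_{n+1}^a`. -/
theorem laguerrePoly_raise {a : ℝ} (ha : -1 < a) (n : ℕ) (u : ℝ) :
    u * (∑ j ∈ Finset.range (n + 1), laguerreCoeff (a + 1) n j * (j * u ^ (j - 1))) +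
      (a + 1 - u) * laguerrePoly (a + 1) n u = (n + 1) * laguerrePoly a (n + 1) u := by
  rw [laguerrePoly_eq_sum, laguerrePoly_eq_sum]
  have h1 : u * (∑ j ∈ Finset.range (n + 1), laguerreCoeff (a + 1) n j * (j * u ^ (j - 1)))
      = ∑ j ∈ Finset.range (n + 1), laguerreCoeff (a + 1) n j * (j * u ^ j) := by
    rw [Finset.mul_sum]
    refine Finset.sum_congr rfl fun j _ => ?_
    rcases j with _ | j
    · simp
    · simp only [Nat.add_sub_cancel, pow_succ]; ring
  have h2 : u * ∑ j ∈ Finset.range (n + 1), laguerreCoeff (a + 1) n j * u ^ j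
      = - ∑ j ∈ Finset.range (n + 2), laguerreCoeff a (n + 1) j * (j * u ^ j) := by
    rw [Finset.sum_range_succ' _ (n + 1), Finset.mul_sum]
    simp only [Nat.cast_zero, zero_mul, mul_zero, add_zero]
    rw [← Finset.sum_neg_distrib]
    refine Finset.sum_congr rfl fun j _ => ?_
    have := laguerreCoeff_succ_succ a n j
    push_cast
    rw [pow_succ]
    linear_combination (u ^ j * u) * this
  have h3 : ∑ j ∈ Finset.range (n + 1), laguerreCoeff (a + 1) n j * (j * u ^ j) +
      (a + 1) * ∑ j ∈ Finset.range (n + 1), laguerreCoeff (a + 1) n j * u ^ j =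
      ∑ j ∈ Finset.range (n + 2), laguerreCoeff a (n + 1) j * (((n + 1 : ℝ) - j) * u ^ j) := by
    rw [Finset.sum_range_succ _ (n + 1), Finset.mul_sum, ← Finset.sum_add_distrib]
    have : ((n + 1 : ℝ) - ((n + 1 : ℕ) : ℝ)) = 0 := by push_cast; ring
    rw [this, zero_mul, mul_zero, add_zero]
    refine Finset.sum_congr rfl fun j hj => ?_
    have := laguerreCoeff_raise ha (Nat.lt_succ_iff.1 (Finset.mem_range.1 hj))
    linear_combination u ^ j * this
  have h4 : (n + 1 : ℝ) * ∑ j ∈ Finset.range (n + 1 + 1), laguerreCoeff a (n + 1) j * u ^ j =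
      ∑ j ∈ Finset.range (n + 2), laguerreCoeff a (n + 1) j * (((n + 1 : ℝ) - j) * u ^ j) +
      ∑ j ∈ Finset.range (n + 2), laguerreCoeff a (n + 1) j * (j * u ^ j) := by
    rw [Finset.mul_sum, ← Finset.sum_add_distrib]
    exact Finset.sum_congr rfl fun j _ => by ring
  rw [h1, sub_mul, h2, h4]
  linear_combination h3

/-- `laguerreQuot a n x = (∂ + x) ℓ_n^a (x) / x = -2 √n ℓ_{n-1}^{a+1}(x)`. -/
def laguerreQuot (a : ℝ) : ℕ → ℝ → ℝ
  | 0, _ => 0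
  | n + 1, x => -2 * Real.sqrt (n + 1) * laguerreFun (a + 1) n x

/-- `laguerreDel a n = (∂ + x) ℓ_n^a`, in closed form. -/
def laguerreDel (a : ℝ) (n : ℕ) (x : ℝ) : ℝ := x * laguerreQuot a n x

/-- The normalizing constants of `ℓ_{n+1}^a` and `ℓ_n^{a+1}` differ by the factor `√(n + 1)`. -/
theorem laguerre_norm_succ (a : ℝ) (n : ℕ) :
    Real.sqrt (2 * (n + 1).factorial / Real.Gamma ((n + 1 : ℕ) + a + 1)) =
      Real.sqrt (n + 1) * Real.sqrt (2 * n.factorial / Real.Gamma (n + (a + 1) + 1)) := by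
  rw [← Real.sqrt_mul (by positivity)]
  congr 1
  rw [Nat.factorial_succ]
  have h1 : (((n + 1 : ℕ) : ℝ) + a + 1) = n + (a + 1) + 1 := by push_cast; ring
  rw [h1]
  push_cast
  ring

theorem hasDerivAt_gauss (x : ℝ) :
    HasDerivAt (fun x : ℝ => Real.exp (-x ^ 2 / 2)) (-x * Real.exp (-x ^ 2 / 2)) x := by
  have : HasDerivAt (fun x : ℝ => -x ^ 2 / 2) (-x) x := by
    refine ((hasDerivAt_pow 2 x).fun_neg.div_const 2).congr_deriv ?_
    norm_num
    ring
  convert this.exp using 1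
  ring

theorem hasDerivAt_laguerreFun_aux (a : ℝ) (n : ℕ) (x L' : ℝ)
    (h : HasDerivAt (laguerrePoly a n) L' (x ^ 2)) :
    HasDerivAt (laguerreFun a n)
      (Real.sqrt (2 * n.factorial / Real.Gamma (n + a + 1)) * (L' * (2 * x)) *
        Real.exp (-x ^ 2 / 2) - x * laguerreFun a n x) x := by
  have h2 : HasDerivAt (fun x : ℝ => x ^ 2) (2 * x) x := by simpa using hasDerivAt_pow 2 x
  have h3 := ((HasDerivAt.comp x (h₂ := laguerrePoly a n) (h := fun x : ℝ => x ^ 2) h h2).const_mul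
    (Real.sqrt (2 * n.factorial / Real.Gamma (n + a + 1)))).mul (hasDerivAt_gauss x)
  refine h3.congr_deriv ?_
  simp only [laguerreFun, Function.comp]
  ring

/-- First half of the first-order system: `ℓ' = m - x ℓ` for `ℓ = ℓ_n^a` and `m = laguerreDel a n`.
-/
theorem hasDerivAt_laguerreFun (a : ℝ) (n : ℕ) (x : ℝ) :
    HasDerivAt (laguerreFun a n) (laguerreDel a n x - x * laguerreFun a n x) x := by
  rcases n with _ | n
  · refine (hasDerivAt_laguerreFun_aux a 0 x 0 (hasDerivAt_laguerrePoly_zero a _)).congr_deriv ?_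
    simp [laguerreDel, laguerreQuot]
  · refine (hasDerivAt_laguerreFun_aux a (n + 1) x _
      (hasDerivAt_laguerrePoly_succ a n _)).congr_deriv ?_
    rw [laguerre_norm_succ]
    simp only [laguerreDel, laguerreQuot, laguerreFun]
    ring

/-- Second half of the first-order system: `m' = (x - (2 a + 1) / x) m - 4 n ℓ`. The quotient
`m / x` is written as `laguerreQuot`, so that the formula also holds at `x = 0`. -/
theorem hasDerivAt_laguerreDel {a : ℝ} (ha : -1 < a) (n : ℕ) (x : ℝ) :
    HasDerivAt (laguerreDel a n)
      (x * laguerreDel a n x - (2 * a + 1) * laguerreQuot a n x - 4 * n * laguerreFun a n x) x := by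
  rcases n with _ | n
  · have : laguerreDel a 0 = fun _ => 0 := by funext x; simp [laguerreDel, laguerreQuot]
    rw [this]
    refine (hasDerivAt_const x (0 : ℝ)).congr_deriv ?_
    simp [laguerreQuot]
  · have h := ((hasDerivAt_laguerreFun_aux (a + 1) n x _
      (hasDerivAt_laguerrePoly (a + 1) n _)).const_mul (-2 * Real.sqrt (n + 1)))
    have h2 := (hasDerivAt_id x).mul h
    refine h2.congr_deriv ?_
    have hr := laguerrePoly_raise ha n (x ^ 2)
    simp only [id, laguerreDel, laguerreQuot, laguerreFun]
    rw [laguerre_norm_succ]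
    set S := ∑ j ∈ Finset.range (n + 1), laguerreCoeff (a + 1) n j * (j * (x ^ 2) ^ (j - 1))
    set c := Real.sqrt (2 * n.factorial / Real.Gamma (n + (a + 1) + 1))
    push_cast
    linear_combination (-4 * Real.sqrt (n + 1) * c * Real.exp (-x ^ 2 / 2)) * hr

theorem continuous_laguerreFun (a : ℝ) (n : ℕ) : Continuous (laguerreFun a n) :=
  continuous_iff_continuousAt.2 fun x => (hasDerivAt_laguerreFun a n x).continuousAt

theorem continuous_laguerreQuot (a : ℝ) (n : ℕ) : Continuous (laguerreQuot a n) := by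
  rcases n with _ | n
  · exact continuous_const
  · exact continuous_const.mul (continuous_laguerreFun (a + 1) n)

theorem continuous_laguerreDel (a : ℝ) (n : ℕ) : Continuous (laguerreDel a n) :=
  continuous_id.mul (continuous_laguerreQuot a n)

/-! ### Gaussian bounds -/

theorem le_exp_mul_one_add {C x : ℝ} (hC : 0 ≤ C) (hx : 0 ≤ x) : C ≤ Real.exp (C * (1 + x)) := by
  have := Real.add_one_le_exp (C * (1 + x))
  nlinarith [mul_nonneg hC hx]

theorem exists_pow_le_exp (j : ℕ) :
    ∃ A, 0 ≤ A ∧ ∀ x : ℝ, 0 ≤ x → x ^ j ≤ Real.exp (A * (1 + x)) := by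
  refine ⟨j.factorial + 1, by positivity, fun x hx => ?_⟩
  have h1 := Real.pow_div_factorial_le_exp x hx j
  rw [div_le_iff₀ (by positivity)] at h1
  refine h1.trans ?_
  have h2 : (j.factorial : ℝ) ≤ Real.exp (j.factorial * (1 + x)) :=
    le_exp_mul_one_add (by positivity) hx
  calc Real.exp x * j.factorial ≤ Real.exp x * Real.exp (j.factorial * (1 + x)) := by gcongr
    _ = Real.exp (x + j.factorial * (1 + x)) := by rw [Real.exp_add]
    _ ≤ _ := by apply Real.exp_le_exp.2; nlinarith

theorem exp_add_exp_le {A B x : ℝ} (hA : 0 ≤ A) (hB : 0 ≤ B) (hx : 0 ≤ x) :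
    Real.exp (A * (1 + x)) + Real.exp (B * (1 + x)) ≤ Real.exp ((A + B + 1) * (1 + x)) := by
  have h1 : (1 : ℝ) ≤ Real.exp (A * (1 + x)) := Real.one_le_exp (by positivity)
  have h2 : (1 : ℝ) ≤ Real.exp (B * (1 + x)) := Real.one_le_exp (by positivity)
  have h3 : (2 : ℝ) ≤ Real.exp (1 + x) := by have := Real.add_one_le_exp (1 + x); linarith
  have : Real.exp ((A + B + 1) * (1 + x)) =
      Real.exp (A * (1 + x)) * Real.exp (B * (1 + x)) * Real.exp (1 + x) := by
    rw [← Real.exp_add, ← Real.exp_add]; congr 1; ring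
  rw [this]
  nlinarith [mul_nonneg (sub_nonneg.2 h1) (sub_nonneg.2 h2),
    mul_pos (Real.exp_pos (A * (1 + x))) (Real.exp_pos (B * (1 + x)))]

/-- `f` is bounded on the half-line by an exponential times `exp (-x² / 2)`. -/
def HalfLineBound (f : ℝ → ℝ) : Prop :=
  ∃ A, 0 ≤ A ∧ ∀ x : ℝ, 0 ≤ x → |f x| ≤ Real.exp (A * (1 + x)) * Real.exp (-x ^ 2 / 2)

theorem halfLineBound_laguerreFun (a : ℝ) (n : ℕ) :
    HalfLineBound (laguerreFun a n) := by
  have key : ∀ (s : Finset ℕ) (c : ℕ → ℝ), ∃ A, 0 ≤ A ∧ ∀ x : ℝ, 0 ≤ x →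
      |∑ j ∈ s, c j * (x ^ 2) ^ j| ≤ Real.exp (A * (1 + x)) := by
    intro s c
    induction s using Finset.induction_on with
    | empty => exact ⟨0, le_rfl, fun x _ => by simp⟩
    | insert i s hi ih =>
      obtain ⟨A, hA, h⟩ := ih
      obtain ⟨B, hB, h'⟩ := exists_pow_le_exp (2 * i)
      refine ⟨(|c i| + B) + A + 1, by positivity, fun x hx => ?_⟩
      rw [Finset.sum_insert hi]
      refine (abs_add_le _ _).trans (le_trans (add_le_add ?_ (h x hx))
        (exp_add_exp_le (by positivity) hA hx))
      rw [abs_mul, ← pow_mul, abs_of_nonneg (pow_nonneg hx _), add_mul, Real.exp_add]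
      exact mul_le_mul (le_exp_mul_one_add (abs_nonneg _) hx) (h' x hx) (by positivity)
        (Real.exp_pos _).le
  obtain ⟨A, hA, h⟩ := key (Finset.range (n + 1)) (laguerreCoeff a n)
  set C := Real.sqrt (2 * n.factorial / Real.Gamma (n + a + 1))
  refine ⟨C + A, by positivity, fun x hx => ?_⟩
  rw [laguerreFun, abs_mul, abs_of_pos (Real.exp_pos _), abs_mul, laguerrePoly_eq_sum,
    abs_of_nonneg (Real.sqrt_nonneg _), add_mul, Real.exp_add]
  gcongr
  · exact le_exp_mul_one_add (Real.sqrt_nonneg _) hx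
  · exact h x hx

theorem halfLineBound_laguerreQuot (a : ℝ) (n : ℕ) :
    HalfLineBound (laguerreQuot a n) := by
  rcases n with _ | n
  · exact ⟨0, le_rfl, fun x _ => by simp [laguerreQuot, Real.exp_nonneg]⟩
  · obtain ⟨A, hA, h⟩ := halfLineBound_laguerreFun (a + 1) n
    set C := |-2 * Real.sqrt (n + 1)| with hC
    refine ⟨C + A, by positivity, fun x hx => ?_⟩
    rw [laguerreQuot, abs_mul, add_mul, Real.exp_add, mul_assoc]
    gcongr
    · exact le_exp_mul_one_add (abs_nonneg _) hx
    · exact h x hx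

/-! ### The half-line measure -/

/-- The measure `x ^ (2 a + 1) dx` on `(0, ∞)`, the one-dimensional factor of `laguerreMeasure`. -/
def halfLineMeasure (a : ℝ) : Measure ℝ :=
  ((volume : Measure ℝ).restrict (Set.Ioi 0)).withDensity fun x => ENNReal.ofReal (x ^ (2 * a + 1))

theorem laguerreMeasure_eq {d : ℕ} (α : Fin d → ℝ) :
    laguerreMeasure α = Measure.pi fun i => halfLineMeasure (α i) := rfl

theorem measurable_halfLine_density (a : ℝ) : Measurable fun x : ℝ => x ^ (2 * a + 1) :=
  measurable_id.pow_const _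

instance (a : ℝ) : SigmaFinite (halfLineMeasure a) := by
  unfold halfLineMeasure
  have : (fun x : ℝ => ENNReal.ofReal (x ^ (2 * a + 1))) =
      fun x => ((Real.toNNReal (x ^ (2 * a + 1)) : NNReal) : ℝ≥0∞) := rfl
  rw [this]
  infer_instance

theorem halfLineMeasure_ae_pos (a : ℝ) : ∀ᵐ x ∂halfLineMeasure a, 0 < x :=
  (withDensity_absolutelyContinuous _ _).ae_le (ae_restrict_mem measurableSet_Ioi)

theorem integral_halfLine (a : ℝ) (f : ℝ → ℝ) :
    ∫ x, f x ∂halfLineMeasure a = ∫ x in Set.Ioi (0 : ℝ), x ^ (2 * a + 1) * f x := by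
  unfold halfLineMeasure
  rw [integral_withDensity_eq_integral_toReal_smul
    (measurable_halfLine_density a).ennreal_ofReal (ae_of_all _ fun x => ENNReal.ofReal_lt_top)]
  refine setIntegral_congr_fun measurableSet_Ioi fun x hx => ?_
  rw [ENNReal.toReal_ofReal (Real.rpow_nonneg (le_of_lt hx) _), smul_eq_mul]

theorem integrable_halfLine_iff (a : ℝ) (f : ℝ → ℝ) :
    Integrable f (halfLineMeasure a) ↔
      IntegrableOn (fun x => x ^ (2 * a + 1) * f x) (Set.Ioi (0 : ℝ)) := by
  unfold halfLineMeasure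
  rw [integrable_withDensity_iff_integrable_smul'
    (measurable_halfLine_density a).ennreal_ofReal (ae_of_all _ fun x => ENNReal.ofReal_lt_top)]
  refine integrableOn_congr_fun (fun x hx => ?_) measurableSet_Ioi
  rw [ENNReal.toReal_ofReal (Real.rpow_nonneg (le_of_lt hx) _), smul_eq_mul]

/-- Exponential growth is absorbed by half of a Gaussian. -/
theorem exp_mul_gauss_le {c : ℝ} (hc : 0 < c) (A x : ℝ) :
    Real.exp (A * (1 + x)) * Real.exp (-c * x ^ 2) ≤
      Real.exp (A + A ^ 2 / (2 * c)) * Real.exp (-(c / 2) * x ^ 2) := by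
  rw [← Real.exp_add, ← Real.exp_add]
  apply Real.exp_le_exp.2
  have h : 0 ≤ (A - c * x) ^ 2 / (2 * c) := by positivity
  have h2 : (A - c * x) ^ 2 / (2 * c) = A ^ 2 / (2 * c) - A * x + c / 2 * x ^ 2 := by
    field_simp
    ring
  linarith

theorem integrable_exp_gauss {a : ℝ} (ha : -(1 / 2) ≤ a) (A : ℝ) {c : ℝ} (hc : 0 < c) :
    Integrable (fun x => Real.exp (A * (1 + x)) * Real.exp (-c * x ^ 2)) (halfLineMeasure a) := by
  rw [integrable_halfLine_iff]
  have h := (integrable_rpow_mul_exp_neg_mul_sq (half_pos hc) (s := 2 * a + 1)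
    (by linarith)).const_mul (Real.exp (A + A ^ 2 / (2 * c)))
  refine Integrable.mono' h.integrableOn ?_ ?_
  · refine AEStronglyMeasurable.mul (measurable_halfLine_density a).aestronglyMeasurable ?_
    exact (by fun_prop : Continuous fun x : ℝ =>
      Real.exp (A * (1 + x)) * Real.exp (-c * x ^ 2)).aestronglyMeasurable
  · filter_upwards [ae_restrict_mem measurableSet_Ioi] with x hx
    have h0 := Real.rpow_nonneg (le_of_lt hx) (2 * a + 1)
    rw [Real.norm_of_nonneg (by positivity)]
    calc _ ≤ x ^ (2 * a + 1) *
          (Real.exp (A + A ^ 2 / (2 * c)) * Real.exp (-(c / 2) * x ^ 2)) :=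
          mul_le_mul_of_nonneg_left (exp_mul_gauss_le hc A x) h0
      _ = _ := by ring

theorem tendsto_exp_gauss (A : ℝ) {c : ℝ} (hc : 0 < c) (s : ℝ) :
    Tendsto (fun x => x ^ s * (Real.exp (A * (1 + x)) * Real.exp (-c * x ^ 2))) atTop (𝓝 0) := by
  have h := (rpow_mul_exp_neg_mul_sq_isLittleO_exp_neg (half_pos hc) s).trans_tendsto
    (g'' := fun x : ℝ => Real.exp (-(1 / 2) * x)) (by
      have : Tendsto (fun x : ℝ => -(1 / 2) * x) atTop atBot :=
        tendsto_id.const_mul_atTop_of_neg (by norm_num)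
      exact Real.tendsto_exp_atBot.comp this)
  have h2 := h.const_mul (Real.exp (A + A ^ 2 / (2 * c)))
  rw [mul_zero] at h2
  refine tendsto_of_tendsto_of_tendsto_of_le_of_le' tendsto_const_nhds h2 ?_ ?_
  · filter_upwards [eventually_ge_atTop 0] with x hx
    have := Real.rpow_nonneg hx s
    positivity
  · filter_upwards [eventually_ge_atTop 0] with x hx
    have h0 := Real.rpow_nonneg hx s
    calc _ ≤ x ^ s *
          (Real.exp (A + A ^ 2 / (2 * c)) * Real.exp (-(c / 2) * x ^ 2)) :=
          mul_le_mul_of_nonneg_left (exp_mul_gauss_le hc A x) h0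
      _ = _ := by ring

/-- The divergence `φ' + (2 a + 1) / x * φ` of a Gaussian-decaying field that vanishes at `0` to
first order has integral `0` with respect to `x ^ (2 a + 1) dx`. -/
theorem integral_divergence_eq_zero {a : ℝ} (ha : -(1 / 2) ≤ a) {A c : ℝ} (hc : 0 < c)
    {φ φ' : ℝ → ℝ} (hderiv : ∀ x, 0 < x → HasDerivAt φ (φ' x) x)
    (hb : ∀ x, 0 < x → |φ x| ≤ x * (Real.exp (A * (1 + x)) * Real.exp (-c * x ^ 2)))
    (hint : Integrable (fun x => φ' x + (2 * a + 1) / x * φ x) (halfLineMeasure a)) :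
    ∫ x, (φ' x + (2 * a + 1) / x * φ x) ∂halfLineMeasure a = 0 := by
  rw [integral_halfLine]
  -- The factor `x ^ (2 a + 2)`, unlike `x ^ (2 a + 1)`, vanishes at `0` also when `a = -1 / 2`.
  set F : ℝ → ℝ := fun x => x ^ (2 * a + 2) * (φ x / x) with hF
  have hF0 : F 0 = 0 := by simp [hF]
  have hFle : ∀ x, 0 < x → |F x| ≤
      x ^ (2 * a + 2) * (Real.exp (A * (1 + x)) * Real.exp (-c * x ^ 2)) := by
    intro x hx
    have h0 := Real.rpow_nonneg hx.le (2 * a + 2)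
    rw [hF, abs_mul, abs_of_nonneg h0, abs_div, abs_of_pos hx]
    refine mul_le_mul_of_nonneg_left ?_ h0
    rw [div_le_iff₀ hx, mul_comm]
    exact hb x hx
  have h1 := integral_Ioi_of_hasDerivAt_of_tendsto (f := F) (a := 0) (m := 0)
    (f' := fun x => x ^ (2 * a + 1) * (φ' x + (2 * a + 1) / x * φ x)) ?_ ?_ ?_ ?_
  · rw [h1, hF0, sub_zero]
  · rw [ContinuousWithinAt, hF0]
    have hlim : Tendsto (fun x : ℝ => |x| ^ (2 * a + 2) *
        (Real.exp (A * (1 + x)) * Real.exp (-c * x ^ 2))) (𝓝[Set.Ici 0] 0) (𝓝 0) := by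
      have : Continuous fun x : ℝ => |x| ^ (2 * a + 2) *
          (Real.exp (A * (1 + x)) * Real.exp (-c * x ^ 2)) := by
        refine Continuous.mul ?_ (by fun_prop)
        exact continuous_abs.rpow_const fun x => Or.inr (by linarith)
      have h := this.tendsto 0
      have hz : (0 : ℝ) ^ (2 * a + 2) = 0 := Real.zero_rpow (by linarith)
      simp only [abs_zero, hz, zero_mul] at h
      exact h.mono_left nhdsWithin_le_nhds
    refine squeeze_zero_norm' ?_ hlim
    filter_upwards [self_mem_nhdsWithin] with x hx
    rcases (show (0 : ℝ) ≤ x from hx).eq_or_lt with rfl | hx'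
    · rw [hF0, norm_zero]; positivity
    · rw [abs_of_pos hx']; exact hFle x hx'
  · intro x hx
    have hx' : 0 < x := hx
    have h2 : HasDerivAt (fun x : ℝ => x ^ (2 * a + 1) * φ x)
        ((2 * a + 1) * x ^ (2 * a + 1 - 1) * φ x + x ^ (2 * a + 1) * φ' x) x :=
      (Real.hasDerivAt_rpow_const (Or.inl hx'.ne')).mul (hderiv x hx')
    have h3 : F =ᶠ[𝓝 x] fun x : ℝ => x ^ (2 * a + 1) * φ x := by
      filter_upwards [Ioi_mem_nhds hx'] with y hy
      have hy' : 0 < y := hy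
      have : 2 * a + 2 = (2 * a + 1) + 1 := by ring
      simp only [hF]
      rw [this, Real.rpow_add_one hy'.ne']
      field_simp
    refine (h2.congr_of_eventuallyEq h3).congr_deriv ?_
    rw [Real.rpow_sub_one hx'.ne']
    field_simp
    ring
  · exact (integrable_halfLine_iff _ _).1 hint
  · refine squeeze_zero_norm' ?_ (tendsto_exp_gauss A hc (2 * a + 2))
    filter_upwards [eventually_gt_atTop 0] with x hx using hFle x hx

/-! ### Orthogonality on the half-line -/

theorem abs_mul_le_gauss {A B x u v : ℝ}
    (hu : |u| ≤ Real.exp (A * (1 + x)) * Real.exp (-x ^ 2 / 2))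
    (hv : |v| ≤ Real.exp (B * (1 + x)) * Real.exp (-x ^ 2 / 2)) :
    |u * v| ≤ Real.exp ((A + B) * (1 + x)) * Real.exp (-1 * x ^ 2) := by
  rw [abs_mul]
  refine (mul_le_mul hu hv (abs_nonneg _) (by positivity)).trans_eq ?_
  rw [mul_mul_mul_comm, ← Real.exp_add, ← Real.exp_add]
  congr 2 <;> ring

theorem integrable_gauss_mul {a : ℝ} (ha : -(1 / 2) ≤ a) {f g : ℝ → ℝ} (hf : Continuous f)
    (hg : Continuous g)
    (hfb : HalfLineBound f)
    (hgb : HalfLineBound g) :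
    Integrable (fun x => f x * g x) (halfLineMeasure a) := by
  obtain ⟨A, _, hA⟩ := hfb
  obtain ⟨B, _, hB⟩ := hgb
  refine Integrable.mono' (integrable_exp_gauss ha (A + B) one_pos)
    (hf.mul hg).aestronglyMeasurable ?_
  filter_upwards [halfLineMeasure_ae_pos a] with x hx
  exact abs_mul_le_gauss (hA x hx.le) (hB x hx.le)

theorem HalfLineBound.id_mul {f : ℝ → ℝ}
    (hf : HalfLineBound f) :
    HalfLineBound fun x => x * f x := by
  obtain ⟨A, hA, h⟩ := hf
  refine ⟨1 + A, by positivity, fun x hx => ?_⟩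
  rw [abs_mul, abs_of_nonneg hx, add_mul, Real.exp_add, mul_assoc]
  refine mul_le_mul ?_ (h x hx) (abs_nonneg _) (Real.exp_pos _).le
  have := Real.add_one_le_exp (1 * (1 + x))
  linarith

theorem halfLineBound_laguerreDel (a : ℝ) (n : ℕ) :
    HalfLineBound (laguerreDel a n) :=
  HalfLineBound.id_mul (halfLineBound_laguerreQuot a n)

/-- `⟨δ ℓ_n, δ ℓ_k⟩ = 4 n ⟨ℓ_n, ℓ_k⟩` for `δ = ∂ + x`: the difference of the integrands is the
weighted divergence of `(δ ℓ_n) ℓ_k`. -/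
theorem integral_laguerreDel_mul {a : ℝ} (ha : -(1 / 2) ≤ a) (n k : ℕ) :
    ∫ x, laguerreDel a n x * laguerreDel a k x ∂halfLineMeasure a =
      4 * n * ∫ x, laguerreFun a n x * laguerreFun a k x ∂halfLineMeasure a := by
  have hi1 := integrable_gauss_mul ha (continuous_laguerreDel a n) (continuous_laguerreDel a k)
    (halfLineBound_laguerreDel a n) (halfLineBound_laguerreDel a k)
  have hi2 := (integrable_gauss_mul ha (continuous_laguerreFun a n) (continuous_laguerreFun a k)
    (halfLineBound_laguerreFun a n) (halfLineBound_laguerreFun a k)).const_mul (4 * n : ℝ)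
  rw [← integral_const_mul, ← sub_eq_zero, ← integral_sub hi1 hi2]
  obtain ⟨A, _, hA⟩ := halfLineBound_laguerreQuot a n
  obtain ⟨B, _, hB⟩ := halfLineBound_laguerreFun a k
  have key : ∀ x, 0 < x →
      laguerreDel a n x * laguerreDel a k x - 4 * n * (laguerreFun a n x * laguerreFun a k x) =
      (x * laguerreDel a n x - (2 * a + 1) * laguerreQuot a n x - 4 * n * laguerreFun a n x) *
        laguerreFun a k x + laguerreDel a n x * (laguerreDel a k x - x * laguerreFun a k x) +
      (2 * a + 1) / x * (laguerreDel a n x * laguerreFun a k x) := by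
    intro x hx
    unfold laguerreDel
    field_simp
    ring
  have hae : (fun x => laguerreDel a n x * laguerreDel a k x -
      4 * n * (laguerreFun a n x * laguerreFun a k x)) =ᵐ[halfLineMeasure a] fun x =>
      (x * laguerreDel a n x - (2 * a + 1) * laguerreQuot a n x - 4 * n * laguerreFun a n x) *
        laguerreFun a k x + laguerreDel a n x * (laguerreDel a k x - x * laguerreFun a k x) +
      (2 * a + 1) / x * (laguerreDel a n x * laguerreFun a k x) := by
    filter_upwards [halfLineMeasure_ae_pos a] with x hx using key x hx
  rw [integral_congr_ae hae]
  refine integral_divergence_eq_zero (A := A + B) ha one_pos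
    (φ := fun x => laguerreDel a n x * laguerreFun a k x)
    (fun x hx => ((hasDerivAt_laguerreDel (by linarith) n x).mul (hasDerivAt_laguerreFun a k x)))
    (fun x hx => ?_) ((hi1.sub hi2).congr hae)
  rw [laguerreDel, mul_assoc, abs_mul, abs_of_pos hx]
  exact mul_le_mul_of_nonneg_left (abs_mul_le_gauss (hA x hx.le) (hB x hx.le)) hx.le

theorem integral_laguerreFun_zero_sq {a : ℝ} (ha : -(1 / 2) ≤ a) :
    ∫ x, laguerreFun a 0 x * laguerreFun a 0 x ∂halfLineMeasure a = 1 := by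
  have hG := Real.Gamma_pos_of_pos (show 0 < a + 1 by linarith)
  have h1 : ∀ x : ℝ, laguerreFun a 0 x * laguerreFun a 0 x =
      2 / Real.Gamma (a + 1) * Real.exp (-x ^ (2 : ℝ)) := by
    intro x
    have h2 : laguerrePoly a 0 (x ^ 2) = 1 := by
      simp [laguerrePoly, hG.ne']
    rw [laguerreFun, h2]
    simp only [CharP.cast_eq_zero, zero_add, Nat.factorial_zero, Nat.cast_one, mul_one]
    rw [mul_mul_mul_comm, Real.mul_self_sqrt (by positivity), ← Real.exp_add, Real.rpow_two]
    congr 2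
    ring
  rw [integral_halfLine]
  have h3 := integral_rpow_mul_exp_neg_rpow (p := 2) (q := 2 * a + 1) (by norm_num) (by linarith)
  have h4 : (2 * a + 1 + 1) / 2 = a + 1 := by ring
  rw [h4] at h3
  calc _ = ∫ x in Set.Ioi (0 : ℝ), 2 / Real.Gamma (a + 1) *
        (x ^ (2 * a + 1) * Real.exp (-x ^ (2 : ℝ))) := by
        congr 1; funext x; rw [h1]; ring
    _ = 1 := by
        rw [integral_const_mul, h3]
        field_simp

theorem integral_halfLine_sq (a : ℝ) (f : ℝ → ℝ) :
    ∫ x, x ^ 2 * f x ∂halfLineMeasure a = ∫ x, f x ∂halfLineMeasure (a + 1) := by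
  rw [integral_halfLine, integral_halfLine]
  refine setIntegral_congr_fun measurableSet_Ioi fun x hx => ?_
  have : 2 * (a + 1) + 1 = (2 * a + 1) + (2 : ℕ) := by push_cast; ring
  rw [this, Real.rpow_add_natCast (ne_of_gt hx)]
  ring

/-- The functions `δ ℓ_{n+1}^a` are multiples of `x ℓ_n^{a+1}`, and the factor `x²` turns the weight
with parameter `a` into the one with parameter `a + 1`. -/
theorem integral_laguerreDel_succ (a : ℝ) (n k : ℕ) :
    ∫ x, laguerreDel a (n + 1) x * laguerreDel a (k + 1) x ∂halfLineMeasure a =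
      4 * Real.sqrt (n + 1) * Real.sqrt (k + 1) *
        ∫ x, laguerreFun (a + 1) n x * laguerreFun (a + 1) k x ∂halfLineMeasure (a + 1) := by
  rw [← integral_const_mul, ← integral_halfLine_sq]
  congr 1
  funext x
  simp only [laguerreDel, laguerreQuot]
  ring

/-- The functions `ℓ_n^a` are orthonormal. Pairing with `∂ + x` turns `⟨ℓ_n^a, ℓ_k^a⟩` into
`⟨ℓ_{n-1}^{a+1}, ℓ_{k-1}^{a+1}⟩`, which gives an induction on the degree. -/
theorem integral_laguerreFun_mul {a : ℝ} (ha : -(1 / 2) ≤ a) (n k : ℕ) :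
    ∫ x, laguerreFun a n x * laguerreFun a k x ∂halfLineMeasure a = if n = k then 1 else 0 := by
  induction n generalizing a k with
  | zero =>
    rcases k with _ | k
    · simpa using integral_laguerreFun_zero_sq ha
    · have h := integral_laguerreDel_mul ha (k + 1) 0
      have h0 : ∀ x, laguerreDel a 0 x = 0 := fun x => by simp [laguerreDel, laguerreQuot]
      simp only [h0, mul_zero, integral_zero] at h
      simp only [mul_comm (laguerreFun a 0 _)]
      have h4 : (4 * ((k + 1 : ℕ) : ℝ)) ≠ 0 := by positivity
      simpa [h4] using (mul_eq_zero.1 h.symm).resolve_left h4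
  | succ n ih =>
    rcases k with _ | k
    · have h := integral_laguerreDel_mul ha (n + 1) 0
      have h0 : ∀ x, laguerreDel a 0 x = 0 := fun x => by simp [laguerreDel, laguerreQuot]
      simp only [h0, mul_zero, integral_zero] at h
      have h4 : (4 * ((n + 1 : ℕ) : ℝ)) ≠ 0 := by positivity
      simpa [h4] using (mul_eq_zero.1 h.symm).resolve_left h4
    · have h := integral_laguerreDel_mul ha (n + 1) (k + 1)
      rw [integral_laguerreDel_succ, ih (by linarith)] at h
      have h4 : (4 * ((n + 1 : ℕ) : ℝ)) ≠ 0 := by positivity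
      by_cases hnk : n = k
      · subst hnk
        have hs : Real.sqrt ((n : ℝ) + 1) * Real.sqrt ((n : ℝ) + 1) = n + 1 :=
          Real.mul_self_sqrt (by positivity)
        rw [if_pos rfl, mul_one] at h
        rw [if_pos rfl]
        apply mul_left_cancel₀ h4
        rw [← h, mul_assoc, hs]
        push_cast
        ring
      · rw [if_neg hnk, mul_zero] at h
        rw [if_neg (by simpa using hnk)]
        exact (mul_eq_zero.1 h.symm).resolve_left h4

/-! ### Even monomials as combinations of Laguerre functions -/

theorem laguerreCoeff_self_ne_zero {a : ℝ} (ha : -1 < a) (n : ℕ) : laguerreCoeff a n n ≠ 0 := by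
  have hG : Real.Gamma ((n : ℝ) + a + 1) ≠ 0 :=
    (Real.Gamma_pos_of_pos (by have := Nat.cast_nonneg (α := ℝ) n; linarith)).ne'
  unfold laguerreCoeff
  simp only [Nat.sub_self, Nat.factorial_zero, Nat.cast_one, mul_one]
  have : (n.factorial : ℝ) ≠ 0 := by positivity
  exact div_ne_zero (mul_ne_zero (by simp) (div_ne_zero hG hG)) this

/-- Every even monomial times the Gaussian is a finite combination of Laguerre functions. -/
theorem exists_sum_laguerreFun {a : ℝ} (ha : -1 < a) (n : ℕ) :
    ∃ c : ℕ → ℝ, ∀ x : ℝ, x ^ (2 * n) * Real.exp (-x ^ 2 / 2) =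
      ∑ j ∈ Finset.range (n + 1), c j * laguerreFun a j x := by
  induction n using Nat.strong_induction_on with
  | _ n ih =>
    choose! C hC using ih
    -- Solve the expansion of `ℓ_n^a` for its leading monomial and insert the lower ones.
    set K := Real.sqrt (2 * n.factorial / Real.Gamma (n + a + 1))
    have hK : K ≠ 0 := by
      have hG := (Real.Gamma_pos_of_pos (show 0 < (n : ℝ) + a + 1 by
        have := Nat.cast_nonneg (α := ℝ) n; linarith))
      exact (Real.sqrt_pos.2 (by positivity)).ne'
    have hn := laguerreCoeff_self_ne_zero ha n
    refine ⟨fun j => if j = n then (K * laguerreCoeff a n n)⁻¹ else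
      -(laguerreCoeff a n n)⁻¹ * ∑ i ∈ Finset.range n,
        if j < i + 1 then laguerreCoeff a n i * C i j else 0, fun x => ?_⟩
    rw [Finset.sum_range_succ]
    simp only [if_true]
    have h1 : laguerreFun a n x = K * (laguerreCoeff a n n * (x ^ (2 * n) * Real.exp (-x ^ 2 / 2)) +
        ∑ i ∈ Finset.range n, laguerreCoeff a n i * (x ^ (2 * i) * Real.exp (-x ^ 2 / 2))) := by
      rw [laguerreFun, laguerrePoly_eq_sum, Finset.sum_range_succ, mul_assoc, add_mul,
        Finset.sum_mul]
      simp only [← pow_mul]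
      simp only [mul_assoc]
      exact congrArg (K * ·) (add_comm _ _)
    have h2 : ∑ i ∈ Finset.range n, laguerreCoeff a n i * (x ^ (2 * i) * Real.exp (-x ^ 2 / 2)) =
        ∑ j ∈ Finset.range n, (∑ i ∈ Finset.range n,
          if j < i + 1 then laguerreCoeff a n i * C i j else 0) * laguerreFun a j x := by
      simp only [Finset.sum_mul]
      rw [Finset.sum_comm]
      refine Finset.sum_congr rfl fun i hi => ?_
      rw [hC i (Finset.mem_range.1 hi) x, Finset.mul_sum]
      have hsub : Finset.range (i + 1) ⊆ Finset.range n := by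
        intro j hj
        have := Finset.mem_range.1 hi
        have := Finset.mem_range.1 hj
        exact Finset.mem_range.2 (by omega)
      rw [← Finset.sum_subset hsub]
      · refine Finset.sum_congr rfl fun j hj => ?_
        rw [if_pos (Finset.mem_range.1 hj)]; ring
      · intro j _ hj
        rw [if_neg (by simpa using hj), zero_mul]
    have h3 : ∑ j ∈ Finset.range n, (if j = n then (K * laguerreCoeff a n n)⁻¹ else
        -(laguerreCoeff a n n)⁻¹ * ∑ i ∈ Finset.range n,
          if j < i + 1 then laguerreCoeff a n i * C i j else 0) * laguerreFun a j x =
        -(laguerreCoeff a n n)⁻¹ * ∑ j ∈ Finset.range n, (∑ i ∈ Finset.range n,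
          if j < i + 1 then laguerreCoeff a n i * C i j else 0) * laguerreFun a j x := by
      rw [Finset.mul_sum]
      refine Finset.sum_congr rfl fun j hj => ?_
      rw [if_neg (by have := Finset.mem_range.1 hj; omega)]
      ring
    rw [h3, ← h2, h1]
    field_simp
    ring

/-! ### Gaussian-decaying functions on the orthant -/

instance (α : Fin d → ℝ) : SigmaFinite (laguerreMeasure α) := by
  rw [laguerreMeasure_eq]; infer_instance

theorem laguerreMeasure_ae_pos (α : Fin d → ℝ) : ∀ᵐ x ∂laguerreMeasure α, ∀ i, 0 < x i := by
  rw [laguerreMeasure_eq]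
  exact ae_all_iff.2 fun i => Measure.tendsto_eval_ae_ae.eventually (halfLineMeasure_ae_pos (α i))

theorem integrable_exp_gauss_pi {α : Fin d → ℝ} (hα : ∀ i, -(1 / 2 : ℝ) ≤ α i) (A : ℝ) {c : ℝ}
    (hc : 0 < c) :
    Integrable (fun x : Fin d → ℝ => Real.exp (A * (1 + ∑ i, x i)) * Real.exp (-c * ∑ i, x i ^ 2))
      (laguerreMeasure α) := by
  have h : Integrable (fun x : Fin d → ℝ => Real.exp (A - d * A) *
      ∏ i, (Real.exp (A * (1 + x i)) * Real.exp (-c * x i ^ 2))) (laguerreMeasure α) := by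
    rw [laguerreMeasure_eq]
    exact (Integrable.fintype_prod_dep fun i => integrable_exp_gauss (hα i) A hc).const_mul _
  refine h.congr (ae_of_all _ fun x => ?_)
  simp only
  rw [Finset.prod_mul_distrib, ← Real.exp_sum, ← Real.exp_sum, ← mul_assoc, ← Real.exp_add]
  congr 2
  · rw [← Finset.mul_sum, Finset.sum_add_distrib]
    simp
    ring
  · rw [Finset.mul_sum]

/-- `f` is bounded on the orthant by an exponential times `exp (-c |x|²)`. -/
def GaussBound (c : ℝ) (f : (Fin d → ℝ) → ℝ) : Prop :=
  ∃ A, 0 ≤ A ∧ ∀ x : Fin d → ℝ, (∀ i, 0 < x i) →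
    |f x| ≤ Real.exp (A * (1 + ∑ i, x i)) * Real.exp (-c * ∑ i, x i ^ 2)

theorem GaussBound.add {c : ℝ} {f g : (Fin d → ℝ) → ℝ} (hf : GaussBound c f)
    (hg : GaussBound c g) : GaussBound c fun x => f x + g x := by
  obtain ⟨A, hA, h⟩ := hf
  obtain ⟨B, hB, h'⟩ := hg
  refine ⟨A + B + 1, by positivity, fun x hx => ?_⟩
  have hs : 0 ≤ ∑ i, x i := Finset.sum_nonneg fun i _ => (hx i).le
  calc |f x + g x| ≤ |f x| + |g x| := abs_add_le _ _
    _ ≤ (Real.exp (A * (1 + ∑ i, x i)) + Real.exp (B * (1 + ∑ i, x i))) *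
        Real.exp (-c * ∑ i, x i ^ 2) := by
        rw [add_mul]; exact add_le_add (h x hx) (h' x hx)
    _ ≤ _ := mul_le_mul_of_nonneg_right (exp_add_exp_le hA hB hs) (Real.exp_pos _).le

theorem GaussBound.mul {c c' : ℝ} {f g : (Fin d → ℝ) → ℝ} (hf : GaussBound c f)
    (hg : GaussBound c' g) : GaussBound (c + c') fun x => f x * g x := by
  obtain ⟨A, hA, h⟩ := hf
  obtain ⟨B, hB, h'⟩ := hg
  refine ⟨A + B, by positivity, fun x hx => ?_⟩
  rw [abs_mul]
  refine (mul_le_mul (h x hx) (h' x hx) (abs_nonneg _) (by positivity)).trans_eq ?_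
  rw [mul_mul_mul_comm, ← Real.exp_add, ← Real.exp_add]
  congr 2 <;> ring

theorem gaussBound_const (C : ℝ) : GaussBound (d := d) 0 fun _ => C := by
  refine ⟨|C|, abs_nonneg _, fun x hx => ?_⟩
  have hs : 0 ≤ ∑ i, x i := Finset.sum_nonneg fun i _ => (hx i).le
  simpa using le_exp_mul_one_add (abs_nonneg C) hs

theorem GaussBound.const_mul {c : ℝ} {f : (Fin d → ℝ) → ℝ} (hf : GaussBound c f) (C : ℝ) :
    GaussBound c fun x => C * f x := by
  simpa using (gaussBound_const C).mul hf

theorem gaussBound_zero (c : ℝ) : GaussBound (d := d) c fun _ => 0 :=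
  ⟨0, le_rfl, fun x _ => by simp [Real.exp_nonneg]⟩

theorem GaussBound.sum {c : ℝ} {ι : Type*} (s : Finset ι) {f : ι → (Fin d → ℝ) → ℝ}
    (hf : ∀ j ∈ s, GaussBound c (f j)) : GaussBound c fun x => ∑ j ∈ s, f j x := by
  classical
  induction s using Finset.induction_on with
  | empty => simpa using gaussBound_zero c
  | insert i s hi ih =>
    simp only [Finset.sum_insert hi]
    exact (hf i (Finset.mem_insert_self i s)).add
      (ih fun j hj => hf j (Finset.mem_insert_of_mem hj))

theorem GaussBound.integrable {α : Fin d → ℝ} (hα : ∀ i, -(1 / 2 : ℝ) ≤ α i) {c : ℝ} (hc : 0 < c)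
    {f : (Fin d → ℝ) → ℝ} (hf : GaussBound c f) (hm : AEStronglyMeasurable f (laguerreMeasure α)) :
    Integrable f (laguerreMeasure α) := by
  obtain ⟨A, _, h⟩ := hf
  refine Integrable.mono' (integrable_exp_gauss_pi hα A hc) hm ?_
  filter_upwards [laguerreMeasure_ae_pos α] with x hx using h x hx

theorem GaussBound.rpow {c : ℝ} {f : (Fin d → ℝ) → ℝ} (hf : GaussBound c f) {s : ℝ} (hs : 0 ≤ s) :
    GaussBound (s * c) fun x => |f x| ^ s := by
  obtain ⟨A, hA, h⟩ := hf
  refine ⟨s * A, by positivity, fun x hx => ?_⟩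
  rw [abs_of_nonneg (by positivity)]
  refine (Real.rpow_le_rpow (abs_nonneg _) (h x hx) hs).trans_eq ?_
  rw [Real.mul_rpow (Real.exp_pos _).le (Real.exp_pos _).le, ← Real.exp_mul, ← Real.exp_mul]
  congr 2 <;> ring

theorem GaussBound.memLp {α : Fin d → ℝ} (hα : ∀ i, -(1 / 2 : ℝ) ≤ α i) {c : ℝ} (hc : 0 < c)
    {f : (Fin d → ℝ) → ℝ} (hf : GaussBound c f) (hm : AEStronglyMeasurable f (laguerreMeasure α))
    {p : ℝ≥0∞} (hp0 : p ≠ 0) (hp : p ≠ ⊤) : MemLp f p (laguerreMeasure α) := by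
  rw [← integrable_norm_rpow_iff hm hp0 hp]
  exact (hf.rpow ENNReal.toReal_nonneg).integrable hα
    (mul_pos (ENNReal.toReal_pos hp0 hp) hc) (hm.norm.aemeasurable.pow_const _).aestronglyMeasurable

/-! ### Tensor products -/

/-- The factor in the variable `x_j` of `ℓ_k^α` (if `o = none`) or of `δ_i ℓ_k^α`
(if `o = some i`). -/
def tensorFactor (α : Fin d → ℝ) (o : Option (Fin d)) (k : Fin d → ℕ) (j : Fin d) : ℝ → ℝ :=
  if o = some j then laguerreDel (α j) (k j) else laguerreFun (α j) (k j)

/-- The functions `ℓ_k^α` (for `o = none`) and `δ_i ℓ_k^α` (for `o = some i`). -/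
def tensorFun (α : Fin d → ℝ) (o : Option (Fin d)) (k : Fin d → ℕ) (x : Fin d → ℝ) : ℝ :=
  ∏ j, tensorFactor α o k j (x j)

theorem tensorFun_none (α : Fin d → ℝ) (k : Fin d → ℕ) :
    tensorFun α none k = laguerreTensor α k := by
  funext x
  simp [tensorFun, tensorFactor, laguerreTensor]

theorem prod_update_eq (f : Fin d → ℝ → ℝ) (x : Fin d → ℝ) (i : Fin d) (t : ℝ) :
    ∏ j, f j (Function.update x i t j) = f i t * ∏ j ∈ Finset.univ.erase i, f j (x j) := by
  rw [← Finset.mul_prod_erase _ _ (Finset.mem_univ i), Function.update_self]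
  congr 1
  exact Finset.prod_congr rfl fun j hj => by
    rw [Function.update_of_ne (Finset.ne_of_mem_erase hj)]

theorem prod_eq_mul_erase (f : Fin d → ℝ → ℝ) (x : Fin d → ℝ) (i : Fin d) :
    ∏ j, f j (x j) = f i (x i) * ∏ j ∈ Finset.univ.erase i, f j (x j) :=
  (Finset.mul_prod_erase _ _ (Finset.mem_univ i)).symm

theorem tensorFun_some_eq (α : Fin d → ℝ) (i : Fin d) (k : Fin d → ℕ) (x : Fin d → ℝ) :
    tensorFun α (some i) k x =
      laguerreDel (α i) (k i) (x i) *
        ∏ j ∈ Finset.univ.erase i, laguerreFun (α j) (k j) (x j) := by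
  rw [tensorFun, prod_eq_mul_erase _ x i]
  congr 1
  · simp [tensorFactor]
  · refine Finset.prod_congr rfl fun j hj => ?_
    have : i ≠ j := (Finset.ne_of_mem_erase hj).symm
    simp [tensorFactor, this]

theorem laguerreDelta_tensor (α : Fin d → ℝ) (i : Fin d) (k : Fin d → ℕ) :
    laguerreDelta i (laguerreTensor α k) = tensorFun α (some i) k := by
  funext x
  have h : (fun t : ℝ => laguerreTensor α k (Function.update x i t)) = fun t =>
      laguerreFun (α i) (k i) t * ∏ j ∈ Finset.univ.erase i, laguerreFun (α j) (k j) (x j) :=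
    funext fun t => prod_update_eq (fun j => laguerreFun (α j) (k j)) x i t
  rw [laguerreDelta, h, ((hasDerivAt_laguerreFun (α i) (k i) (x i)).mul_const _).deriv,
    tensorFun_some_eq, laguerreTensor,
    prod_eq_mul_erase (fun j => laguerreFun (α j) (k j)) x i]
  ring

theorem continuous_tensorFactor (α : Fin d → ℝ) (o : Option (Fin d)) (k : Fin d → ℕ) (j : Fin d) :
    Continuous (tensorFactor α o k j) := by
  unfold tensorFactor
  split_ifs
  · exact continuous_laguerreDel _ _
  · exact continuous_laguerreFun _ _

theorem continuous_tensorFun (α : Fin d → ℝ) (o : Option (Fin d)) (k : Fin d → ℕ) :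
    Continuous (tensorFun α o k) :=
  continuous_finsetProd _ fun j _ => (continuous_tensorFactor α o k j).comp (continuous_apply j)

theorem halfLineBound_tensorFactor (α : Fin d → ℝ) (o : Option (Fin d)) (k : Fin d → ℕ) (j : Fin d) :
    HalfLineBound (tensorFactor α o k j) := by
  unfold tensorFactor
  split_ifs
  · exact halfLineBound_laguerreDel _ _
  · exact halfLineBound_laguerreFun _ _

/-- A product of one-variable functions with Gaussian decay has Gaussian decay. -/
theorem gaussBound_prod {φ : Fin d → ℝ → ℝ}
    (h : ∀ j, HalfLineBound (φ j)) :
    GaussBound (1 / 2) fun x => ∏ j, φ j (x j) := by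
  choose A hA h using h
  refine ⟨∑ j, A j, Finset.sum_nonneg fun j _ => hA j, fun x hx => ?_⟩
  rw [Finset.abs_prod]
  refine (Finset.prod_le_prod (fun j _ => abs_nonneg _) fun j _ => h j _ (hx j).le).trans ?_
  rw [Finset.prod_mul_distrib, ← Real.exp_sum, ← Real.exp_sum]
  refine mul_le_mul (Real.exp_le_exp.2 ?_) (Real.exp_le_exp.2 (le_of_eq ?_)) (Real.exp_pos _).le
    (Real.exp_pos _).le
  · rw [Finset.sum_mul]
    refine Finset.sum_le_sum fun j _ => mul_le_mul_of_nonneg_left ?_ (hA j)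
    have := Finset.single_le_sum (f := x) (fun i _ => (hx i).le) (Finset.mem_univ j)
    linarith
  · rw [Finset.mul_sum]
    exact Finset.sum_congr rfl fun j _ => by ring

theorem gaussBound_tensorFun (α : Fin d → ℝ) (o : Option (Fin d)) (k : Fin d → ℕ) :
    GaussBound (1 / 2) (tensorFun α o k) :=
  gaussBound_prod fun j => halfLineBound_tensorFactor α o k j

theorem memLp_tensorFun {α : Fin d → ℝ} (hα : ∀ i, -(1 / 2 : ℝ) ≤ α i) (o : Option (Fin d))
    (k : Fin d → ℕ) {p : ℝ≥0∞} (hp0 : p ≠ 0) (hp : p ≠ ⊤) :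
    MemLp (tensorFun α o k) p (laguerreMeasure α) :=
  (gaussBound_tensorFun α o k).memLp hα (by norm_num)
    (continuous_tensorFun α o k).aestronglyMeasurable hp0 hp

theorem integrable_tensorFun_mul {α : Fin d → ℝ} (hα : ∀ i, -(1 / 2 : ℝ) ≤ α i)
    (o o' : Option (Fin d)) (k l : Fin d → ℕ) :
    Integrable (fun x => tensorFun α o k x * tensorFun α o' l x) (laguerreMeasure α) :=
  ((gaussBound_tensorFun α o k).mul (gaussBound_tensorFun α o' l)).integrable hα (by norm_num)
    ((continuous_tensorFun α o k).mul (continuous_tensorFun α o' l)).aestronglyMeasurable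

/-- The squared norm of `tensorFun α o k` in `L²`. -/
def tensorNormSq (o : Option (Fin d)) (k : Fin d → ℕ) : ℝ :=
  o.elim 1 fun i => 4 * k i

theorem integral_tensorFun_mul {α : Fin d → ℝ} (hα : ∀ i, -(1 / 2 : ℝ) ≤ α i)
    (o : Option (Fin d)) (k l : Fin d → ℕ) :
    ∫ x, tensorFun α o k x * tensorFun α o l x ∂laguerreMeasure α =
      if k = l then tensorNormSq o k else 0 := by
  have h1 : ∀ j, ∫ t, tensorFactor α o k j t * tensorFactor α o l j t ∂halfLineMeasure (α j) =
      (if o = some j then 4 * (k j : ℝ) else 1) * if k j = l j then 1 else 0 := by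
    intro j
    unfold tensorFactor
    split_ifs with h h' h'
    · rw [integral_laguerreDel_mul (hα j), integral_laguerreFun_mul (hα j), if_pos h']
    · rw [integral_laguerreDel_mul (hα j), integral_laguerreFun_mul (hα j), if_neg h']
    · rw [integral_laguerreFun_mul (hα j), if_pos h', mul_one]
    · rw [integral_laguerreFun_mul (hα j), if_neg h', mul_zero]
  have h2 : ∏ j, (if o = some j then 4 * (k j : ℝ) else 1) = tensorNormSq o k := by
    rcases o with _ | i
    · simp [tensorNormSq]
    · simp only [Option.some.injEq, tensorNormSq, Option.elim]
      rw [Finset.prod_ite_eq]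
      simp
  simp only [tensorFun, ← Finset.prod_mul_distrib]
  rw [laguerreMeasure_eq,
    integral_fintype_prod_eq_prod (fun j t => tensorFactor α o k j t * tensorFactor α o l j t)]
  simp only [h1]
  rw [Finset.prod_mul_distrib, h2]
  split_ifs with h
  · subst h; simp
  · obtain ⟨j, hj⟩ := Function.ne_iff.1 h
    rw [Finset.prod_eq_zero (Finset.mem_univ j) (if_neg hj), mul_zero]

/-- An integrable function on the orthant has integral zero if its integrals over all lines
parallel to a coordinate axis vanish. -/
theorem integral_eq_zero_of_lines {α : Fin d → ℝ} (j : Fin d) {G : (Fin d → ℝ) → ℝ}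
    (hG : Integrable G (laguerreMeasure α))
    (h : ∀ x : Fin d → ℝ, (∀ i, 0 < x i) →
      Integrable (fun s => G (Function.update x j s)) (halfLineMeasure (α j)) →
      ∫ s, G (Function.update x j s) ∂halfLineMeasure (α j) = 0) :
    ∫ x, G x ∂laguerreMeasure α = 0 := by
  rcases d with _ | n
  · exact j.elim0
  rw [laguerreMeasure_eq] at hG ⊢
  have hmp := (measurePreserving_piFinSuccAbove (fun i => halfLineMeasure (α i)) j).symm
  have hG' := (hmp.integrable_comp_emb (MeasurableEquiv.measurableEmbedding _)).2 hG
  rw [← hmp.integral_comp' G]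
  refine (integral_prod_symm _ hG').trans ?_
  have hpos : ∀ᵐ y ∂Measure.pi fun i => halfLineMeasure (α (j.succAbove i)), ∀ i, 0 < y i :=
    laguerreMeasure_ae_pos fun i => α (j.succAbove i)
  refine integral_eq_zero_of_ae ?_
  filter_upwards [hpos, hG'.prod_left_ae] with y hy hint
  have hx : ∀ i, 0 < (j.insertNth (1 : ℝ) y : Fin (n + 1) → ℝ) i := by
    intro i
    refine Fin.succAboveCases j ?_ (fun i => ?_) i
    · simp
    · simpa using hy i
  have he : ∀ s, (MeasurableEquiv.piFinSuccAbove (fun _ : Fin (n + 1) => ℝ) j).symm (s, y) =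
      Function.update (j.insertNth (1 : ℝ) y : Fin (n + 1) → ℝ) j s := by
    intro s
    rw [Fin.update_insertNth]
    rfl
  simp only [Function.comp_def, he] at hint
  simp only [Function.comp_def, he]
  exact h _ hx hint

/-! ### The Bellman function -/

/-- The weight `S ^ (p / 2) + T ^ (q / 2)`, where `p = q / (q - 1)` is the exponent conjugate
to `q`. -/
def bellmanN (q S T : ℝ) : ℝ := S ^ (q / (q - 1) / 2) + T ^ (q / 2)

/-- A smooth Bellman function of Nazarov–Treil type, for `1 < q ≤ 2` and `p = q / (q - 1)`, in the
variables `S = |u|²`, `T = |v|²`: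
`|u|^p + |v|^q + (q - 1) / 8 * |u|² * (|u|^p + |v|^q) ^ ((2 - q) / q)`.
The usual function has `|u|² |v| ^ (2 - q)` in place of the last product and only where
`|u|^p ≤ |v|^q`, which makes it merely `C¹`. -/
def bellman (q S T : ℝ) : ℝ :=
  bellmanN q S T + (q - 1) / 8 * (S * bellmanN q S T ^ ((2 - q) / q))

/-- `∂F/∂S` for the Bellman function `F`. -/
def bellmanS (q S T : ℝ) : ℝ :=
  q / (q - 1) / 2 * (S ^ (q / (q - 1) / 2) / S) +
    (q - 1) / 8 * (bellmanN q S T ^ ((2 - q) / q) * (1 + (2 - q) / q * (q / (q - 1) / 2) *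
      (S ^ (q / (q - 1) / 2) / bellmanN q S T)))

/-- `∂F/∂T` for the Bellman function `F`. -/
def bellmanT (q S T : ℝ) : ℝ :=
  q / 2 * (T ^ (q / 2) / T) *
    (1 + (q - 1) / 8 * ((2 - q) / q) * (S * (bellmanN q S T ^ ((2 - q) / q) / bellmanN q S T)))

/-- The normalized second derivatives of the Bellman function, as functions of the ratios
`θ = S ^ (p / 2) / N` and `κ = S N ^ r / N`: here `(S² / N) ∂²F/∂S²`. -/
def bellmanHessS (q θ κ : ℝ) : ℝ :=
  q / (q - 1) / 2 * (q / (q - 1) / 2 - 1) * θ +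
    (q - 1) / 8 * ((2 - q) / q * (q / (q - 1) / 2) * κ * θ *
      (q / (q - 1) / 2 + 1 - (1 - (2 - q) / q) * (q / (q - 1) / 2) * θ))

/-- The normalized mixed derivative `(S T / N) ∂²F/∂S∂T`. -/
def bellmanHessST (q θ κ : ℝ) : ℝ :=
  (q - 1) / 8 * ((2 - q) / 2) * κ * (1 - θ) * (1 - θ)

/-- The normalized second derivative `(T² / N) ∂²F/∂T²`. -/
def bellmanHessT (q θ κ : ℝ) : ℝ :=
  q / 2 * (1 - θ) * ((q / 2 - 1) * (1 + (q - 1) / 8 * ((2 - q) / q) * κ) -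
    (q - 1) / 8 * ((2 - q) / q) * (1 - (2 - q) / q) * (q / 2) * κ * (1 - θ))

theorem HasDerivAt.rpow_const_div {f : ℝ → ℝ} {f' x : ℝ} (s : ℝ) (hf : HasDerivAt f f' x)
    (hx : 0 < f x) : HasDerivAt (fun t => f t ^ s) (s * (f x ^ s / f x) * f') x := by
  refine (hf.rpow_const (Or.inl hx.ne')).congr_deriv ?_
  rw [Real.rpow_sub_one hx.ne']
  ring

section Derivatives

variable {q : ℝ} {S T : ℝ → ℝ} {S' T' x : ℝ}

theorem bellmanN_pos {q S T : ℝ} (hS : 0 < S) (hT : 0 < T) : 0 < bellmanN q S T :=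
  add_pos (Real.rpow_pos_of_pos hS _) (Real.rpow_pos_of_pos hT _)

theorem hasDerivAt_bellmanN (hS : HasDerivAt S S' x) (hT : HasDerivAt T T' x) (hS0 : 0 < S x)
    (hT0 : 0 < T x) : HasDerivAt (fun t => bellmanN q (S t) (T t))
      (q / (q - 1) / 2 * (S x ^ (q / (q - 1) / 2) / S x) * S' +
        q / 2 * (T x ^ (q / 2) / T x) * T') x :=
  (hS.rpow_const_div _ hS0).add (hT.rpow_const_div _ hT0)

theorem hasDerivAt_bellman (hq : 1 < q) (hS : HasDerivAt S S' x) (hT : HasDerivAt T T' x)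
    (hS0 : 0 < S x) (hT0 : 0 < T x) : HasDerivAt (fun t => bellman q (S t) (T t))
      (bellmanS q (S x) (T x) * S' + bellmanT q (S x) (T x) * T') x := by
  have hN := hasDerivAt_bellmanN (q := q) hS hT hS0 hT0
  have hN0 := bellmanN_pos (q := q) hS0 hT0
  refine (hN.add ((hS.mul (hN.rpow_const_div ((2 - q) / q) hN0)).const_mul
    ((q - 1) / 8))).congr_deriv ?_
  unfold bellmanS bellmanT
  have h1 := hN0.ne'
  have h2 := hS0.ne'
  have h3 := hT0.ne'
  have h4 : q - 1 ≠ 0 := by linarith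
  have h5 : q ≠ 0 := by linarith
  generalize bellmanN q (S x) (T x) = N at *
  generalize N ^ ((2 - q) / q) = R at *
  field_simp
  ring

theorem hasDerivAt_bellmanS (hq : 1 < q) (hS : HasDerivAt S S' x) (hT : HasDerivAt T T' x)
    (hS0 : 0 < S x) (hT0 : 0 < T x) : HasDerivAt (fun t => bellmanS q (S t) (T t))
      (bellmanN q (S x) (T x) / S x ^ 2 *
        bellmanHessS q (S x ^ (q / (q - 1) / 2) / bellmanN q (S x) (T x))
          (S x * bellmanN q (S x) (T x) ^ ((2 - q) / q) / bellmanN q (S x) (T x)) * S' +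
      bellmanN q (S x) (T x) / (S x * T x) *
        bellmanHessST q (S x ^ (q / (q - 1) / 2) / bellmanN q (S x) (T x))
          (S x * bellmanN q (S x) (T x) ^ ((2 - q) / q) / bellmanN q (S x) (T x)) * T') x := by
  have hN := hasDerivAt_bellmanN (q := q) hS hT hS0 hT0
  have hN0 := bellmanN_pos (q := q) hS0 hT0
  have hA := hS.rpow_const_div (q / (q - 1) / 2) hS0
  have hNr := hN.rpow_const_div ((2 - q) / q) hN0
  refine (((hA.fun_div hS hS0.ne').const_mul (q / (q - 1) / 2)).add
    ((hNr.mul (((hA.fun_div hN hN0.ne').const_mul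
      ((2 - q) / q * (q / (q - 1) / 2))).const_add 1)).const_mul ((q - 1) / 8))).congr_deriv ?_
  unfold bellmanHessS bellmanHessST
  have hE : T x ^ (q / 2) = bellmanN q (S x) (T x) - S x ^ (q / (q - 1) / 2) := by
    unfold bellmanN; ring
  have h1 := hN0.ne'
  have h2 := hS0.ne'
  have h3 := hT0.ne'
  have h4 : q - 1 ≠ 0 := by linarith
  have h5 : q ≠ 0 := by linarith
  rw [hE]
  generalize bellmanN q (S x) (T x) = N at *
  generalize S x ^ (q / (q - 1) / 2) = A at *
  generalize N ^ ((2 - q) / q) = R at *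
  field_simp
  ring

theorem hasDerivAt_bellmanT (hq : 1 < q) (hS : HasDerivAt S S' x) (hT : HasDerivAt T T' x)
    (hS0 : 0 < S x) (hT0 : 0 < T x) : HasDerivAt (fun t => bellmanT q (S t) (T t))
      (bellmanN q (S x) (T x) / (S x * T x) *
        bellmanHessST q (S x ^ (q / (q - 1) / 2) / bellmanN q (S x) (T x))
          (S x * bellmanN q (S x) (T x) ^ ((2 - q) / q) / bellmanN q (S x) (T x)) * S' +
      bellmanN q (S x) (T x) / T x ^ 2 *
        bellmanHessT q (S x ^ (q / (q - 1) / 2) / bellmanN q (S x) (T x))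
          (S x * bellmanN q (S x) (T x) ^ ((2 - q) / q) / bellmanN q (S x) (T x)) * T') x := by
  have hN := hasDerivAt_bellmanN (q := q) hS hT hS0 hT0
  have hN0 := bellmanN_pos (q := q) hS0 hT0
  have hE' := hT.rpow_const_div (q / 2) hT0
  have hNr := hN.rpow_const_div ((2 - q) / q) hN0
  refine ((((hE'.fun_div hT hT0.ne').const_mul (q / 2)).mul
    (((hS.fun_mul (hNr.fun_div hN hN0.ne')).const_mul ((q - 1) / 8 * ((2 - q) / q))).const_add
      1))).congr_deriv ?_
  unfold bellmanHessT bellmanHessST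
  have hE : T x ^ (q / 2) = bellmanN q (S x) (T x) - S x ^ (q / (q - 1) / 2) := by
    unfold bellmanN; ring
  have h1 := hN0.ne'
  have h2 := hS0.ne'
  have h3 := hT0.ne'
  have h4 : q - 1 ≠ 0 := by linarith
  have h5 : q ≠ 0 := by linarith
  rw [hE]
  generalize bellmanN q (S x) (T x) = N at *
  generalize S x ^ (q / (q - 1) / 2) = A at *
  generalize N ^ ((2 - q) / q) = R at *
  field_simp
  ring

end Derivatives

/-! ### Convexity of the Bellman function -/

/-- The part of the lower bound that concerns the second variable. The radial second derivative
is nonpositive there, so it is worst when the velocity is radial, `η² = n`. -/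
theorem bellmanHessT_lower {q θ κ η n : ℝ} (hq : 1 < q) (hq2 : q ≤ 2) (hθ : 0 ≤ θ) (hθ1 : θ ≤ 1)
    (hκ : 0 ≤ κ) (hκ1 : κ ≤ 1) (hn : η ^ 2 ≤ n) :
    (q - 1) / 2 * (1 - θ) * n ≤
      2 * (q / 2 * (1 - θ) * (1 + (q - 1) / 8 * ((2 - q) / q) * κ)) * n +
      4 * bellmanHessT q θ κ * η ^ 2 -
      (q - 1) / 2 * (2 - q) ^ 2 * κ * (1 - θ) ^ 4 * η ^ 2 := by
  have hq0 : 0 < q - 1 := by linarith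
  have hq1 : 0 < q := by linarith
  have hn0 : 0 ≤ n := (sq_nonneg η).trans hn
  have hr : 0 ≤ (2 - q) / q := div_nonneg (by linarith) hq1.le
  have hθ' : 0 ≤ 1 - θ := by linarith
  have hr1 : 0 ≤ 1 - (2 - q) / q := by
    rw [sub_nonneg, div_le_one hq1]; linarith
  have hD : 4 * bellmanHessT q θ κ - (q - 1) / 2 * (2 - q) ^ 2 * κ * (1 - θ) ^ 4 ≤ 0 := by
    unfold bellmanHessT
    have h1 : 0 ≤ q / 2 * (1 - θ) * ((1 - q / 2) * (1 + (q - 1) / 8 * ((2 - q) / q) * κ) +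
      (q - 1) / 8 * ((2 - q) / q) * (1 - (2 - q) / q) * (q / 2) * κ * (1 - θ)) := by
      have : 0 ≤ 1 - q / 2 := by linarith
      positivity
    have h2 : 0 ≤ (q - 1) / 2 * (2 - q) ^ 2 * κ * (1 - θ) ^ 4 := by positivity
    linarith
  have hE : (q - 1) / 2 * (1 - θ) ≤
      2 * (q / 2 * (1 - θ) * (1 + (q - 1) / 8 * ((2 - q) / q) * κ)) +
      (4 * bellmanHessT q θ κ - (q - 1) / 2 * (2 - q) ^ 2 * κ * (1 - θ) ^ 4) := by
    have h1 : 2 * (q / 2 * (1 - θ) * (1 + (q - 1) / 8 * ((2 - q) / q) * κ)) +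
      (4 * bellmanHessT q θ κ - (q - 1) / 2 * (2 - q) ^ 2 * κ * (1 - θ) ^ 4) =
      (1 - θ) * (q - 1) * (q + (q - 1) / 8 * (2 - q) * κ * (1 - 2 * (1 - θ)) -
        (2 - q) ^ 2 / 2 * (κ * (1 - θ) ^ 3)) := by
      unfold bellmanHessT
      field_simp
      ring
    rw [h1]
    have h2 : κ * (1 - θ) ^ 3 ≤ 1 :=
      mul_le_one₀ hκ1 (by positivity) (pow_le_one₀ hθ' (by linarith))
    have h3 : -1 ≤ κ * (1 - 2 * (1 - θ)) := by nlinarith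
    have h4 : -((q - 1) / 8 * (2 - q)) ≤ (q - 1) / 8 * (2 - q) * (κ * (1 - 2 * (1 - θ))) := by
      have : 0 ≤ (q - 1) / 8 * (2 - q) := mul_nonneg (by linarith) (by linarith)
      nlinarith
    have h5 : (2 - q) ^ 2 / 2 * (κ * (1 - θ) ^ 3) ≤ (2 - q) ^ 2 / 2 :=
      mul_le_of_le_one_right (by positivity) h2
    have h6 : 1 / 2 ≤ q + (q - 1) / 8 * (2 - q) * κ * (1 - 2 * (1 - θ)) -
        (2 - q) ^ 2 / 2 * (κ * (1 - θ) ^ 3) := by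
      have : (q - 1) / 8 * (2 - q) * κ * (1 - 2 * (1 - θ)) =
        (q - 1) / 8 * (2 - q) * (κ * (1 - 2 * (1 - θ))) := by ring
      rw [this]
      have h8 : (q - 1) / 8 * (2 - q) ≤ (2 - q) / 8 := by nlinarith
      have h9 : (2 - q) ^ 2 ≤ 2 - q := by nlinarith
      linarith
    have h7 : 0 ≤ (1 - θ) * (q - 1) := by positivity
    have := mul_le_mul_of_nonneg_left h6 h7
    linarith
  have h1 := mul_le_mul_of_nonneg_right hE hn0
  have h2 := mul_le_mul_of_nonpos_left hn hD
  linarith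

/-- Lower bound for the normalized second derivative of the Bellman function. The variables
`m ≥ ξ²` and `n ≥ η²` stand for the full squared lengths of the velocities, `ξ` and `η` for their
radial components. -/
theorem bellmanHess_lower {q θ κ ξ η m n : ℝ} (hq : 1 < q) (hq2 : q ≤ 2) (hθ : 0 ≤ θ) (hθ1 : θ ≤ 1)
    (hκ : 0 ≤ κ) (hκ1 : κ ≤ 1) (hm : ξ ^ 2 ≤ m) (hn : η ^ 2 ≤ n) :
    (q - 1) / 8 * κ * m + (q - 1) / 2 * (1 - θ) * n ≤
      2 * (q / (q - 1) / 2 * θ +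
        (q - 1) / 8 * (κ * (1 + (2 - q) / q * (q / (q - 1) / 2) * θ))) * m +
      2 * (q / 2 * (1 - θ) * (1 + (q - 1) / 8 * ((2 - q) / q) * κ)) * n +
      4 * bellmanHessS q θ κ * ξ ^ 2 + 8 * bellmanHessST q θ κ * (ξ * η) +
      4 * bellmanHessT q θ κ * η ^ 2 := by
  have hq0 : 0 < q - 1 := by linarith
  have hq1 : 0 < q := by linarith
  have hm0 : 0 ≤ m := (sq_nonneg ξ).trans hm
  have hn0 : 0 ≤ n := (sq_nonneg η).trans hn
  have hP : 1 ≤ q / (q - 1) / 2 := by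
    rw [div_div, le_div_iff₀ (by positivity)]; linarith
  have hr : 0 ≤ (2 - q) / q := div_nonneg (by linarith) hq1.le
  have hrP : (1 - (2 - q) / q) * (q / (q - 1) / 2) = 1 := by field_simp; ring
  have hHS : 0 ≤ bellmanHessS q θ κ := by
    unfold bellmanHessS
    rw [hrP]
    have h1 : 0 ≤ q / (q - 1) / 2 - 1 := by linarith
    have h2 : 0 ≤ q / (q - 1) / 2 + 1 - 1 * θ := by linarith
    positivity
  have hrq : (2 - q) / q * q = 2 - q := by field_simp
  have hA : (q - 1) / 8 * κ * m ≤ 2 * (q / (q - 1) / 2 * θ +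
        (q - 1) / 8 * (κ * (1 + (2 - q) / q * (q / (q - 1) / 2) * θ))) * m
        - (q - 1) / 8 * κ * ξ ^ 2 := by
    have h1 : (q - 1) / 8 * κ * ξ ^ 2 ≤ (q - 1) / 8 * κ * m := by gcongr
    have h2 : (q - 1) / 8 * κ ≤ q / (q - 1) / 2 * θ +
        (q - 1) / 8 * (κ * (1 + (2 - q) / q * (q / (q - 1) / 2) * θ)) := by
      have h3 : 0 ≤ q / (q - 1) / 2 * θ := by positivity
      have h4 : 0 ≤ (q - 1) / 8 * (κ * ((2 - q) / q * (q / (q - 1) / 2) * θ)) := by positivity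
      linarith
    have h5 := mul_le_mul_of_nonneg_right h2 hm0
    linarith
  -- The mixed term, by completing the square. The term in `ξ²` is the surplus in `hA`, the one in
  -- `η²` is paid for by `bellmanHessT_lower`.
  have hB : -((q - 1) / 8 * κ * ξ ^ 2) - (q - 1) / 2 * (2 - q) ^ 2 * κ * (1 - θ) ^ 4 * η ^ 2 ≤
      8 * bellmanHessST q θ κ * (ξ * η) := by
    have h : 0 ≤ (q - 1) / 8 * κ * (ξ + 2 * (2 - q) * (1 - θ) ^ 2 * η) ^ 2 := by positivity
    unfold bellmanHessST
    linarith
  have hC := bellmanHessT_lower hq hq2 hθ hθ1 hκ hκ1 hn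
  have hS := mul_nonneg hHS (sq_nonneg ξ)
  linarith

/-- Upper bound for the normalized second derivative of the Bellman function, of the same form as
the lower bound `bellmanHess_lower`. -/
theorem exists_bellmanHess_upper {q : ℝ} (hq : 1 < q) (hq2 : q ≤ 2) :
    ∃ C, 0 ≤ C ∧ ∀ θ κ ξ η m n : ℝ, 0 ≤ θ → θ ≤ 1 → 0 ≤ κ → κ ≤ 1 → θ ≤ κ →
      ξ ^ 2 ≤ m → η ^ 2 ≤ n →
      2 * (q / (q - 1) / 2 * θ +
        (q - 1) / 8 * (κ * (1 + (2 - q) / q * (q / (q - 1) / 2) * θ))) * m +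
      2 * (q / 2 * (1 - θ) * (1 + (q - 1) / 8 * ((2 - q) / q) * κ)) * n +
      4 * bellmanHessS q θ κ * ξ ^ 2 + 8 * bellmanHessST q θ κ * (ξ * η) +
      4 * bellmanHessT q θ κ * η ^ 2 ≤ C * (κ * m + (1 - θ) * n) := by
  have hq0 : 0 < q - 1 := by linarith
  have hq1 : 0 < q := by linarith
  set P := q / (q - 1) / 2 with hPdef
  set r := (2 - q) / q with hrdef
  set g := (q - 1) / 8 with hgdef
  have hg0 : 0 < g := by rw [hgdef]; linarith
  have hP : 1 ≤ P := by
    rw [hPdef, div_div, le_div_iff₀ (by positivity)]; linarith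
  have hr : 0 ≤ r := div_nonneg (by linarith) hq1.le
  have hrP : (1 - r) * P = 1 := by rw [hPdef, hrdef]; field_simp; ring
  have hr1 : 0 ≤ 1 - r := by rw [sub_nonneg, hrdef, div_le_one hq1]; linarith
  set C1 := 2 * (P + g * (1 + r * P)) + 4 * (P * (P - 1) + g * (r * P * (P + 1))) + g with hC1
  set C2 := q * (1 + g * r) + (q - 1) / 2 * (2 - q) ^ 2 with hC2
  have hP1 : 0 ≤ P - 1 := by linarith
  have hC1n : 0 ≤ C1 := by positivity
  have hC2n : 0 ≤ C2 := by positivity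
  refine ⟨C1 + C2, by positivity, fun θ κ ξ η m n hθ hθ1 hκ hκ1 hθκ hm hn => ?_⟩
  have hm0 : 0 ≤ m := (sq_nonneg ξ).trans hm
  have hn0 : 0 ≤ n := (sq_nonneg η).trans hn
  have hθ' : 0 ≤ 1 - θ := by linarith
  have h1 : P * θ + g * (κ * (1 + r * P * θ)) ≤ (P + g * (1 + r * P)) * κ := by
    have : g * (κ * (1 + r * P * θ)) ≤ g * (κ * (1 + r * P * 1)) := by gcongr
    nlinarith
  have hHS : bellmanHessS q θ κ ≤ (P * (P - 1) + g * (r * P * (P + 1))) * κ := by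
    unfold bellmanHessS
    rw [← hPdef, ← hrdef, ← hgdef, hrP]
    have h2 : r * P * κ * θ * (P + 1 - 1 * θ) ≤ r * P * κ * 1 * (P + 1) := by
      gcongr
      · linarith
      · linarith
    have h3 : P * (P - 1) * θ ≤ P * (P - 1) * κ := by gcongr
    nlinarith
  have hHS0 : 4 * bellmanHessS q θ κ * ξ ^ 2 ≤
      4 * (P * (P - 1) + g * (r * P * (P + 1))) * κ * m := by
    have h2 : bellmanHessS q θ κ * ξ ^ 2 ≤
        (P * (P - 1) + g * (r * P * (P + 1))) * κ * ξ ^ 2 := by gcongr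
    have h3 : (P * (P - 1) + g * (r * P * (P + 1))) * κ * ξ ^ 2 ≤
        (P * (P - 1) + g * (r * P * (P + 1))) * κ * m := by gcongr
    linarith
  have hHT : bellmanHessT q θ κ * η ^ 2 ≤ 0 := by
    refine mul_nonpos_of_nonpos_of_nonneg ?_ (sq_nonneg η)
    unfold bellmanHessT
    rw [← hrdef, ← hgdef]
    have h2 : 0 ≤ q / 2 * (1 - θ) * ((1 - q / 2) * (1 + g * r * κ) +
        g * r * (1 - r) * (q / 2) * κ * (1 - θ)) := by
      have : 0 ≤ 1 - q / 2 := by linarith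
      positivity
    linarith
  have hST : 8 * bellmanHessST q θ κ * (ξ * η) ≤ g * κ * m +
      (q - 1) / 2 * (2 - q) ^ 2 * ((1 - θ) * n) := by
    have h : 0 ≤ (q - 1) / 8 * κ * (ξ - 2 * (2 - q) * (1 - θ) ^ 2 * η) ^ 2 := by positivity
    have h2 : (q - 1) / 8 * κ * ξ ^ 2 ≤ g * κ * m := by rw [← hgdef]; gcongr
    have h3 : κ * (1 - θ) ^ 4 * η ^ 2 ≤ (1 - θ) * n := by
      have h4 : κ * (1 - θ) ^ 4 ≤ 1 - θ := by
        have h5 : (1 - θ) ^ 4 ≤ (1 - θ) ^ 1 :=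
          pow_le_pow_of_le_one hθ' (by linarith) (by norm_num)
        rw [pow_one] at h5
        calc κ * (1 - θ) ^ 4 ≤ 1 * (1 - θ) := by gcongr
          _ = _ := one_mul _
      gcongr
    have h6 : (q - 1) / 2 * (2 - q) ^ 2 * (κ * (1 - θ) ^ 4 * η ^ 2) ≤
      (q - 1) / 2 * (2 - q) ^ 2 * ((1 - θ) * n) := by gcongr
    unfold bellmanHessST
    linarith
  have hT : 2 * (q / 2 * (1 - θ) * (1 + g * r * κ)) * n ≤ q * (1 + g * r) * ((1 - θ) * n) := by
    have : (1 - θ) * (1 + g * r * κ) * n ≤ (1 - θ) * (1 + g * r * 1) * n := by gcongr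
    nlinarith
  have h7 := mul_le_mul_of_nonneg_right h1 hm0
  have h8 : 0 ≤ C2 * (κ * m) := by positivity
  have h9 : 0 ≤ C1 * ((1 - θ) * n) := by positivity
  rw [hC1] at h9 ⊢
  rw [hC2] at h8 ⊢
  linarith

/-! ### The Bellman function on vectors -/

section Vectors

variable {ι κ : Type*} [Fintype ι] [Fintype κ]

/-- The derivative of `(u, v) ↦ bellman q |u|² |v|²` in the direction `(u', v')`. -/
def bellmanGrad (q : ℝ) (u : ι → ℝ) (v : κ → ℝ) (u' : ι → ℝ) (v' : κ → ℝ) : ℝ :=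
  bellmanS q (u ⬝ᵥ u) (v ⬝ᵥ v) * (2 * (u ⬝ᵥ u')) + bellmanT q (u ⬝ᵥ u) (v ⬝ᵥ v) * (2 * (v ⬝ᵥ v'))

/-- The second derivative of `(u, v) ↦ bellman q |u|² |v|²` in the direction `(u', v')`. -/
def bellmanQuad (q : ℝ) (u : ι → ℝ) (v : κ → ℝ) (u' : ι → ℝ) (v' : κ → ℝ) : ℝ :=
  let N := bellmanN q (u ⬝ᵥ u) (v ⬝ᵥ v)
  let θ := (u ⬝ᵥ u) ^ (q / (q - 1) / 2) / N
  let k := (u ⬝ᵥ u) * N ^ ((2 - q) / q) / N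
  2 * bellmanS q (u ⬝ᵥ u) (v ⬝ᵥ v) * (u' ⬝ᵥ u') + 2 * bellmanT q (u ⬝ᵥ u) (v ⬝ᵥ v) * (v' ⬝ᵥ v') +
    4 * (N / (u ⬝ᵥ u) ^ 2 * bellmanHessS q θ k) * (u ⬝ᵥ u') ^ 2 +
    8 * (N / ((u ⬝ᵥ u) * (v ⬝ᵥ v)) * bellmanHessST q θ k) * ((u ⬝ᵥ u') * (v ⬝ᵥ v')) +
    4 * (N / (v ⬝ᵥ v) ^ 2 * bellmanHessT q θ k) * (v ⬝ᵥ v') ^ 2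

theorem hasDerivAt_dotProduct {f g : ι → ℝ → ℝ} {f' g' : ι → ℝ} {x : ℝ}
    (hf : ∀ i, HasDerivAt (f i) (f' i) x) (hg : ∀ i, HasDerivAt (g i) (g' i) x) :
    HasDerivAt (fun s => (fun i => f i s) ⬝ᵥ fun i => g i s)
      (f' ⬝ᵥ (fun i => g i x) + (fun i => f i x) ⬝ᵥ g') x := by
  simp only [dotProduct]
  rw [← Finset.sum_add_distrib]
  exact HasDerivAt.fun_sum fun i _ => (hf i).mul (hg i)

theorem hasDerivAt_bellman_curve {q : ℝ} (hq : 1 < q) {U : ι → ℝ → ℝ} {V : κ → ℝ → ℝ}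
    {U' : ι → ℝ} {V' : κ → ℝ} {x : ℝ}
    (hU : ∀ i, HasDerivAt (U i) (U' i) x) (hV : ∀ i, HasDerivAt (V i) (V' i) x)
    (hU0 : 0 < (fun i => U i x) ⬝ᵥ fun i => U i x) (hV0 : 0 < (fun i => V i x) ⬝ᵥ fun i => V i x) :
    HasDerivAt (fun s => bellman q ((fun i => U i s) ⬝ᵥ fun i => U i s)
      ((fun i => V i s) ⬝ᵥ fun i => V i s))
      (bellmanGrad q (fun i => U i x) (fun i => V i x) U' V') x := by
  refine (hasDerivAt_bellman hq (hasDerivAt_dotProduct hU hU) (hasDerivAt_dotProduct hV hV)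
    hU0 hV0).congr_deriv ?_
  rw [bellmanGrad, dotProduct_comm U', dotProduct_comm V']
  ring

theorem hasDerivAt_bellmanGrad_curve {q : ℝ} (hq : 1 < q) {U U' : ι → ℝ → ℝ} {V V' : κ → ℝ → ℝ}
    {U'' : ι → ℝ} {V'' : κ → ℝ} {x : ℝ}
    (hU : ∀ i, HasDerivAt (U i) (U' i x) x) (hV : ∀ i, HasDerivAt (V i) (V' i x) x)
    (hU' : ∀ i, HasDerivAt (U' i) (U'' i) x) (hV' : ∀ i, HasDerivAt (V' i) (V'' i) x)
    (hU0 : 0 < (fun i => U i x) ⬝ᵥ fun i => U i x) (hV0 : 0 < (fun i => V i x) ⬝ᵥ fun i => V i x) :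
    HasDerivAt (fun s => bellmanGrad q (fun i => U i s) (fun i => V i s)
      (fun i => U' i s) (fun i => V' i s))
      (bellmanQuad q (fun i => U i x) (fun i => V i x) (fun i => U' i x) (fun i => V' i x) +
        bellmanGrad q (fun i => U i x) (fun i => V i x) U'' V'') x := by
  have hS := hasDerivAt_dotProduct hU hU
  have hT := hasDerivAt_dotProduct hV hV
  refine (((hasDerivAt_bellmanS hq hS hT hU0 hV0).mul
    ((hasDerivAt_dotProduct hU hU').const_mul 2)).add
    ((hasDerivAt_bellmanT hq hS hT hU0 hV0).mul
    ((hasDerivAt_dotProduct hV hV').const_mul 2))).congr_deriv ?_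
  simp only [bellmanGrad, bellmanQuad]
  rw [dotProduct_comm (fun i => U' i x) (fun i => U i x),
    dotProduct_comm (fun i => V' i x) (fun i => V i x)]
  ring

/-- The ratios `θ ≤ κ ≤ 1` at which the second derivatives of the Bellman function are evaluated.
The last inequality makes the product of the two coefficients in `bellmanQuad_lower` bounded
below. -/
theorem bellman_ratios {q S T : ℝ} (hq : 1 < q) (hq2 : q ≤ 2) (hS : 0 < S) (hT : 0 < T) :
    0 ≤ S ^ (q / (q - 1) / 2) / bellmanN q S T ∧
    1 - S ^ (q / (q - 1) / 2) / bellmanN q S T = T ^ (q / 2) / bellmanN q S T ∧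
    S ^ (q / (q - 1) / 2) / bellmanN q S T ≤
      S * bellmanN q S T ^ ((2 - q) / q) / bellmanN q S T ∧
    S * bellmanN q S T ^ ((2 - q) / q) / bellmanN q S T ≤ 1 ∧
    1 ≤ bellmanN q S T ^ ((2 - q) / q) * (T ^ (q / 2) / T) := by
  have hq0 : 0 < q - 1 := by linarith
  have hq1 : 0 < q := by linarith
  have hN := bellmanN_pos (q := q) hS hT
  have hA := Real.rpow_pos_of_pos hS (q / (q - 1) / 2)
  have hE := Real.rpow_pos_of_pos hT (q / 2)
  have hr : 0 ≤ (2 - q) / q := div_nonneg (by linarith) hq1.le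
  have hrP : q / (q - 1) / 2 * (1 - (2 - q) / q) = 1 := by field_simp; ring
  have hr1 : 0 ≤ 1 - (2 - q) / q := by rw [sub_nonneg, div_le_one hq1]; linarith
  have hAN : S ^ (q / (q - 1) / 2) ≤ bellmanN q S T := by unfold bellmanN; linarith
  have hEN : T ^ (q / 2) ≤ bellmanN q S T := by unfold bellmanN; linarith
  have hSA : S = (S ^ (q / (q - 1) / 2)) ^ (1 - (2 - q) / q) := by
    rw [← Real.rpow_mul hS.le, hrP, Real.rpow_one]
  refine ⟨by positivity, ?_, ?_, ?_, ?_⟩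
  · rw [eq_div_iff hN.ne', sub_mul, div_mul_cancel₀ _ hN.ne']
    unfold bellmanN; ring
  · gcongr
    calc S ^ (q / (q - 1) / 2) = (S ^ (q / (q - 1) / 2)) ^ (1 - (2 - q) / q) *
          (S ^ (q / (q - 1) / 2)) ^ ((2 - q) / q) := by
          rw [← Real.rpow_add hA, sub_add_cancel, Real.rpow_one]
      _ ≤ _ := by
          rw [← hSA]
          gcongr
  · rw [div_le_one hN]
    calc S * bellmanN q S T ^ ((2 - q) / q) ≤
          bellmanN q S T ^ (1 - (2 - q) / q) * bellmanN q S T ^ ((2 - q) / q) := by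
          refine mul_le_mul_of_nonneg_right ?_ (Real.rpow_nonneg hN.le _)
          calc S = (S ^ (q / (q - 1) / 2)) ^ (1 - (2 - q) / q) := hSA
            _ ≤ _ := Real.rpow_le_rpow hA.le hAN hr1
      _ = _ := by rw [← Real.rpow_add hN, sub_add_cancel, Real.rpow_one]
  · calc (1 : ℝ) = (T ^ (q / 2)) ^ ((2 - q) / q) * (T ^ (q / 2) / T) := by
          rw [← Real.rpow_mul hT.le, ← Real.rpow_sub_one hT.ne', ← Real.rpow_add hT]
          have : q / 2 * ((2 - q) / q) + (q / 2 - 1) = 0 := by field_simp; ring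
          rw [this, Real.rpow_zero]
      _ ≤ _ := by gcongr

theorem sq_dotProduct_le (u v : ι → ℝ) : (u ⬝ᵥ v) ^ 2 ≤ (u ⬝ᵥ u) * (v ⬝ᵥ v) := by
  have := Finset.sum_mul_sq_le_sq_mul_sq Finset.univ u v
  simpa [dotProduct, sq] using this

theorem dotProduct_self_nonneg' (u : ι → ℝ) : 0 ≤ u ⬝ᵥ u :=
  Finset.sum_nonneg fun _ _ => mul_self_nonneg _

/-- The second derivative of the Bellman function in normalized variables. -/
theorem bellmanQuad_eq {q : ℝ} {u u' : ι → ℝ} {v v' : κ → ℝ}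
    (hu : 0 < u ⬝ᵥ u) (hv : 0 < v ⬝ᵥ v) {θ k N : ℝ}
    (hN : N = bellmanN q (u ⬝ᵥ u) (v ⬝ᵥ v)) (hθ : θ = (u ⬝ᵥ u) ^ (q / (q - 1) / 2) / N)
    (hk : k = (u ⬝ᵥ u) * N ^ ((2 - q) / q) / N) (hE : 1 - θ = (v ⬝ᵥ v) ^ (q / 2) / N) :
    bellmanQuad q u v u' v' = N *
      (2 * (q / (q - 1) / 2 * θ +
        (q - 1) / 8 * (k * (1 + (2 - q) / q * (q / (q - 1) / 2) * θ))) * ((u' ⬝ᵥ u') / (u ⬝ᵥ u)) +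
      2 * (q / 2 * (1 - θ) * (1 + (q - 1) / 8 * ((2 - q) / q) * k)) * ((v' ⬝ᵥ v') / (v ⬝ᵥ v)) +
      4 * bellmanHessS q θ k * ((u ⬝ᵥ u') / (u ⬝ᵥ u)) ^ 2 +
      8 * bellmanHessST q θ k * ((u ⬝ᵥ u') / (u ⬝ᵥ u) * ((v ⬝ᵥ v') / (v ⬝ᵥ v))) +
      4 * bellmanHessT q θ k * ((v ⬝ᵥ v') / (v ⬝ᵥ v)) ^ 2) := by
  have hN0 : 0 < N := hN ▸ bellmanN_pos hu hv
  have hA : (u ⬝ᵥ u) ^ (q / (q - 1) / 2) = θ * N := by rw [hθ, div_mul_cancel₀ _ hN0.ne']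
  have hR : N ^ ((2 - q) / q) = k * N / (u ⬝ᵥ u) := by rw [hk]; field_simp
  have hE' : (v ⬝ᵥ v) ^ (q / 2) = (1 - θ) * N := by rw [hE, div_mul_cancel₀ _ hN0.ne']
  simp only [bellmanQuad, ← hN, ← hθ, ← hk]
  rw [bellmanS, bellmanT, ← hN, hA, hE', hR]
  generalize bellmanHessS q θ k = a1
  generalize bellmanHessST q θ k = a2
  generalize bellmanHessT q θ k = a3
  generalize (2 - q) / q = r
  generalize q / (q - 1) / 2 = P
  field_simp

/-- Convexity of the Bellman function, with a weight `N ^ r` on `|u'|²` and `|v| ^ (q - 2)` on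
`|v'|²`. -/
theorem bellmanQuad_lower {q : ℝ} (hq : 1 < q) (hq2 : q ≤ 2) {u : ι → ℝ} {v : κ → ℝ}
    (hu : 0 < u ⬝ᵥ u) (hv : 0 < v ⬝ᵥ v) (u' : ι → ℝ) (v' : κ → ℝ) :
    (q - 1) / 8 * bellmanN q (u ⬝ᵥ u) (v ⬝ᵥ v) ^ ((2 - q) / q) * (u' ⬝ᵥ u') +
      (q - 1) / 2 * ((v ⬝ᵥ v) ^ (q / 2) / (v ⬝ᵥ v)) * (v' ⬝ᵥ v') ≤ bellmanQuad q u v u' v' := by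
  obtain ⟨h0, h1, h2, h3, -⟩ := bellman_ratios hq hq2 hu hv
  rw [bellmanQuad_eq hu hv rfl rfl rfl h1]
  have hN := bellmanN_pos (q := q) hu hv
  have hθ1 := h2.trans h3
  have h := bellmanHess_lower (ξ := (u ⬝ᵥ u') / (u ⬝ᵥ u)) (η := (v ⬝ᵥ v') / (v ⬝ᵥ v))
    (m := (u' ⬝ᵥ u') / (u ⬝ᵥ u)) (n := (v' ⬝ᵥ v') / (v ⬝ᵥ v)) hq hq2 h0 hθ1 (h0.trans h2) h3
    (by rw [div_pow, div_le_div_iff₀ (by positivity) hu]; nlinarith [sq_dotProduct_le u u'])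
    (by rw [div_pow, div_le_div_iff₀ (by positivity) hv]; nlinarith [sq_dotProduct_le v v'])
  refine le_trans (le_of_eq ?_) (mul_le_mul_of_nonneg_left h hN.le)
  rw [h1]
  field_simp

/-- An upper bound by the weights of `bellmanQuad_lower`. Only its finiteness matters: it gives
integrability of the second derivatives. -/
theorem exists_bellmanQuad_upper {q : ℝ} (hq : 1 < q) (hq2 : q ≤ 2) :
    ∃ C, 0 ≤ C ∧ ∀ (u : ι → ℝ) (v : κ → ℝ), 0 < u ⬝ᵥ u → 0 < v ⬝ᵥ v →
      ∀ (u' : ι → ℝ) (v' : κ → ℝ), |bellmanQuad q u v u' v'| ≤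
        C * (bellmanN q (u ⬝ᵥ u) (v ⬝ᵥ v) ^ ((2 - q) / q) * (u' ⬝ᵥ u') +
          (v ⬝ᵥ v) ^ (q / 2) / (v ⬝ᵥ v) * (v' ⬝ᵥ v')) := by
  obtain ⟨C, hC, H⟩ := exists_bellmanHess_upper hq hq2
  refine ⟨C, hC, fun u v hu hv u' v' => ?_⟩
  have hlow := bellmanQuad_lower hq hq2 hu hv u' v'
  have hN := bellmanN_pos (q := q) hu hv
  have h0' : 0 ≤ bellmanQuad q u v u' v' := by
    refine le_trans ?_ hlow
    have := dotProduct_self_nonneg' u'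
    have := dotProduct_self_nonneg' v'
    have : 0 < q - 1 := by linarith
    positivity
  rw [abs_of_nonneg h0']
  obtain ⟨h0, h1, h2, h3, -⟩ := bellman_ratios hq hq2 hu hv
  rw [bellmanQuad_eq hu hv rfl rfl rfl h1]
  have hθ1 := h2.trans h3
  have h := H _ _ ((u ⬝ᵥ u') / (u ⬝ᵥ u)) ((v ⬝ᵥ v') / (v ⬝ᵥ v))
    ((u' ⬝ᵥ u') / (u ⬝ᵥ u)) ((v' ⬝ᵥ v') / (v ⬝ᵥ v)) h0 hθ1 (h0.trans h2) h3 h2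
    (by rw [div_pow, div_le_div_iff₀ (by positivity) hu]; nlinarith [sq_dotProduct_le u u'])
    (by rw [div_pow, div_le_div_iff₀ (by positivity) hv]; nlinarith [sq_dotProduct_le v v'])
  refine (mul_le_mul_of_nonneg_left h hN.le).trans (le_of_eq ?_)
  rw [h1]
  field_simp

end Vectors

theorem bellmanS_lower {q S T : ℝ} (hq : 1 < q) (hq2 : q ≤ 2) (hS : 0 < S) (hT : 0 < T) :
    (q - 1) / 8 * bellmanN q S T ^ ((2 - q) / q) ≤ bellmanS q S T := by
  have hN := bellmanN_pos (q := q) hS hT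
  have hq0 : 0 < q - 1 := by linarith
  have hq1 : 0 < q := by linarith
  have hr : 0 ≤ (2 - q) / q := div_nonneg (by linarith) hq1.le
  have h1 : 0 ≤ q / (q - 1) / 2 * (S ^ (q / (q - 1) / 2) / S) := by positivity
  have h2 : 0 ≤ (q - 1) / 8 * (bellmanN q S T ^ ((2 - q) / q) * ((2 - q) / q * (q / (q - 1) / 2) *
      (S ^ (q / (q - 1) / 2) / bellmanN q S T))) := by positivity
  unfold bellmanS
  linarith

theorem bellmanT_lower {q S T : ℝ} (hq : 1 < q) (hq2 : q ≤ 2) (hS : 0 < S) (hT : 0 < T) :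
    q / 2 * (T ^ (q / 2) / T) ≤ bellmanT q S T := by
  have hN := bellmanN_pos (q := q) hS hT
  have hq0 : 0 < q - 1 := by linarith
  have hq1 : 0 < q := by linarith
  have hr : 0 ≤ (2 - q) / q := div_nonneg (by linarith) hq1.le
  unfold bellmanT
  refine le_mul_of_one_le_right (by positivity) ?_
  rw [le_add_iff_nonneg_right]
  positivity

theorem exists_bellmanST_upper {q : ℝ} (hq : 1 < q) (hq2 : q ≤ 2) :
    ∃ C, 0 ≤ C ∧ ∀ S T : ℝ, 0 < S → 0 < T →
      bellmanS q S T ≤ C * bellmanN q S T ^ ((2 - q) / q) ∧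
      bellmanT q S T ≤ C * (T ^ (q / 2) / T) := by
  have hq0 : 0 < q - 1 := by linarith
  have hq1 : 0 < q := by linarith
  set P := q / (q - 1) / 2 with hP
  set r := (2 - q) / q with hrdef
  have hr : 0 ≤ r := div_nonneg (by linarith) hq1.le
  have hP0 : 0 ≤ P := by positivity
  refine ⟨(P + (q - 1) / 8 * (1 + r * P)) + q / 2 * (1 + (q - 1) / 8 * r), by positivity,
    fun S T hS hT => ?_⟩
  have hN := bellmanN_pos (q := q) hS hT
  obtain ⟨h0, h1, h2, h3, -⟩ := bellman_ratios hq hq2 hS hT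
  rw [← hP] at h0 h1 h2
  rw [← hrdef] at h2 h3
  have hR := Real.rpow_pos_of_pos hN r
  have hE : 0 < T ^ (q / 2) / T := by positivity
  constructor
  · rw [bellmanS, ← hP, ← hrdef]
    have h4 : S ^ P / S ≤ bellmanN q S T ^ r := by
      rw [div_le_div_iff_of_pos_right hN] at h2
      rw [div_le_iff₀ hS]; linarith
    have h5 : bellmanN q S T ^ r * (1 + r * P * (S ^ P / bellmanN q S T)) ≤
        bellmanN q S T ^ r * (1 + r * P * 1) := by
      gcongr; exact h2.trans h3
    have h6 : P * (S ^ P / S) ≤ P * bellmanN q S T ^ r := by gcongr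
    have h7 : 0 ≤ q / 2 * (1 + (q - 1) / 8 * r) * bellmanN q S T ^ r := by positivity
    nlinarith
  · rw [bellmanT, ← hrdef]
    have h4 : S * (bellmanN q S T ^ r / bellmanN q S T) ≤ 1 := by rwa [← mul_div_assoc]
    have h5 : q / 2 * (T ^ (q / 2) / T) *
        (1 + (q - 1) / 8 * r * (S * (bellmanN q S T ^ r / bellmanN q S T))) ≤
        q / 2 * (T ^ (q / 2) / T) * (1 + (q - 1) / 8 * r * 1) := by gcongr
    have h7 : 0 ≤ (P + (q - 1) / 8 * (1 + r * P)) * (T ^ (q / 2) / T) := by positivity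
    nlinarith

theorem bellman_nonneg {q S T : ℝ} (hq : 1 < q) (hS : 0 < S) (hT : 0 < T) : 0 ≤ bellman q S T := by
  have hN := bellmanN_pos (q := q) hS hT
  have hq0 : 0 < q - 1 := by linarith
  unfold bellman
  positivity

theorem bellman_le {q S T : ℝ} (hq : 1 < q) (hq2 : q ≤ 2) (hS : 0 < S) (hT : 0 < T) :
    bellman q S T ≤ 9 / 8 * bellmanN q S T := by
  have hN := bellmanN_pos (q := q) hS hT
  obtain ⟨-, -, -, h3, -⟩ := bellman_ratios hq hq2 hS hT
  rw [div_le_one hN] at h3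
  unfold bellman
  have : 0 ≤ S * bellmanN q S T ^ ((2 - q) / q) := by positivity
  nlinarith

/-! ### Second-order equations on the half-line -/

theorem HalfLineBound.add {f g : ℝ → ℝ} (hf : HalfLineBound f) (hg : HalfLineBound g) :
    HalfLineBound fun x => f x + g x := by
  obtain ⟨A, hA, h⟩ := hf
  obtain ⟨B, hB, h'⟩ := hg
  refine ⟨A + B + 1, by positivity, fun x hx => ?_⟩
  calc |f x + g x| ≤ |f x| + |g x| := abs_add_le _ _
    _ ≤ (Real.exp (A * (1 + x)) + Real.exp (B * (1 + x))) * Real.exp (-x ^ 2 / 2) := by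
        rw [add_mul]; exact add_le_add (h x hx) (h' x hx)
    _ ≤ _ := mul_le_mul_of_nonneg_right (exp_add_exp_le hA hB hx) (Real.exp_pos _).le

theorem HalfLineBound.const_mul {f : ℝ → ℝ} (hf : HalfLineBound f) (c : ℝ) :
    HalfLineBound fun x => c * f x := by
  obtain ⟨A, hA, h⟩ := hf
  refine ⟨|c| + A, by positivity, fun x hx => ?_⟩
  rw [abs_mul, add_mul, Real.exp_add, mul_assoc]
  exact mul_le_mul (le_exp_mul_one_add (abs_nonneg c) hx) (h x hx) (abs_nonneg _) (Real.exp_pos _).le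

theorem HalfLineBound.sub {f g : ℝ → ℝ} (hf : HalfLineBound f) (hg : HalfLineBound g) :
    HalfLineBound fun x => f x - g x := by
  simpa [sub_eq_add_neg] using hf.add (hg.const_mul (-1))

/-- The derivative of `laguerreQuot`. -/
def laguerreQuotDeriv (a : ℝ) : ℕ → ℝ → ℝ
  | 0, _ => 0
  | n + 1, x => -2 * Real.sqrt (n + 1) *
      (laguerreDel (a + 1) n x - x * laguerreFun (a + 1) n x)

theorem hasDerivAt_laguerreQuot (a : ℝ) (n : ℕ) (x : ℝ) :
    HasDerivAt (laguerreQuot a n) (laguerreQuotDeriv a n x) x := by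
  rcases n with _ | n
  · exact hasDerivAt_const x 0
  · exact (hasDerivAt_laguerreFun (a + 1) n x).const_mul _

theorem continuous_laguerreQuotDeriv (a : ℝ) (n : ℕ) : Continuous (laguerreQuotDeriv a n) := by
  rcases n with _ | n
  · exact continuous_const
  · exact continuous_const.mul ((continuous_laguerreDel _ n).sub
      (continuous_id.mul (continuous_laguerreFun _ n)))

theorem halfLineBound_laguerreQuotDeriv (a : ℝ) (n : ℕ) :
    HalfLineBound (laguerreQuotDeriv a n) := by
  rcases n with _ | n
  · exact ⟨0, le_rfl, fun x _ => by simp [laguerreQuotDeriv, Real.exp_nonneg]⟩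
  · exact ((halfLineBound_laguerreDel _ n).sub (halfLineBound_laguerreFun _ n).id_mul).const_mul _

/-- The data of a regular solution `φ` of the eigenvalue equation
`φ'' + (2 a + 1) / x * φ' = (x² - lam + V) φ` on the half-line. Either `φ` (if `odd`) or `φ'`
(otherwise) vanishes at `0` to first order. -/
structure HalfLineEigen (a lam : ℝ) (V : ℝ → ℝ) (odd : Prop) (φ φ' φ'' : ℝ → ℝ) : Prop where
  cont : Continuous φ
  cont' : Continuous φ'
  cont'' : Continuous φ''
  deriv : ∀ x, HasDerivAt φ (φ' x) x
  deriv' : ∀ x, HasDerivAt φ' (φ'' x) x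
  bound : HalfLineBound φ
  bound' : HalfLineBound φ'
  bound'' : HalfLineBound φ''
  eq : ∀ x, 0 < x → φ'' x + (2 * a + 1) / x * φ' x = (x ^ 2 - lam + V x) * φ x
  parity : ∃ ψ, HalfLineBound ψ ∧ (odd → ∀ x, φ x = x * ψ x) ∧ (¬ odd → ∀ x, φ' x = x * ψ x)

theorem halfLineBound_deriv_laguerreDel (a : ℝ) (n : ℕ) : HalfLineBound fun x =>
    x * laguerreDel a n x - (2 * a + 1) * laguerreQuot a n x - 4 * n * laguerreFun a n x :=
  ((halfLineBound_laguerreDel a n).id_mul.sub ((halfLineBound_laguerreQuot a n).const_mul _)).sub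
    ((halfLineBound_laguerreFun a n).const_mul _)

theorem exists_halfLineEigen_laguerreFun {a : ℝ} (ha : -1 < a) (n : ℕ) :
    ∃ φ' φ'', HalfLineEigen a (4 * n + 2 * a + 2) (fun _ => 0) False (laguerreFun a n) φ' φ'' := by
  refine ⟨fun x => laguerreDel a n x - x * laguerreFun a n x,
    fun x => (x * laguerreDel a n x - (2 * a + 1) * laguerreQuot a n x - 4 * n * laguerreFun a n x) -
      (laguerreFun a n x + x * (laguerreDel a n x - x * laguerreFun a n x)), ?_⟩
  have hF := continuous_laguerreFun a n
  have hD := continuous_laguerreDel a n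
  have hQ := continuous_laguerreQuot a n
  have bF := halfLineBound_laguerreFun a n
  have bD := halfLineBound_laguerreDel a n
  exact
  { cont := hF
    cont' := by fun_prop
    cont'' := by fun_prop
    deriv := hasDerivAt_laguerreFun a n
    deriv' := fun x => by
      refine ((hasDerivAt_laguerreDel ha n x).sub
        ((hasDerivAt_id x).mul (hasDerivAt_laguerreFun a n x))).congr_deriv ?_
      simp
    bound := bF
    bound' := bD.sub bF.id_mul
    bound'' := (halfLineBound_deriv_laguerreDel a n).sub (bF.add (bD.sub bF.id_mul).id_mul)
    eq := fun x hx => by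
      have : laguerreDel a n x = x * laguerreQuot a n x := rfl
      rw [this]
      field_simp
      ring
    parity := ⟨fun x => laguerreQuot a n x - laguerreFun a n x,
      (halfLineBound_laguerreQuot a n).sub bF, fun h => h.elim, fun _ x => by
        simp only [laguerreDel]; ring⟩ }

theorem exists_halfLineEigen_laguerreDel {a : ℝ} (ha : -1 < a) (n : ℕ) :
    ∃ φ' φ'', HalfLineEigen a (4 * n + 2 * a + 2) (fun x => 2 + (2 * a + 1) / x ^ 2) True
      (laguerreDel a n) φ' φ'' := by
  set φ' : ℝ → ℝ := fun x =>
    x * laguerreDel a n x - (2 * a + 1) * laguerreQuot a n x - 4 * n * laguerreFun a n x with hφ'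
  refine ⟨φ', fun x => (laguerreDel a n x + x * φ' x) - (2 * a + 1) * laguerreQuotDeriv a n x -
    4 * n * (laguerreDel a n x - x * laguerreFun a n x), ?_⟩
  have hF := continuous_laguerreFun a n
  have hD := continuous_laguerreDel a n
  have hQ := continuous_laguerreQuot a n
  have hQ' := continuous_laguerreQuotDeriv a n
  have bF := halfLineBound_laguerreFun a n
  have bD := halfLineBound_laguerreDel a n
  have hc : Continuous φ' := by fun_prop
  have bφ' : HalfLineBound φ' := halfLineBound_deriv_laguerreDel a n
  exact
  { cont := hD
    cont' := hc
    cont'' := by fun_prop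
    deriv := hasDerivAt_laguerreDel ha n
    deriv' := fun x => by
      refine ((((hasDerivAt_id x).mul (hasDerivAt_laguerreDel ha n x)).sub
        ((hasDerivAt_laguerreQuot a n x).const_mul _)).sub
        ((hasDerivAt_laguerreFun a n x).const_mul _)).congr_deriv ?_
      simp [hφ']
    bound := bD
    bound' := bφ'
    bound'' := ((bD.add bφ'.id_mul).sub ((halfLineBound_laguerreQuotDeriv a n).const_mul _)).sub
      ((bD.sub bF.id_mul).const_mul _)
    eq := fun x hx => by
      have h1 : laguerreQuotDeriv a n x = (φ' x - laguerreQuot a n x) / x := by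
        have h2 := (hasDerivAt_id x).mul (hasDerivAt_laguerreQuot a n x)
        have h3 := h2.unique (hasDerivAt_laguerreDel ha n x)
        simp only [id, one_mul] at h3
        rw [eq_div_iff hx.ne', hφ']
        linarith
      have h4 : laguerreDel a n x = x * laguerreQuot a n x := rfl
      rw [h1, hφ']
      simp only [h4]
      field_simp
      ring
    parity := ⟨laguerreQuot a n, halfLineBound_laguerreQuot a n, fun _ _ => rfl,
      fun h => (h trivial).elim⟩ }


/-! ### Poisson extensions -/

/-- The decay rate in `t` of the Poisson semigroup, i.e. the square root of the lowest
eigenvalue. -/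
def groundRate (α : Fin d → ℝ) : ℝ := Real.sqrt (laguerreEigenvalue α 0)

theorem groundRate_pos (hd : 0 < d) {α : Fin d → ℝ} (hα : ∀ i, -(1 / 2 : ℝ) ≤ α i) :
    0 < groundRate α := by
  refine Real.sqrt_pos.2 (Finset.sum_pos (fun i _ => ?_) ⟨⟨0, hd⟩, Finset.mem_univ _⟩)
  have := hα i
  simp only [Pi.zero_apply, CharP.cast_eq_zero]
  linarith

theorem groundRate_le (α : Fin d → ℝ) (k : Fin d → ℕ) :
    groundRate α ≤ Real.sqrt (laguerreEigenvalue α k) := by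
  refine Real.sqrt_le_sqrt (Finset.sum_le_sum fun i _ => ?_)
  have : (0 : ℝ) ≤ k i := Nat.cast_nonneg _
  simp only [Pi.zero_apply, CharP.cast_eq_zero]
  linarith

/-- The Poisson extension of the (unnormalized) ground state `exp (-|x|² / 2)`. -/
def groundState (α : Fin d → ℝ) (t : ℝ) (x : Fin d → ℝ) : ℝ :=
  Real.exp (-(t * groundRate α)) * Real.exp (-(1 / 2) * ∑ i, x i ^ 2)

theorem groundState_pos (α : Fin d → ℝ) (t : ℝ) (x : Fin d → ℝ) : 0 < groundState α t x := by
  unfold groundState; positivity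

theorem groundState_le_one (α : Fin d → ℝ) {t : ℝ} (ht : 0 ≤ t) (x : Fin d → ℝ) :
    groundState α t x ≤ 1 := by
  have h0 : 0 ≤ groundRate α := Real.sqrt_nonneg _
  have h1 : 0 ≤ ∑ i, x i ^ 2 := Finset.sum_nonneg fun i _ => sq_nonneg _
  refine mul_le_one₀ (Real.exp_le_one_iff.2 ?_) (Real.exp_pos _).le (Real.exp_le_one_iff.2 ?_)
  · have := mul_nonneg ht h0; linarith
  · linarith

/-- `f` is bounded on the half-space over the orthant by an exponential times the `s`-th power
of the ground state. -/
def PoissonBound (α : Fin d → ℝ) (s : ℝ) (f : ℝ → (Fin d → ℝ) → ℝ) : Prop :=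
  ∃ A, 0 ≤ A ∧ ∀ t, 0 ≤ t → ∀ x : Fin d → ℝ, (∀ i, 0 < x i) →
    |f t x| ≤ Real.exp (A * (1 + ∑ i, x i)) * groundState α t x ^ s

section PoissonBound

variable {α : Fin d → ℝ} {s s' : ℝ} {f g : ℝ → (Fin d → ℝ) → ℝ}

theorem PoissonBound.of_le (hg : PoissonBound α s g)
    (h : ∀ t, 0 ≤ t → ∀ x : Fin d → ℝ, (∀ i, 0 < x i) → |f t x| ≤ |g t x|) : PoissonBound α s f := by
  obtain ⟨A, hA, h'⟩ := hg
  exact ⟨A, hA, fun t ht x hx => (h t ht x hx).trans (h' t ht x hx)⟩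

theorem PoissonBound.congr (hg : PoissonBound α s g)
    (h : ∀ t, 0 ≤ t → ∀ x : Fin d → ℝ, (∀ i, 0 < x i) → f t x = g t x) : PoissonBound α s f :=
  hg.of_le fun t ht x hx => (congrArg abs (h t ht x hx)).le

theorem PoissonBound.add (hf : PoissonBound α s f) (hg : PoissonBound α s g) :
    PoissonBound α s fun t x => f t x + g t x := by
  obtain ⟨A, hA, h⟩ := hf
  obtain ⟨B, hB, h'⟩ := hg
  refine ⟨A + B + 1, by positivity, fun t ht x hx => ?_⟩
  have hs : 0 ≤ ∑ i, x i := Finset.sum_nonneg fun i _ => (hx i).le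
  calc |f t x + g t x| ≤ |f t x| + |g t x| := abs_add_le _ _
    _ ≤ (Real.exp (A * (1 + ∑ i, x i)) + Real.exp (B * (1 + ∑ i, x i))) *
        groundState α t x ^ s := by
        rw [add_mul]; exact add_le_add (h t ht x hx) (h' t ht x hx)
    _ ≤ _ := mul_le_mul_of_nonneg_right (exp_add_exp_le hA hB hs)
        (Real.rpow_nonneg (groundState_pos α t x).le _)

theorem PoissonBound.mul (hf : PoissonBound α s f) (hg : PoissonBound α s' g) :
    PoissonBound α (s + s') fun t x => f t x * g t x := by
  obtain ⟨A, hA, h⟩ := hf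
  obtain ⟨B, hB, h'⟩ := hg
  refine ⟨A + B, by positivity, fun t ht x hx => ?_⟩
  have h0 := groundState_pos α t x
  rw [abs_mul]
  refine (mul_le_mul (h t ht x hx) (h' t ht x hx) (abs_nonneg _) (by positivity)).trans_eq ?_
  rw [mul_mul_mul_comm, ← Real.exp_add, ← Real.rpow_add h0]
  congr 2
  ring

theorem poissonBound_const (C : ℝ) : PoissonBound α 0 fun _ _ => C := by
  refine ⟨|C|, abs_nonneg _, fun t _ x hx => ?_⟩
  have hs : 0 ≤ ∑ i, x i := Finset.sum_nonneg fun i _ => (hx i).le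
  simpa using le_exp_mul_one_add (abs_nonneg C) hs

theorem PoissonBound.const_mul (hf : PoissonBound α s f) (C : ℝ) :
    PoissonBound α s fun t x => C * f t x := by
  simpa using (poissonBound_const C).mul hf

theorem poissonBound_zero : PoissonBound α s fun _ _ => 0 :=
  ⟨0, le_rfl, fun t _ x _ => by
    simpa using Real.rpow_nonneg (groundState_pos α t x).le s⟩

theorem PoissonBound.sum {ι : Type*} (S : Finset ι) {F : ι → ℝ → (Fin d → ℝ) → ℝ}
    (hF : ∀ j ∈ S, PoissonBound α s (F j)) : PoissonBound α s fun t x => ∑ j ∈ S, F j t x := by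
  classical
  induction S using Finset.induction_on with
  | empty => simpa using poissonBound_zero
  | insert i S hi ih =>
    simp only [Finset.sum_insert hi]
    exact (hF i (Finset.mem_insert_self i S)).add
      (ih fun j hj => hF j (Finset.mem_insert_of_mem hj))

theorem PoissonBound.mono (hf : PoissonBound α s f) (h : s' ≤ s) : PoissonBound α s' f := by
  obtain ⟨A, hA, hb⟩ := hf
  refine ⟨A, hA, fun t ht x hx => (hb t ht x hx).trans ?_⟩
  exact mul_le_mul_of_nonneg_left (Real.rpow_le_rpow_of_exponent_ge (groundState_pos α t x)
    (groundState_le_one α ht x) h) (Real.exp_pos _).le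

theorem PoissonBound.rpow (hf : PoissonBound α s f) {r : ℝ} (hr : 0 ≤ r) :
    PoissonBound α (s * r) fun t x => |f t x| ^ r := by
  obtain ⟨A, hA, h⟩ := hf
  refine ⟨A * r, by positivity, fun t ht x hx => ?_⟩
  have h0 := groundState_pos α t x
  rw [abs_of_nonneg (by positivity)]
  refine (Real.rpow_le_rpow (abs_nonneg _) (h t ht x hx) hr).trans_eq ?_
  rw [Real.mul_rpow (Real.exp_pos _).le (Real.rpow_nonneg h0.le _), ← Real.exp_mul,
    ← Real.rpow_mul h0.le]
  congr 2
  ring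

theorem poissonBound_exp_mul {g : (Fin d → ℝ) → ℝ} (hg : GaussBound (1 / 2) g) {ρ : ℝ}
    (hρ : groundRate α ≤ ρ) : PoissonBound α 1 fun t x => Real.exp (-(t * ρ)) * g x := by
  obtain ⟨A, hA, h⟩ := hg
  refine ⟨A, hA, fun t ht x hx => ?_⟩
  rw [Real.rpow_one, abs_mul, abs_of_pos (Real.exp_pos _), groundState, mul_left_comm]
  refine mul_le_mul (Real.exp_le_exp.2 ?_) (h x hx) (abs_nonneg _) (Real.exp_pos _).le
  have := mul_le_mul_of_nonneg_left hρ ht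
  linarith

theorem PoissonBound.gaussBound (hf : PoissonBound α s f) {t : ℝ} (ht : 0 ≤ t) :
    GaussBound (s / 2) (f t) := by
  obtain ⟨A, hA, h⟩ := hf
  refine ⟨A + |s| * (t * groundRate α), by
    have : 0 ≤ groundRate α := Real.sqrt_nonneg _
    positivity, fun x hx => (h t ht x hx).trans ?_⟩
  have h0 : 0 ≤ t * groundRate α := mul_nonneg ht (Real.sqrt_nonneg _)
  have hs : 0 ≤ ∑ i, x i := Finset.sum_nonneg fun i _ => (hx i).le
  rw [groundState, Real.mul_rpow (Real.exp_pos _).le (Real.exp_pos _).le, ← Real.exp_mul,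
    ← Real.exp_mul, ← mul_assoc, ← Real.exp_add]
  refine mul_le_mul (Real.exp_le_exp.2 ?_) (Real.exp_le_exp.2 (le_of_eq (by ring)))
    (Real.exp_pos _).le (Real.exp_pos _).le
  have h1 : -(t * groundRate α) * s ≤ |s| * (t * groundRate α) := by
    have := neg_abs_le s
    nlinarith
  have h2 : 0 ≤ |s| * (t * groundRate α) * ∑ i, x i := by positivity
  linarith

end PoissonBound

/-- The potential in `(∂_t² + ∑ i, ∂_i² + (2 α_i + 1) / x_i ∂_i) w = (|x|² + potential) w`, where
`w` is the Poisson extension of a combination of the `ℓ_k^α` (for `o = none`) or of the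
`δ_i ℓ_k^α` (for `o = some i`). It is the commutator of `δ_i` with its adjoint, and nonnegative
exactly because `α_i ≥ -1 / 2`. -/
def tensorPotential (α : Fin d → ℝ) (o : Option (Fin d)) (x : Fin d → ℝ) : ℝ :=
  o.elim 0 fun i => 2 + (2 * α i + 1) / x i ^ 2

theorem tensorPotential_nonneg {α : Fin d → ℝ} (hα : ∀ i, -(1 / 2 : ℝ) ≤ α i)
    (o : Option (Fin d)) (x : Fin d → ℝ) : 0 ≤ tensorPotential α o x := by
  rcases o with _ | i
  · exact le_rfl
  · have : 0 ≤ 2 * α i + 1 := by linarith [hα i]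
    simp only [tensorPotential, Option.elim]
    positivity

/-- A solution `w(t, x)` of the Poisson equation, bundled with its derivatives and their bounds by
the ground state. In the variable `x_j` it is odd if `o = some j` and even otherwise; `parity`
records the first-order vanishing at `x_j = 0` of the function or of its derivative. -/
structure PoissonExt (α : Fin d → ℝ) (o : Option (Fin d)) where
  w : ℝ → (Fin d → ℝ) → ℝ
  wt : ℝ → (Fin d → ℝ) → ℝ
  wtt : ℝ → (Fin d → ℝ) → ℝ
  wx : Fin d → ℝ → (Fin d → ℝ) → ℝ
  wxx : Fin d → ℝ → (Fin d → ℝ) → ℝ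
  meas : Measurable fun z : ℝ × (Fin d → ℝ) => w z.1 z.2
  meas_t : Measurable fun z : ℝ × (Fin d → ℝ) => wt z.1 z.2
  meas_tt : Measurable fun z : ℝ × (Fin d → ℝ) => wtt z.1 z.2
  meas_x : ∀ j, Measurable fun z : ℝ × (Fin d → ℝ) => wx j z.1 z.2
  meas_xx : ∀ j, Measurable fun z : ℝ × (Fin d → ℝ) => wxx j z.1 z.2
  deriv_t : ∀ t x, HasDerivAt (fun s => w s x) (wt t x) t
  deriv_tt : ∀ t x, HasDerivAt (fun s => wt s x) (wtt t x) t
  deriv_x : ∀ j t x, HasDerivAt (fun s => w t (Function.update x j s)) (wx j t x) (x j)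
  deriv_xx : ∀ j t x, HasDerivAt (fun s => wx j t (Function.update x j s)) (wxx j t x) (x j)
  eq : ∀ t x, (∀ i, 0 < x i) →
    wtt t x + ∑ j, (wxx j t x + (2 * α j + 1) / x j * wx j t x) =
      (∑ i, x i ^ 2 + tensorPotential α o x) * w t x
  bound : PoissonBound α 1 w
  bound_t : PoissonBound α 1 wt
  bound_tt : PoissonBound α 1 wtt
  bound_x : ∀ j, PoissonBound α 1 (wx j)
  bound_xx : ∀ j, PoissonBound α 1 (wxx j)
  parity : ∀ j, PoissonBound α 1 fun t x => (if o = some j then w t x else wx j t x) / x j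

/-- Finite linear combinations of Poisson extensions. -/
def PoissonExt.lin {α : Fin d → ℝ} {o : Option (Fin d)} {K : Type*} (S : Finset K) (c : K → ℝ)
    (F : K → PoissonExt α o) : PoissonExt α o where
  w t x := ∑ k ∈ S, c k * (F k).w t x
  wt t x := ∑ k ∈ S, c k * (F k).wt t x
  wtt t x := ∑ k ∈ S, c k * (F k).wtt t x
  wx j t x := ∑ k ∈ S, c k * (F k).wx j t x
  wxx j t x := ∑ k ∈ S, c k * (F k).wxx j t x
  meas := Finset.measurable_fun_sum _ fun k _ => (F k).meas.const_mul _
  meas_t := Finset.measurable_fun_sum _ fun k _ => (F k).meas_t.const_mul _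
  meas_tt := Finset.measurable_fun_sum _ fun k _ => (F k).meas_tt.const_mul _
  meas_x j := Finset.measurable_fun_sum _ fun k _ => ((F k).meas_x j).const_mul _
  meas_xx j := Finset.measurable_fun_sum _ fun k _ => ((F k).meas_xx j).const_mul _
  deriv_t t x := HasDerivAt.fun_sum fun k _ => ((F k).deriv_t t x).const_mul _
  deriv_tt t x := HasDerivAt.fun_sum fun k _ => ((F k).deriv_tt t x).const_mul _
  deriv_x j t x := HasDerivAt.fun_sum fun k _ => ((F k).deriv_x j t x).const_mul _
  deriv_xx j t x := HasDerivAt.fun_sum fun k _ => ((F k).deriv_xx j t x).const_mul _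
  eq t x hx := by
    simp only [Finset.mul_sum]
    simp only [← Finset.sum_add_distrib]
    rw [Finset.sum_comm, ← Finset.sum_add_distrib]
    refine Finset.sum_congr rfl fun k _ => ?_
    rw [mul_left_comm _ (c k), ← (F k).eq t x hx, mul_add, Finset.mul_sum]
    congr 1
    exact Finset.sum_congr rfl fun j _ => by ring
  bound := PoissonBound.sum S fun k _ => (F k).bound.const_mul _
  bound_t := PoissonBound.sum S fun k _ => (F k).bound_t.const_mul _
  bound_tt := PoissonBound.sum S fun k _ => (F k).bound_tt.const_mul _
  bound_x j := PoissonBound.sum S fun k _ => ((F k).bound_x j).const_mul _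
  bound_xx j := PoissonBound.sum S fun k _ => ((F k).bound_xx j).const_mul _
  parity j := by
    refine (PoissonBound.sum S fun k _ => ((F k).parity j).const_mul (c k)).congr
      fun t _ x _ => ?_
    split_ifs
    · rw [Finset.sum_div]; exact Finset.sum_congr rfl fun k _ => by ring
    · rw [Finset.sum_div]; exact Finset.sum_congr rfl fun k _ => by ring

theorem exists_halfLineEigen_tensorFactor {α : Fin d → ℝ} (hα : ∀ i, -1 < α i)
    (o : Option (Fin d)) (k : Fin d → ℕ) (j : Fin d) :
    ∃ φ' φ'', HalfLineEigen (α j) (4 * k j + 2 * α j + 2)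
      (fun x => if o = some j then 2 + (2 * α j + 1) / x ^ 2 else 0) (o = some j)
      (tensorFactor α o k j) φ' φ'' := by
  by_cases h : o = some j
  · obtain ⟨φ', φ'', H⟩ := exists_halfLineEigen_laguerreDel (hα j) (k j)
    refine ⟨φ', φ'', ?_⟩
    subst h
    have h1 : tensorFactor α (some j) k j = laguerreDel (α j) (k j) := by simp [tensorFactor]
    simpa [h1] using H
  · obtain ⟨φ', φ'', H⟩ := exists_halfLineEigen_laguerreFun (hα j) (k j)
    refine ⟨φ', φ'', ?_⟩
    have h1 : tensorFactor α o k j = laguerreFun (α j) (k j) := by simp [tensorFactor, h]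
    simpa [h1, h] using H

theorem prod_update_fun (φ : Fin d → ℝ → ℝ) (j : Fin d) (ψ : ℝ → ℝ) (x : Fin d → ℝ) :
    ∏ i, Function.update φ j ψ i (x i) = ψ (x j) * ∏ i ∈ Finset.univ.erase j, φ i (x i) := by
  rw [prod_eq_mul_erase _ x j, Function.update_self]
  congr 1
  exact Finset.prod_congr rfl fun i hi => by rw [Function.update_of_ne (Finset.ne_of_mem_erase hi)]

theorem prod_erase_update (φ : Fin d → ℝ → ℝ) (x : Fin d → ℝ) (j : Fin d) (s : ℝ) :
    ∏ i ∈ Finset.univ.erase j, φ i (Function.update x j s i) =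
      ∏ i ∈ Finset.univ.erase j, φ i (x i) :=
  Finset.prod_congr rfl fun i hi => by rw [Function.update_of_ne (Finset.ne_of_mem_erase hi)]

theorem gaussBound_update {φ : Fin d → ℝ → ℝ} (h : ∀ j, HalfLineBound (φ j)) (j : Fin d)
    {ψ : ℝ → ℝ} (hψ : HalfLineBound ψ) :
    GaussBound (1 / 2) fun x : Fin d → ℝ => ψ (x j) * ∏ i ∈ Finset.univ.erase j, φ i (x i) := by
  simp only [← prod_update_fun]
  refine gaussBound_prod fun i => ?_
  by_cases hi : i = j
  · subst hi; simpa using hψ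
  · simpa [hi] using h i

/-- The function `exp (-t √λ_k)` times `ℓ_k^α` or `δ_i ℓ_k^α` is a Poisson extension. -/
theorem exists_poissonExt {α : Fin d → ℝ} (hα : ∀ i, -(1 / 2 : ℝ) ≤ α i) (o : Option (Fin d))
    (k : Fin d → ℕ) : ∃ F : PoissonExt α o,
      (∀ t x, F.w t x = Real.exp (-(t * Real.sqrt (laguerreEigenvalue α k))) * tensorFun α o k x) ∧
      (∀ t x, F.wt t x = -Real.sqrt (laguerreEigenvalue α k) * F.w t x) := by
  have hα' : ∀ i, -1 < α i := fun i => by linarith [hα i]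
  have hlam : 0 ≤ laguerreEigenvalue α k := Finset.sum_nonneg fun i _ => by
    have := hα i
    have : (0 : ℝ) ≤ k i := Nat.cast_nonneg _
    linarith
  choose φ' φ'' H using exists_halfLineEigen_tensorFactor hα' o k
  set φ := tensorFactor α o k with hφ
  set lam := laguerreEigenvalue α k with hlamdef
  set ρ := Real.sqrt lam with hρ
  have hρ2 : ρ * ρ = lam := Real.mul_self_sqrt hlam
  have hle : groundRate α ≤ ρ := groundRate_le α k
  have hexp : ∀ t, HasDerivAt (fun s => Real.exp (-(s * ρ))) (-ρ * Real.exp (-(t * ρ))) t := by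
    intro t
    refine (((hasDerivAt_id t).mul_const ρ).fun_neg).exp.congr_deriv ?_
    simp; ring
  have hG : GaussBound (1 / 2) (tensorFun α o k) := gaussBound_tensorFun α o k
  have hme : Measurable fun z : ℝ × (Fin d → ℝ) => Real.exp (-(z.1 * ρ)) :=
    (by fun_prop : Continuous fun z : ℝ × (Fin d → ℝ) => Real.exp (-(z.1 * ρ))).measurable
  have hmw : Measurable fun z : ℝ × (Fin d → ℝ) => tensorFun α o k z.2 :=
    (continuous_tensorFun α o k).measurable.comp measurable_snd
  have hmx : ∀ (ψ : ℝ → ℝ) (j : Fin d), Continuous ψ → Measurable fun z : ℝ × (Fin d → ℝ) =>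
      ψ (z.2 j) * ∏ i ∈ Finset.univ.erase j, φ i (z.2 i) := by
    intro ψ j hψ
    have : Continuous fun z : ℝ × (Fin d → ℝ) =>
        ψ (z.2 j) * ∏ i ∈ Finset.univ.erase j, φ i (z.2 i) := by
      refine (hψ.comp (by fun_prop)).mul (continuous_finsetProd _ fun i _ => ?_)
      exact (H i).cont.comp (by fun_prop)
    exact this.measurable
  have hprod : ∀ x j, tensorFun α o k x = φ j (x j) * ∏ i ∈ Finset.univ.erase j, φ i (x i) :=
    fun x j => prod_eq_mul_erase _ x j
  refine ⟨
    { w := fun t x => Real.exp (-(t * ρ)) * tensorFun α o k x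
      wt := fun t x => -ρ * (Real.exp (-(t * ρ)) * tensorFun α o k x)
      wtt := fun t x => lam * (Real.exp (-(t * ρ)) * tensorFun α o k x)
      wx := fun j t x => Real.exp (-(t * ρ)) *
        (φ' j (x j) * ∏ i ∈ Finset.univ.erase j, φ i (x i))
      wxx := fun j t x => Real.exp (-(t * ρ)) *
        (φ'' j (x j) * ∏ i ∈ Finset.univ.erase j, φ i (x i))
      meas := hme.mul hmw
      meas_t := (hme.mul hmw).const_mul _
      meas_tt := (hme.mul hmw).const_mul _
      meas_x := fun j => hme.mul (hmx _ j (H j).cont')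
      meas_xx := fun j => hme.mul (hmx _ j (H j).cont'')
      deriv_t := fun t x => ((hexp t).mul_const _).congr_deriv (by ring)
      deriv_tt := fun t x => (((hexp t).mul_const _).const_mul (-ρ)).congr_deriv (by
        rw [← hρ2]; ring)
      deriv_x := fun j t x => by
        have h : (fun s => Real.exp (-(t * ρ)) * tensorFun α o k (Function.update x j s)) =
            fun s => Real.exp (-(t * ρ)) *
              (φ j s * ∏ i ∈ Finset.univ.erase j, φ i (x i)) :=
          funext fun s => congrArg _ (prod_update_eq φ x j s)
        simp only [h]
        exact (((H j).deriv (x j)).mul_const _).const_mul _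
      deriv_xx := fun j t x => by
        simp only [Function.update_self, prod_erase_update]
        exact (((H j).deriv' (x j)).mul_const _).const_mul _
      eq := fun t x hx => by
        have h1 : ∀ j, Real.exp (-(t * ρ)) *
            (φ'' j (x j) * ∏ i ∈ Finset.univ.erase j, φ i (x i)) +
            (2 * α j + 1) / x j * (Real.exp (-(t * ρ)) *
              (φ' j (x j) * ∏ i ∈ Finset.univ.erase j, φ i (x i))) =
            (x j ^ 2 - (4 * k j + 2 * α j + 2) +
              if o = some j then 2 + (2 * α j + 1) / x j ^ 2 else 0) *
              (Real.exp (-(t * ρ)) * tensorFun α o k x) := by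
          intro j
          rw [hprod x j]
          linear_combination (Real.exp (-(t * ρ)) * ∏ i ∈ Finset.univ.erase j, φ i (x i)) *
            (H j).eq (x j) (hx j)
        have h2 : ∑ j, (if o = some j then 2 + (2 * α j + 1) / x j ^ 2 else 0) =
            tensorPotential α o x := by
          rcases o with _ | i
          · simp [tensorPotential]
          · simp only [Option.some.injEq, tensorPotential, Option.elim]
            rw [Finset.sum_ite_eq]; simp
        simp only [h1]
        rw [← Finset.sum_mul, Finset.sum_add_distrib, Finset.sum_sub_distrib, h2, hlamdef,
          laguerreEigenvalue]
        ring
      bound := poissonBound_exp_mul hG hle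
      bound_t := (poissonBound_exp_mul hG hle).const_mul _
      bound_tt := (poissonBound_exp_mul hG hle).const_mul _
      bound_x := fun j => poissonBound_exp_mul
        (gaussBound_update (fun i => (H i).bound) j (H j).bound') hle
      bound_xx := fun j => poissonBound_exp_mul
        (gaussBound_update (fun i => (H i).bound) j (H j).bound'') hle
      parity := fun j => by
        obtain ⟨ψ, hψ, h1, h2⟩ := (H j).parity
        refine (poissonBound_exp_mul (gaussBound_update (fun i => (H i).bound) j hψ) hle).congr
          fun t _ x hx => ?_
        have := (hx j).ne'
        split_ifs with h
        · rw [hprod x j, h1 h]; field_simp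
        · rw [h2 h]; field_simp }, fun _ _ => rfl, fun _ _ => rfl⟩

/-! ### Integration over the half-space above the orthant -/

section Measurable

variable {Z : Type*} [MeasurableSpace Z] {ι κ : Type*} [Fintype ι] [Fintype κ]

theorem measurable_bellmanN {q : ℝ} {S T : Z → ℝ} (hS : Measurable S) (hT : Measurable T) :
    Measurable fun z => bellmanN q (S z) (T z) := by
  unfold bellmanN; fun_prop

theorem measurable_bellman {q : ℝ} {S T : Z → ℝ} (hS : Measurable S) (hT : Measurable T) :
    Measurable fun z => bellman q (S z) (T z) := by
  have := measurable_bellmanN (q := q) hS hT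
  unfold bellman; fun_prop

theorem measurable_bellmanS {q : ℝ} {S T : Z → ℝ} (hS : Measurable S) (hT : Measurable T) :
    Measurable fun z => bellmanS q (S z) (T z) := by
  have := measurable_bellmanN (q := q) hS hT
  unfold bellmanS; fun_prop

theorem measurable_bellmanT {q : ℝ} {S T : Z → ℝ} (hS : Measurable S) (hT : Measurable T) :
    Measurable fun z => bellmanT q (S z) (T z) := by
  have := measurable_bellmanN (q := q) hS hT
  unfold bellmanT; fun_prop

theorem measurable_dotProduct {u v : Z → ι → ℝ} (hu : ∀ i, Measurable fun z => u z i)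
    (hv : ∀ i, Measurable fun z => v z i) : Measurable fun z => u z ⬝ᵥ v z :=
  Finset.measurable_fun_sum _ fun i _ => (hu i).mul (hv i)

theorem measurable_bellmanGrad {q : ℝ} {u u' : Z → ι → ℝ} {v v' : Z → κ → ℝ}
    (hu : ∀ i, Measurable fun z => u z i) (hv : ∀ i, Measurable fun z => v z i)
    (hu' : ∀ i, Measurable fun z => u' z i) (hv' : ∀ i, Measurable fun z => v' z i) :
    Measurable fun z => bellmanGrad q (u z) (v z) (u' z) (v' z) := by
  have hS := measurable_dotProduct hu hu
  have hT := measurable_dotProduct hv hv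
  exact ((measurable_bellmanS hS hT).mul ((measurable_dotProduct hu hu').const_mul 2)).add
    ((measurable_bellmanT hS hT).mul ((measurable_dotProduct hv hv').const_mul 2))

theorem measurable_bellmanQuad {q : ℝ} {u u' : Z → ι → ℝ} {v v' : Z → κ → ℝ}
    (hu : ∀ i, Measurable fun z => u z i) (hv : ∀ i, Measurable fun z => v z i)
    (hu' : ∀ i, Measurable fun z => u' z i) (hv' : ∀ i, Measurable fun z => v' z i) :
    Measurable fun z => bellmanQuad q (u z) (v z) (u' z) (v' z) := by
  have hS := measurable_dotProduct hu hu
  have hT := measurable_dotProduct hv hv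
  have h1 := measurable_bellmanN (q := q) hS hT
  have h2 := measurable_bellmanS (q := q) hS hT
  have h3 := measurable_bellmanT (q := q) hS hT
  have h4 := measurable_dotProduct hu' hu'
  have h5 := measurable_dotProduct hv' hv'
  have h6 := measurable_dotProduct hu hu'
  have h7 := measurable_dotProduct hv hv'
  simp only [bellmanQuad, bellmanHessS, bellmanHessST, bellmanHessT]
  fun_prop

end Measurable

theorem ae_prod_pos (α : Fin d → ℝ) :
    ∀ᵐ z ∂((volume.restrict (Set.Ioi (0 : ℝ))).prod (laguerreMeasure α)),
      0 < z.1 ∧ ∀ i, 0 < z.2 i := by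
  have h4 : ∀ᵐ t ∂(volume.restrict (Set.Ioi (0 : ℝ))), 0 < t := ae_restrict_mem measurableSet_Ioi
  exact (Measure.quasiMeasurePreserving_fst.ae h4).and
    (Measure.quasiMeasurePreserving_snd.ae (laguerreMeasure_ae_pos α))

/-- Integrability of `t f(t, x)` for a function bounded by a positive power of the ground state. -/
theorem PoissonBound.integrable (hd : 0 < d) {α : Fin d → ℝ} (hα : ∀ i, -(1 / 2 : ℝ) ≤ α i) {s : ℝ}
    (hs : 0 < s) {f : ℝ → (Fin d → ℝ) → ℝ} (hf : PoissonBound α s f)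
    (hm : Measurable fun z : ℝ × (Fin d → ℝ) => f z.1 z.2) :
    Integrable (fun z : ℝ × (Fin d → ℝ) => z.1 * f z.1 z.2)
      ((volume.restrict (Set.Ioi (0 : ℝ))).prod (laguerreMeasure α)) := by
  obtain ⟨A, hA, h⟩ := hf
  have hΛ := groundRate_pos hd hα
  have h1 : Integrable (fun t : ℝ => t * Real.exp (-(s * groundRate α) * t))
      (volume.restrict (Set.Ioi (0 : ℝ))) := by
    have := integrableOn_rpow_mul_exp_neg_mul_rpow (p := 1) (s := 1) (b := s * groundRate α)
      (by norm_num) one_pos (by positivity)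
    simpa [IntegrableOn] using this
  have h2 := h1.mul_prod (integrable_exp_gauss_pi hα A (half_pos hs))
  refine h2.mono' (measurable_fst.mul hm).aestronglyMeasurable ?_
  filter_upwards [ae_prod_pos α] with z hz
  rw [Real.norm_eq_abs, abs_mul, abs_of_pos hz.1]
  refine (mul_le_mul_of_nonneg_left (h z.1 hz.1.le z.2 hz.2) hz.1.le).trans_eq ?_
  rw [groundState, Real.mul_rpow (Real.exp_pos _).le (Real.exp_pos _).le, ← Real.exp_mul,
    ← Real.exp_mul]
  have h5 : -(z.1 * groundRate α) * s = -(s * groundRate α) * z.1 := by ring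
  have h6 : (-(1 / 2) * ∑ i, z.2 i ^ 2) * s = -(s / 2) * ∑ i, z.2 i ^ 2 := by ring
  rw [h5, h6]
  ring

/-- `∫∫ t ∂_t² b = ∫ b(0, ·)`. -/
theorem integral_mul_deriv_two (hd : 0 < d) {α : Fin d → ℝ} (hα : ∀ i, -(1 / 2 : ℝ) ≤ α i) {s : ℝ}
    (hs : 0 < s) {b bt btt : ℝ → (Fin d → ℝ) → ℝ} (hb : PoissonBound α s b)
    (hbt : PoissonBound α s bt) (hbtt : PoissonBound α s btt)
    (hm : Measurable fun z : ℝ × (Fin d → ℝ) => btt z.1 z.2)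
    (h1 : ∀ t x, HasDerivAt (fun s => b s x) (bt t x) t)
    (h2 : ∀ t x, HasDerivAt (fun s => bt s x) (btt t x) t) :
    ∫ z, z.1 * btt z.1 z.2 ∂((volume.restrict (Set.Ioi (0 : ℝ))).prod (laguerreMeasure α)) =
      ∫ x, b 0 x ∂laguerreMeasure α := by
  have hint := hbtt.integrable hd hα hs hm
  rw [integral_prod_symm _ hint]
  refine integral_congr_ae ?_
  filter_upwards [hint.prod_left_ae, laguerreMeasure_ae_pos α] with x hx hpos
  have hΛ := groundRate_pos hd hα
  have hlim : ∀ {f : ℝ → (Fin d → ℝ) → ℝ}, PoissonBound α s f →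
      ∀ n : ℕ, Tendsto (fun t => t ^ n * f t x) atTop (𝓝 0) := by
    intro f hf n
    obtain ⟨A, hA, h⟩ := hf
    have h5 : Tendsto (fun t : ℝ => Real.exp (A * (1 + ∑ i, x i)) *
        Real.exp (-(s / 2) * ∑ i, x i ^ 2) * (t ^ n * Real.exp (-(s * groundRate α) * t)))
        atTop (𝓝 0) := by
      have h6 := (isLittleO_pow_exp_pos_mul_atTop n (b := s * groundRate α)
        (by positivity)).tendsto_div_nhds_zero
      have h7 : (fun t : ℝ => t ^ n / Real.exp (s * groundRate α * t)) =
          fun t => t ^ n * Real.exp (-(s * groundRate α) * t) := by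
        funext t; rw [neg_mul, Real.exp_neg, div_eq_mul_inv]
      rw [h7] at h6
      simpa using h6.const_mul (Real.exp (A * (1 + ∑ i, x i)) *
        Real.exp (-(s / 2) * ∑ i, x i ^ 2))
    refine squeeze_zero_norm' ?_ h5
    filter_upwards [eventually_ge_atTop 0] with t ht
    rw [Real.norm_eq_abs, abs_mul, abs_of_nonneg (pow_nonneg ht n)]
    refine (mul_le_mul_of_nonneg_left (h t ht x hpos) (pow_nonneg ht n)).trans_eq ?_
    rw [groundState, Real.mul_rpow (Real.exp_pos _).le (Real.exp_pos _).le, ← Real.exp_mul,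
      ← Real.exp_mul]
    have h5 : -(t * groundRate α) * s = -(s * groundRate α) * t := by ring
    have h6 : (-(1 / 2) * ∑ i, x i ^ 2) * s = -(s / 2) * ∑ i, x i ^ 2 := by ring
    rw [h5, h6]
    ring
  have hF : ∀ t ∈ Set.Ici (0 : ℝ), HasDerivAt (fun t => t * bt t x - b t x) (t * btt t x) t := by
    intro t _
    refine (((hasDerivAt_id t).mul (h2 t x)).sub (h1 t x)).congr_deriv ?_
    simp
  have hlimF : Tendsto (fun t => t * bt t x - b t x) atTop (𝓝 0) := by
    simpa using (hlim hbt 1).sub (hlim hb 0)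
  have := integral_Ioi_of_hasDerivAt_of_tendsto' hF hx hlimF
  rw [this]
  simp

/-- The weighted divergence of a bounded field in the direction of `x_j` has integral zero. -/
theorem integral_mul_divergence_eq_zero (hd : 0 < d) {α : Fin d → ℝ}
    (hα : ∀ i, -(1 / 2 : ℝ) ≤ α i) {s : ℝ} (hs : 0 < s) (j : Fin d)
    {b' b'' : ℝ → (Fin d → ℝ) → ℝ}
    (hb' : PoissonBound α s fun t x => b' t x / x j) (hb'' : PoissonBound α s b'')
    (hm' : Measurable fun z : ℝ × (Fin d → ℝ) => b' z.1 z.2)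
    (hm'' : Measurable fun z : ℝ × (Fin d → ℝ) => b'' z.1 z.2)
    (h : ∀ t x, HasDerivAt (fun s => b' t (Function.update x j s)) (b'' t x) (x j)) :
    Integrable (fun z : ℝ × (Fin d → ℝ) =>
        z.1 * (b'' z.1 z.2 + (2 * α j + 1) / z.2 j * b' z.1 z.2))
      ((volume.restrict (Set.Ioi (0 : ℝ))).prod (laguerreMeasure α)) ∧
    ∫ z, z.1 * (b'' z.1 z.2 + (2 * α j + 1) / z.2 j * b' z.1 z.2)
      ∂((volume.restrict (Set.Ioi (0 : ℝ))).prod (laguerreMeasure α)) = 0 := by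
  have hB : PoissonBound α s fun t x => b'' t x + (2 * α j + 1) / x j * b' t x :=
    (hb''.add (hb'.const_mul (2 * α j + 1))).congr fun t _ x _ => by ring
  have hm : Measurable fun z : ℝ × (Fin d → ℝ) =>
      b'' z.1 z.2 + (2 * α j + 1) / z.2 j * b' z.1 z.2 := by
    have : Measurable fun z : ℝ × (Fin d → ℝ) => z.2 j := (measurable_pi_apply j).comp measurable_snd
    fun_prop
  have hint := hB.integrable hd hα hs hm
  refine ⟨hint, ?_⟩
  rw [integral_prod _ hint]
  refine integral_eq_zero_of_ae ?_
  have h4 : ∀ᵐ t ∂(volume.restrict (Set.Ioi (0 : ℝ))), 0 < t := ae_restrict_mem measurableSet_Ioi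
  filter_upwards [h4] with t ht
  simp only [Pi.zero_apply]
  rw [integral_const_mul]
  refine mul_eq_zero_of_right _ (integral_eq_zero_of_lines j
    ((hB.gaussBound ht.le).integrable hα (by positivity)
      (hm.comp measurable_prodMk_left).aestronglyMeasurable) fun x hx hline => ?_)
  simp only [Function.update_self] at hline ⊢
  obtain ⟨A, hA, hle⟩ := hb'.gaussBound ht.le
  refine integral_divergence_eq_zero (A := A * (1 + ∑ i ∈ Finset.univ.erase j, x i))
    (c := s / 2) (hα j) (by positivity) (φ := fun r => b' t (Function.update x j r))
    (fun r hr => ?_) (fun r hr => ?_) hline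
  · have := h t (Function.update x j r)
    simpa using this
  · have hpos : ∀ i, 0 < Function.update x j r i := fun i => by
      by_cases hi : i = j
      · subst hi; simpa using hr
      · simpa [hi] using hx i
    have h1 := hle _ hpos
    simp only at h1
    rw [Function.update_self, abs_div, abs_of_pos hr, div_le_iff₀ hr, mul_comm _ r] at h1
    refine h1.trans (mul_le_mul_of_nonneg_left (mul_le_mul (Real.exp_le_exp.2 ?_)
      (Real.exp_le_exp.2 ?_) (Real.exp_pos _).le (Real.exp_pos _).le) hr.le)
    · have h2 : ∑ i, Function.update x j r i = r + ∑ i ∈ Finset.univ.erase j, x i := by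
        rw [← Finset.add_sum_erase _ _ (Finset.mem_univ j), Function.update_self]
        congr 1
        exact Finset.sum_congr rfl fun i hi => by
          rw [Function.update_of_ne (Finset.ne_of_mem_erase hi)]
      have h3 : 0 ≤ ∑ i ∈ Finset.univ.erase j, x i := Finset.sum_nonneg fun i _ => (hx i).le
      rw [h2, mul_assoc]
      refine mul_le_mul_of_nonneg_left ?_ hA
      nlinarith [mul_nonneg h3 hr.le]
    · have h2 : r ^ 2 ≤ ∑ i, Function.update x j r i ^ 2 := by
        have := Finset.single_le_sum (f := fun i => Function.update x j r i ^ 2)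
          (fun i _ => sq_nonneg _) (Finset.mem_univ j)
        simpa using this
      have := half_pos hs
      nlinarith

/-! ### The Bellman function along Poisson extensions -/

section Embedding

variable {α : Fin d → ℝ} {ι κ : Type*} [Fintype ι] [Fintype κ] {o : ι → Option (Fin d)}
  {o' : κ → Option (Fin d)}

/-- The squared length of the full gradient of a family of Poisson extensions, the harmonic
oscillator potential included. -/
def poissonEnergy (U : ∀ i, PoissonExt α (o i)) (t : ℝ) (x : Fin d → ℝ) : ℝ :=
  ((fun i => (U i).wt t x) ⬝ᵥ fun i => (U i).wt t x) +
    ∑ j, ((fun i => (U i).wx j t x) ⬝ᵥ fun i => (U i).wx j t x) +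
    (∑ j, x j ^ 2) * ((fun i => (U i).w t x) ⬝ᵥ fun i => (U i).w t x)

theorem poissonEnergy_nonneg (U : ∀ i, PoissonExt α (o i)) (t : ℝ) (x : Fin d → ℝ) :
    0 ≤ poissonEnergy U t x :=
  add_nonneg (add_nonneg (dotProduct_self_nonneg' _)
    (Finset.sum_nonneg fun _ _ => dotProduct_self_nonneg' _))
    (mul_nonneg (Finset.sum_nonneg fun _ _ => sq_nonneg _) (dotProduct_self_nonneg' _))

/-- The Bellman function `b` composed with two families of Poisson extensions, after application
of `∂_t² + ∑ j, ∂_j² + (2 α_j + 1) / x_j ∂_j`. -/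
def bellmanLap (q : ℝ) (U : ∀ i, PoissonExt α (o i)) (V : ∀ i, PoissonExt α (o' i)) (t : ℝ)
    (x : Fin d → ℝ) : ℝ :=
  (bellmanQuad q (fun i => (U i).w t x) (fun i => (V i).w t x)
      (fun i => (U i).wt t x) (fun i => (V i).wt t x) +
    bellmanGrad q (fun i => (U i).w t x) (fun i => (V i).w t x)
      (fun i => (U i).wtt t x) (fun i => (V i).wtt t x)) +
  ∑ j, ((bellmanQuad q (fun i => (U i).w t x) (fun i => (V i).w t x)
      (fun i => (U i).wx j t x) (fun i => (V i).wx j t x) +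
    bellmanGrad q (fun i => (U i).w t x) (fun i => (V i).w t x)
      (fun i => (U i).wxx j t x) (fun i => (V i).wxx j t x)) +
    (2 * α j + 1) / x j * bellmanGrad q (fun i => (U i).w t x) (fun i => (V i).w t x)
      (fun i => (U i).wx j t x) (fun i => (V i).wx j t x))

theorem dotProduct_lap (U : ∀ i, PoissonExt α (o i)) (t : ℝ) {x : Fin d → ℝ} (hx : ∀ i, 0 < x i) :
    ((fun i => (U i).w t x) ⬝ᵥ fun i => (U i).wtt t x) +
      ∑ j, (((fun i => (U i).w t x) ⬝ᵥ fun i => (U i).wxx j t x) +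
        (2 * α j + 1) / x j * ((fun i => (U i).w t x) ⬝ᵥ fun i => (U i).wx j t x)) =
    ∑ i, (∑ j, x j ^ 2 + tensorPotential α (o i) x) * ((U i).w t x * (U i).w t x) := by
  simp only [dotProduct, Finset.mul_sum, ← Finset.sum_add_distrib]
  rw [Finset.sum_comm, ← Finset.sum_add_distrib]
  refine Finset.sum_congr rfl fun i _ => ?_
  rw [← mul_assoc, ← (U i).eq t x hx, add_mul, Finset.sum_mul]
  congr 1
  · ring
  · exact Finset.sum_congr rfl fun j _ => by ring

/-- Here `α_i ≥ -1 / 2` enters: the potential beyond `|x|²` is dropped because it is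
nonnegative. -/
theorem le_dotProduct_lap (hα : ∀ i, -(1 / 2 : ℝ) ≤ α i) (U : ∀ i, PoissonExt α (o i)) (t : ℝ)
    {x : Fin d → ℝ} (hx : ∀ i, 0 < x i) :
    (∑ j, x j ^ 2) * ((fun i => (U i).w t x) ⬝ᵥ fun i => (U i).w t x) ≤
    ((fun i => (U i).w t x) ⬝ᵥ fun i => (U i).wtt t x) +
      ∑ j, (((fun i => (U i).w t x) ⬝ᵥ fun i => (U i).wxx j t x) +
        (2 * α j + 1) / x j * ((fun i => (U i).w t x) ⬝ᵥ fun i => (U i).wx j t x)) := by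
  rw [dotProduct_lap U t hx, dotProduct, Finset.mul_sum]
  refine Finset.sum_le_sum fun i _ => mul_le_mul_of_nonneg_right ?_ (mul_self_nonneg _)
  linarith [tensorPotential_nonneg hα (o i) x]

/-- The Bellman function composed with Poisson extensions is subharmonic, with a quantitative lower
bound. The second derivatives are bounded below by `bellmanQuad_lower`; the first derivatives
multiply the potential, so that `|x|²` contributes the zero-order part of the two energies. -/
theorem bellmanLap_lower (hα : ∀ i, -(1 / 2 : ℝ) ≤ α i) {q : ℝ} (hq : 1 < q) (hq2 : q ≤ 2)
    (U : ∀ i, PoissonExt α (o i)) (V : ∀ i, PoissonExt α (o' i)) {t : ℝ} {x : Fin d → ℝ}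
    (hx : ∀ i, 0 < x i) (hU : 0 < (fun i => (U i).w t x) ⬝ᵥ fun i => (U i).w t x)
    (hV : 0 < (fun i => (V i).w t x) ⬝ᵥ fun i => (V i).w t x) {Ψ : ℝ}
    (hΨ : Ψ ^ 2 ≤ 2 * (poissonEnergy U t x * poissonEnergy V t x)) :
    (q - 1) / 3 * |Ψ| ≤ bellmanLap q U V t x := by
  have hq0 : 0 < q - 1 := by linarith
  set u := fun i => (U i).w t x with hu
  set v := fun i => (V i).w t x with hv
  set R := bellmanN q (u ⬝ᵥ u) (v ⬝ᵥ v) ^ ((2 - q) / q) with hR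
  set E := (v ⬝ᵥ v) ^ (q / 2) / (v ⬝ᵥ v) with hE
  have hR0 : 0 < R := Real.rpow_pos_of_pos (bellmanN_pos hU hV) _
  have hE0 : 0 < E := div_pos (Real.rpow_pos_of_pos hV _) hV
  obtain ⟨-, -, -, -, hRE⟩ := bellman_ratios hq hq2 hU hV
  have hFS := bellmanS_lower hq hq2 hU hV
  have hFT := bellmanT_lower hq hq2 hU hV
  set FS := bellmanS q (u ⬝ᵥ u) (v ⬝ᵥ v) with hFSdef
  set FT := bellmanT q (u ⬝ᵥ u) (v ⬝ᵥ v) with hFTdef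
  have hX2 : 0 ≤ ∑ j, x j ^ 2 := Finset.sum_nonneg fun _ _ => sq_nonneg _
  -- The terms of first order combine to the two potentials.
  have hfirst : bellmanGrad q u v (fun i => (U i).wtt t x) (fun i => (V i).wtt t x) +
      ∑ j, (bellmanGrad q u v (fun i => (U i).wxx j t x) (fun i => (V i).wxx j t x) +
        (2 * α j + 1) / x j * bellmanGrad q u v (fun i => (U i).wx j t x)
          (fun i => (V i).wx j t x)) =
      2 * FS * ((u ⬝ᵥ fun i => (U i).wtt t x) + ∑ j, ((u ⬝ᵥ fun i => (U i).wxx j t x) +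
        (2 * α j + 1) / x j * (u ⬝ᵥ fun i => (U i).wx j t x))) +
      2 * FT * ((v ⬝ᵥ fun i => (V i).wtt t x) + ∑ j, ((v ⬝ᵥ fun i => (V i).wxx j t x) +
        (2 * α j + 1) / x j * (v ⬝ᵥ fun i => (V i).wx j t x))) := by
    have : ∀ j, bellmanGrad q u v (fun i => (U i).wxx j t x) (fun i => (V i).wxx j t x) +
        (2 * α j + 1) / x j * bellmanGrad q u v (fun i => (U i).wx j t x)
          (fun i => (V i).wx j t x) =
        2 * FS * ((u ⬝ᵥ fun i => (U i).wxx j t x) +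
          (2 * α j + 1) / x j * (u ⬝ᵥ fun i => (U i).wx j t x)) +
        2 * FT * ((v ⬝ᵥ fun i => (V i).wxx j t x) +
          (2 * α j + 1) / x j * (v ⬝ᵥ fun i => (V i).wx j t x)) := by
      intro j
      simp only [bellmanGrad, ← hFSdef, ← hFTdef]
      ring
    simp only [this]
    rw [Finset.sum_add_distrib, ← Finset.mul_sum, ← Finset.mul_sum]
    simp only [bellmanGrad, ← hFSdef, ← hFTdef]
    ring
  have hlapU := le_dotProduct_lap hα U t hx
  have hlapV := le_dotProduct_lap hα V t hx
  rw [← hu] at hlapU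
  rw [← hv] at hlapV
  have hFS0 : 0 ≤ FS := le_trans (by positivity) hFS
  have hFT0 : 0 ≤ FT := le_trans (by positivity) hFT
  have hU2 : (q - 1) / 8 * R * ((∑ j, x j ^ 2) * (u ⬝ᵥ u)) ≤
      2 * FS * ((u ⬝ᵥ fun i => (U i).wtt t x) + ∑ j, ((u ⬝ᵥ fun i => (U i).wxx j t x) +
        (2 * α j + 1) / x j * (u ⬝ᵥ fun i => (U i).wx j t x))) := by
    refine mul_le_mul (by linarith) hlapU (mul_nonneg hX2 hU.le) (by linarith)
  have hV2 : (q - 1) / 2 * E * ((∑ j, x j ^ 2) * (v ⬝ᵥ v)) ≤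
      2 * FT * ((v ⬝ᵥ fun i => (V i).wtt t x) + ∑ j, ((v ⬝ᵥ fun i => (V i).wxx j t x) +
        (2 * α j + 1) / x j * (v ⬝ᵥ fun i => (V i).wx j t x))) := by
    refine mul_le_mul ?_ hlapV (mul_nonneg hX2 hV.le) (by linarith)
    have : (q - 1) / 2 * E ≤ q / 2 * E := by gcongr; linarith
    linarith
  have hQt := bellmanQuad_lower hq hq2 hU hV (fun i => (U i).wt t x) (fun i => (V i).wt t x)
  have hQx : ∑ j, ((q - 1) / 8 * R * ((fun i => (U i).wx j t x) ⬝ᵥ fun i => (U i).wx j t x) +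
      (q - 1) / 2 * E * ((fun i => (V i).wx j t x) ⬝ᵥ fun i => (V i).wx j t x)) ≤
      ∑ j, bellmanQuad q u v (fun i => (U i).wx j t x) (fun i => (V i).wx j t x) :=
    Finset.sum_le_sum fun j _ =>
      bellmanQuad_lower hq hq2 hU hV (fun i => (U i).wx j t x) (fun i => (V i).wx j t x)
  rw [Finset.sum_add_distrib, ← Finset.mul_sum, ← Finset.mul_sum] at hQx
  have hlow : (q - 1) / 8 * R * poissonEnergy U t x + (q - 1) / 2 * E * poissonEnergy V t x ≤
      bellmanLap q U V t x := by
    have hsplit : bellmanLap q U V t x =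
        bellmanQuad q u v (fun i => (U i).wt t x) (fun i => (V i).wt t x) +
        ∑ j, bellmanQuad q u v (fun i => (U i).wx j t x) (fun i => (V i).wx j t x) +
        (bellmanGrad q u v (fun i => (U i).wtt t x) (fun i => (V i).wtt t x) +
          ∑ j, (bellmanGrad q u v (fun i => (U i).wxx j t x) (fun i => (V i).wxx j t x) +
            (2 * α j + 1) / x j * bellmanGrad q u v (fun i => (U i).wx j t x)
              (fun i => (V i).wx j t x))) := by
      simp only [bellmanLap, Finset.sum_add_distrib]
      ring
    rw [hsplit, hfirst]
    simp only [poissonEnergy, ← hu, ← hv]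
    linarith
  refine le_trans ?_ hlow
  have hX := poissonEnergy_nonneg U t x
  have hY := poissonEnergy_nonneg V t x
  set X := poissonEnergy U t x
  set Y := poissonEnergy V t x
  refine abs_le_of_sq_le_sq' ?_ (by positivity) |>.2
  -- The arithmetic-geometric mean inequality and `1 ≤ R * E` give `(q - 1)² / 4 * X * Y`, which
  -- dominates `(q - 1)² / 9 * Ψ²` because `2 / 9 ≤ 1 / 4`.
  have h1 : 4 * ((q - 1) / 8 * R * X) * ((q - 1) / 2 * E * Y) ≤
      ((q - 1) / 8 * R * X + (q - 1) / 2 * E * Y) ^ 2 := four_mul_le_sq_add _ _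
  have h2 : (q - 1) ^ 2 / 4 * (X * Y) ≤ 4 * ((q - 1) / 8 * R * X) * ((q - 1) / 2 * E * Y) := by
    have : (q - 1) ^ 2 / 4 * (X * Y) * 1 ≤ (q - 1) ^ 2 / 4 * (X * Y) * (R * E) := by gcongr
    linarith
  have h3 : ((q - 1) / 3 * |Ψ|) ^ 2 = (q - 1) ^ 2 / 9 * Ψ ^ 2 := by
    rw [mul_pow, sq_abs]; ring
  rw [h3]
  have h4 : (q - 1) ^ 2 / 9 * Ψ ^ 2 ≤ (q - 1) ^ 2 / 9 * (2 * (X * Y)) := by gcongr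
  have h5 : 0 ≤ (q - 1) ^ 2 * (X * Y) := by positivity
  linarith

end Embedding

/-! ### The bilinear embedding -/

section Embedding

variable {α : Fin d → ℝ} {ι κ : Type*} [Fintype ι] [Fintype κ] {o : ι → Option (Fin d)}
  {o' : κ → Option (Fin d)}

theorem poissonBound_dotProduct {u v : ι → ℝ → (Fin d → ℝ) → ℝ}
    (hu : ∀ i, PoissonBound α 1 (u i)) (hv : ∀ i, PoissonBound α 1 (v i)) :
    PoissonBound α 2 fun t x => (fun i => u i t x) ⬝ᵥ fun i => v i t x := by
  have h : (2 : ℝ) = 1 + 1 := by norm_num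
  rw [h]
  exact PoissonBound.sum Finset.univ fun i _ => (hu i).mul (hv i)

section Bounds

variable {q ε : ℝ} {u u' : ι → ℝ → (Fin d → ℝ) → ℝ} {v v' : κ → ℝ → (Fin d → ℝ) → ℝ}

theorem dotProduct_pos_of_le (hε : 0 < ε)
    (h : ∀ t x, (ε * groundState α t x) ^ 2 ≤ (fun i => u i t x) ⬝ᵥ fun i => u i t x)
    (t : ℝ) (x : Fin d → ℝ) : 0 < (fun i => u i t x) ⬝ᵥ fun i => u i t x :=
  lt_of_lt_of_le (by have := groundState_pos α t x; positivity) (h t x)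

theorem poissonBound_bellmanN (hq : 1 < q) (hq2 : q ≤ 2) (hu : ∀ i, PoissonBound α 1 (u i))
    (hv : ∀ i, PoissonBound α 1 (v i)) :
    PoissonBound α q fun t x => bellmanN q ((fun i => u i t x) ⬝ᵥ fun i => u i t x)
      ((fun i => v i t x) ⬝ᵥ fun i => v i t x) := by
  have hq0 : 0 < q - 1 := by linarith
  have h1 := (poissonBound_dotProduct hu hu).rpow (r := q / (q - 1) / 2) (by positivity)
  have h2 := (poissonBound_dotProduct hv hv).rpow (r := q / 2) (by positivity)
  have h3 : q ≤ 2 * (q / (q - 1) / 2) := by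
    rw [mul_div_cancel₀ _ two_ne_zero, le_div_iff₀ hq0]; nlinarith
  refine ((h1.mono h3).add (h2.mono (by linarith))).congr fun t _ x _ => ?_
  rw [abs_of_nonneg (dotProduct_self_nonneg' _), abs_of_nonneg (dotProduct_self_nonneg' _)]
  rfl

theorem poissonBound_bellmanN_rpow (hq : 1 < q) (hq2 : q ≤ 2) (hu : ∀ i, PoissonBound α 1 (u i))
    (hv : ∀ i, PoissonBound α 1 (v i))
    (hu0 : ∀ t x, 0 < (fun i => u i t x) ⬝ᵥ fun i => u i t x)
    (hv0 : ∀ t x, 0 < (fun i => v i t x) ⬝ᵥ fun i => v i t x) :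
    PoissonBound α (q - 2) fun t x => bellmanN q ((fun i => u i t x) ⬝ᵥ fun i => u i t x)
      ((fun i => v i t x) ⬝ᵥ fun i => v i t x) ^ ((2 - q) / q) := by
  have h1 := (poissonBound_bellmanN hq hq2 hu hv).rpow (r := (2 - q) / q)
    (div_nonneg (by linarith) (by linarith))
  have h2 : q - 2 ≤ q * ((2 - q) / q) := by
    rw [mul_div_cancel₀ _ (by linarith)]; linarith
  refine (h1.mono h2).congr fun t _ x _ => ?_
  rw [abs_of_pos (bellmanN_pos (hu0 t x) (hv0 t x))]

/-- The singular factor `|v| ^ (q - 2)` is controlled by the lower bound on `|v|`, since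
`q - 2 ≤ 0`. -/
theorem poissonBound_rpow_div (hq2 : q ≤ 2) (hε : 0 < ε)
    (h : ∀ t x, (ε * groundState α t x) ^ 2 ≤ (fun i => v i t x) ⬝ᵥ fun i => v i t x) :
    PoissonBound α (q - 2) fun t x => ((fun i => v i t x) ⬝ᵥ fun i => v i t x) ^ (q / 2) /
      ((fun i => v i t x) ⬝ᵥ fun i => v i t x) := by
  have h1 : PoissonBound α (q - 2) fun t x => ε ^ (q - 2) * groundState α t x ^ (q - 2) := by
    refine PoissonBound.const_mul ⟨0, le_rfl, fun t _ x _ => ?_⟩ _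
    rw [abs_of_nonneg (Real.rpow_nonneg (groundState_pos α t x).le _)]
    simp
  refine h1.of_le fun t _ x _ => ?_
  have h0 := groundState_pos α t x
  have hT := dotProduct_pos_of_le hε h t x
  rw [← Real.rpow_sub_one hT.ne', abs_of_nonneg (by positivity), abs_of_nonneg (by positivity)]
  refine (Real.rpow_le_rpow_of_nonpos (by positivity) (h t x) (by linarith)).trans_eq ?_
  rw [← Real.rpow_natCast, ← Real.rpow_mul (by positivity), Real.mul_rpow hε.le h0.le]
  have : ((2 : ℕ) : ℝ) * (q / 2 - 1) = q - 2 := by push_cast; ring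
  rw [this]

/-- The bound on the directional derivative of the Bellman function, in the form of a bound on the
scalar products; `c` is `1` or, near a wall of the orthant, `1 / x_j`. -/
theorem poissonBound_bellmanGrad_aux (hq : 1 < q) (hq2 : q ≤ 2) (hε : 0 < ε)
    (hu : ∀ i, PoissonBound α 1 (u i)) (hv : ∀ i, PoissonBound α 1 (v i))
    (hu0 : ∀ t x, (ε * groundState α t x) ^ 2 ≤ (fun i => u i t x) ⬝ᵥ fun i => u i t x)
    (hv0 : ∀ t x, (ε * groundState α t x) ^ 2 ≤ (fun i => v i t x) ⬝ᵥ fun i => v i t x)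
    {c : (Fin d → ℝ) → ℝ}
    (hcu : PoissonBound α 2 fun t x => ((fun i => u i t x) ⬝ᵥ fun i => u' i t x) * c x)
    (hcv : PoissonBound α 2 fun t x => ((fun i => v i t x) ⬝ᵥ fun i => v' i t x) * c x) :
    PoissonBound α q fun t x => bellmanGrad q (fun i => u i t x) (fun i => v i t x)
      (fun i => u' i t x) (fun i => v' i t x) * c x := by
  obtain ⟨C, hC, H⟩ := exists_bellmanST_upper hq hq2
  have hu1 := dotProduct_pos_of_le hε hu0
  have hv1 := dotProduct_pos_of_le hε hv0
  have hq0 : 0 < q - 1 := by linarith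
  have hS : PoissonBound α (q - 2) fun t x => bellmanS q ((fun i => u i t x) ⬝ᵥ fun i => u i t x)
      ((fun i => v i t x) ⬝ᵥ fun i => v i t x) := by
    refine ((poissonBound_bellmanN_rpow hq hq2 hu hv hu1 hv1).const_mul C).of_le fun t _ x _ => ?_
    have h1 := bellmanS_lower hq hq2 (hu1 t x) (hv1 t x)
    have h2 := Real.rpow_pos_of_pos (bellmanN_pos (q := q) (hu1 t x) (hv1 t x)) ((2 - q) / q)
    rw [abs_of_nonneg (le_trans (by positivity) h1), abs_of_nonneg (by positivity)]
    exact (H _ _ (hu1 t x) (hv1 t x)).1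
  have hT : PoissonBound α (q - 2) fun t x => bellmanT q ((fun i => u i t x) ⬝ᵥ fun i => u i t x)
      ((fun i => v i t x) ⬝ᵥ fun i => v i t x) := by
    refine ((poissonBound_rpow_div hq2 hε hv0).const_mul C).of_le fun t _ x _ => ?_
    have h1 := bellmanT_lower hq hq2 (hu1 t x) (hv1 t x)
    have h2 := Real.rpow_pos_of_pos (hv1 t x) (q / 2)
    have h3 := hv1 t x
    rw [abs_of_nonneg (le_trans (by positivity) h1), abs_of_nonneg (by positivity)]
    exact (H _ _ (hu1 t x) (hv1 t x)).2
  have h := ((hS.mul hcu).add (hT.mul hcv)).const_mul 2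
  rw [sub_add_cancel] at h
  refine h.congr fun t _ x _ => ?_
  rw [bellmanGrad]
  ring

theorem poissonBound_bellmanGrad (hq : 1 < q) (hq2 : q ≤ 2) (hε : 0 < ε)
    (hu : ∀ i, PoissonBound α 1 (u i)) (hv : ∀ i, PoissonBound α 1 (v i))
    (hu0 : ∀ t x, (ε * groundState α t x) ^ 2 ≤ (fun i => u i t x) ⬝ᵥ fun i => u i t x)
    (hv0 : ∀ t x, (ε * groundState α t x) ^ 2 ≤ (fun i => v i t x) ⬝ᵥ fun i => v i t x)
    (hu' : ∀ i, PoissonBound α 1 (u' i)) (hv' : ∀ i, PoissonBound α 1 (v' i)) :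
    PoissonBound α q fun t x => bellmanGrad q (fun i => u i t x) (fun i => v i t x)
      (fun i => u' i t x) (fun i => v' i t x) := by
  have := poissonBound_bellmanGrad_aux hq hq2 hε hu hv hu0 hv0 (c := fun _ => 1)
    (by simpa using poissonBound_dotProduct hu hu') (by simpa using poissonBound_dotProduct hv hv')
  simpa using this

theorem poissonBound_bellmanQuad (hq : 1 < q) (hq2 : q ≤ 2) (hε : 0 < ε)
    (hu : ∀ i, PoissonBound α 1 (u i)) (hv : ∀ i, PoissonBound α 1 (v i))
    (hu0 : ∀ t x, (ε * groundState α t x) ^ 2 ≤ (fun i => u i t x) ⬝ᵥ fun i => u i t x)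
    (hv0 : ∀ t x, (ε * groundState α t x) ^ 2 ≤ (fun i => v i t x) ⬝ᵥ fun i => v i t x)
    (hu' : ∀ i, PoissonBound α 1 (u' i)) (hv' : ∀ i, PoissonBound α 1 (v' i)) :
    PoissonBound α q fun t x => bellmanQuad q (fun i => u i t x) (fun i => v i t x)
      (fun i => u' i t x) (fun i => v' i t x) := by
  obtain ⟨C, hC, H⟩ := exists_bellmanQuad_upper (ι := ι) (κ := κ) hq hq2
  have hu1 := dotProduct_pos_of_le hε hu0
  have hv1 := dotProduct_pos_of_le hε hv0
  have h := ((((poissonBound_bellmanN_rpow hq hq2 hu hv hu1 hv1).mul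
    (poissonBound_dotProduct hu' hu')).add ((poissonBound_rpow_div hq2 hε hv0).mul
    (poissonBound_dotProduct hv' hv')))).const_mul C
  rw [sub_add_cancel] at h
  refine h.of_le fun t _ x _ => ?_
  exact (H _ _ (hu1 t x) (hv1 t x) _ _).trans (le_abs_self _)

end Bounds

/-- The length of the family is at least `ε` times the ground state. In particular it vanishes
nowhere, so that the Bellman function is smooth along the family. -/
def Nondegenerate (ε : ℝ) (U : ∀ i, PoissonExt α (o i)) : Prop :=
  ∀ t x, (ε * groundState α t x) ^ 2 ≤ (fun i => (U i).w t x) ⬝ᵥ fun i => (U i).w t x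

/-- In each product of a component with its derivative, one factor vanishes at the wall `x_j = 0`
by parity. -/
theorem poissonBound_parity (U : ∀ i, PoissonExt α (o i)) (j : Fin d) :
    PoissonBound α 2 fun t x =>
      ((fun i => (U i).w t x) ⬝ᵥ fun i => (U i).wx j t x) * (x j)⁻¹ := by
  have h : PoissonBound α 2 fun t x => ∑ i, ((if o i = some j then (U i).w t x
      else (U i).wx j t x) / x j) * (if o i = some j then (U i).wx j t x else (U i).w t x) := by
    refine PoissonBound.sum Finset.univ fun i _ => ?_
    have h2 : (2 : ℝ) = 1 + 1 := by norm_num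
    rw [h2]
    refine ((U i).parity j).mul ?_
    split_ifs
    · exact (U i).bound_x j
    · exact (U i).bound
  refine h.congr fun t _ x _ => ?_
  rw [dotProduct, Finset.sum_mul]
  refine Finset.sum_congr rfl fun i _ => ?_
  split_ifs <;> ring

/-- The bilinear embedding theorem for two nondegenerate families of Poisson extensions. The
composed Bellman function is integrated by parts over the half-space: the derivatives in `x` drop
out, those in `t` leave its value at `t = 0`. -/
theorem bilinear_embedding (hd : 0 < d) (hα : ∀ i, -(1 / 2 : ℝ) ≤ α i) {q : ℝ} (hq : 1 < q)
    (hq2 : q ≤ 2) {ε : ℝ} (hε : 0 < ε) (U : ∀ i, PoissonExt α (o i)) (V : ∀ i, PoissonExt α (o' i))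
    (hU : Nondegenerate ε U) (hV : Nondegenerate ε V) {Ψ : ℝ → (Fin d → ℝ) → ℝ}
    (hΨi : Integrable (fun z : ℝ × (Fin d → ℝ) => z.1 * Ψ z.1 z.2)
      ((volume.restrict (Set.Ioi (0 : ℝ))).prod (laguerreMeasure α)))
    (hΨ : ∀ t x, Ψ t x ^ 2 ≤ 2 * (poissonEnergy U t x * poissonEnergy V t x)) :
    (q - 1) / 3 * |∫ z, z.1 * Ψ z.1 z.2
      ∂((volume.restrict (Set.Ioi (0 : ℝ))).prod (laguerreMeasure α))| ≤
      9 / 8 * ∫ x, bellmanN q ((fun i => (U i).w 0 x) ⬝ᵥ fun i => (U i).w 0 x)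
        ((fun i => (V i).w 0 x) ⬝ᵥ fun i => (V i).w 0 x) ∂laguerreMeasure α := by
  have hq0 : 0 < q - 1 := by linarith
  have hqp : 0 < q := by linarith
  have hU0 := dotProduct_pos_of_le hε hU
  have hV0 := dotProduct_pos_of_le hε hV
  have bU := fun i => (U i).bound
  have bV := fun i => (V i).bound
  have mU := fun i => (U i).meas
  have mV := fun i => (V i).meas
  set m := (volume.restrict (Set.Ioi (0 : ℝ))).prod (laguerreMeasure α) with hm
  -- The second derivative in `t`.
  have hb : PoissonBound α q fun t x => bellman q ((fun i => (U i).w t x) ⬝ᵥ fun i => (U i).w t x)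
      ((fun i => (V i).w t x) ⬝ᵥ fun i => (V i).w t x) := by
    refine ((poissonBound_bellmanN hq hq2 bU bV).const_mul (9 / 8)).of_le fun t _ x _ => ?_
    have h1 := bellman_le hq hq2 (hU0 t x) (hV0 t x)
    rw [abs_of_nonneg (bellman_nonneg hq (hU0 t x) (hV0 t x))]
    exact h1.trans (le_abs_self _)
  have hbtt := (poissonBound_bellmanQuad hq hq2 hε bU bV hU hV (fun i => (U i).bound_t)
    (fun i => (V i).bound_t)).add (poissonBound_bellmanGrad hq hq2 hε bU bV hU hV
    (fun i => (U i).bound_tt) (fun i => (V i).bound_tt))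
  have mtt : Measurable fun z : ℝ × (Fin d → ℝ) =>
      bellmanQuad q (fun i => (U i).w z.1 z.2) (fun i => (V i).w z.1 z.2)
        (fun i => (U i).wt z.1 z.2) (fun i => (V i).wt z.1 z.2) +
      bellmanGrad q (fun i => (U i).w z.1 z.2) (fun i => (V i).w z.1 z.2)
        (fun i => (U i).wtt z.1 z.2) (fun i => (V i).wtt z.1 z.2) :=
    (measurable_bellmanQuad mU mV (fun i => (U i).meas_t) fun i => (V i).meas_t).add
      (measurable_bellmanGrad mU mV (fun i => (U i).meas_tt) fun i => (V i).meas_tt)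
  have htime := integral_mul_deriv_two hd hα hqp hb
    (poissonBound_bellmanGrad hq hq2 hε bU bV hU hV (fun i => (U i).bound_t)
      fun i => (V i).bound_t) hbtt mtt
    (fun t x => hasDerivAt_bellman_curve hq (fun i => (U i).deriv_t t x)
      (fun i => (V i).deriv_t t x) (hU0 t x) (hV0 t x))
    (fun t x => hasDerivAt_bellmanGrad_curve hq (U' := fun i s => (U i).wt s x)
      (V' := fun i s => (V i).wt s x) (fun i => (U i).deriv_t t x)
      (fun i => (V i).deriv_t t x) (fun i => (U i).deriv_tt t x)
      (fun i => (V i).deriv_tt t x) (hU0 t x) (hV0 t x))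
  have hitt := hbtt.integrable hd hα hqp mtt
  -- The divergences in the space variables.
  have hspace := fun j => integral_mul_divergence_eq_zero hd hα hqp j
    (b' := fun t x => bellmanGrad q (fun i => (U i).w t x) (fun i => (V i).w t x)
        (fun i => (U i).wx j t x) (fun i => (V i).wx j t x))
    (b'' := fun t x => bellmanQuad q (fun i => (U i).w t x) (fun i => (V i).w t x)
        (fun i => (U i).wx j t x) (fun i => (V i).wx j t x) +
      bellmanGrad q (fun i => (U i).w t x) (fun i => (V i).w t x)
        (fun i => (U i).wxx j t x) (fun i => (V i).wxx j t x))
    (by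
      simp only [div_eq_mul_inv]
      exact poissonBound_bellmanGrad_aux (c := fun x => (x j)⁻¹) hq hq2 hε bU bV hU hV
        (poissonBound_parity U j) (poissonBound_parity V j))
    ((poissonBound_bellmanQuad hq hq2 hε bU bV hU hV (fun i => (U i).bound_x j)
      (fun i => (V i).bound_x j)).add (poissonBound_bellmanGrad hq hq2 hε bU bV hU hV
      (fun i => (U i).bound_xx j) (fun i => (V i).bound_xx j)))
    (measurable_bellmanGrad mU mV (fun i => (U i).meas_x j) fun i => (V i).meas_x j)
    ((measurable_bellmanQuad mU mV (fun i => (U i).meas_x j) fun i => (V i).meas_x j).add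
      (measurable_bellmanGrad mU mV (fun i => (U i).meas_xx j) fun i => (V i).meas_xx j))
    (fun t x => by
      have hx : Function.update x j (x j) = x := Function.update_eq_self j x
      have h := hasDerivAt_bellmanGrad_curve (q := q) hq
        (U := fun i s => (U i).w t (Function.update x j s))
        (V := fun i s => (V i).w t (Function.update x j s))
        (U' := fun i s => (U i).wx j t (Function.update x j s))
        (V' := fun i s => (V i).wx j t (Function.update x j s)) (x := x j)
        (fun i => by simpa only [hx] using (U i).deriv_x j t x)
        (fun i => by simpa only [hx] using (V i).deriv_x j t x)
        (fun i => (U i).deriv_xx j t x) (fun i => (V i).deriv_xx j t x)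
        (hU0 _ _) (hV0 _ _)
      simpa only [hx] using h)
  have hsum : (fun z : ℝ × (Fin d → ℝ) => z.1 * bellmanLap q U V z.1 z.2) = fun z =>
      z.1 * (bellmanQuad q (fun i => (U i).w z.1 z.2) (fun i => (V i).w z.1 z.2)
        (fun i => (U i).wt z.1 z.2) (fun i => (V i).wt z.1 z.2) +
      bellmanGrad q (fun i => (U i).w z.1 z.2) (fun i => (V i).w z.1 z.2)
        (fun i => (U i).wtt z.1 z.2) (fun i => (V i).wtt z.1 z.2)) +
      ∑ j, z.1 * (bellmanQuad q (fun i => (U i).w z.1 z.2) (fun i => (V i).w z.1 z.2)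
        (fun i => (U i).wx j z.1 z.2) (fun i => (V i).wx j z.1 z.2) +
      bellmanGrad q (fun i => (U i).w z.1 z.2) (fun i => (V i).w z.1 z.2)
        (fun i => (U i).wxx j z.1 z.2) (fun i => (V i).wxx j z.1 z.2) +
      (2 * α j + 1) / z.2 j * bellmanGrad q (fun i => (U i).w z.1 z.2) (fun i => (V i).w z.1 z.2)
        (fun i => (U i).wx j z.1 z.2) (fun i => (V i).wx j z.1 z.2)) := by
    funext z
    rw [bellmanLap, mul_add, Finset.mul_sum]
  have hint : Integrable (fun z : ℝ × (Fin d → ℝ) => z.1 * bellmanLap q U V z.1 z.2) m := by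
    rw [hsum]
    exact hitt.add (integrable_finsetSum _ fun j _ => (hspace j).1)
  have hval : ∫ z, z.1 * bellmanLap q U V z.1 z.2 ∂m =
      ∫ x, bellman q ((fun i => (U i).w 0 x) ⬝ᵥ fun i => (U i).w 0 x)
        ((fun i => (V i).w 0 x) ⬝ᵥ fun i => (V i).w 0 x) ∂laguerreMeasure α := by
    rw [hsum, integral_add hitt (integrable_finsetSum _ fun j _ => (hspace j).1),
      integral_finsetSum _ fun j _ => (hspace j).1, htime]
    simp only [fun j => (hspace j).2]
    simp
  have hle : (q - 1) / 3 * |∫ z, z.1 * Ψ z.1 z.2 ∂m| ≤ ∫ z, z.1 * bellmanLap q U V z.1 z.2 ∂m := by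
    calc (q - 1) / 3 * |∫ z, z.1 * Ψ z.1 z.2 ∂m|
        ≤ (q - 1) / 3 * ∫ z, |z.1 * Ψ z.1 z.2| ∂m := by
          gcongr; exact abs_integral_le_integral_abs
      _ = ∫ z, (q - 1) / 3 * |z.1 * Ψ z.1 z.2| ∂m := (integral_const_mul _ _).symm
      _ ≤ _ := by
          refine integral_mono_ae (hΨi.abs.const_mul _) hint ?_
          filter_upwards [ae_prod_pos α] with z hz
          rw [abs_mul, abs_of_pos hz.1, mul_left_comm]
          exact mul_le_mul_of_nonneg_left (bellmanLap_lower hα hq hq2 U V hz.2 (hU0 _ _) (hV0 _ _)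
            (hΨ _ _)) hz.1.le
  refine hle.trans ?_
  rw [hval, ← integral_const_mul]
  have hm0 : Measurable fun x : Fin d → ℝ => ((0 : ℝ), x) := measurable_prodMk_left
  refine integral_mono_ae ((hb.gaussBound le_rfl).integrable hα (by positivity) ?_)
    ((((poissonBound_bellmanN hq hq2 bU bV).const_mul (9 / 8)).gaussBound le_rfl).integrable hα
      (by positivity) ?_) (ae_of_all _ fun x => bellman_le hq hq2 (hU0 _ _) (hV0 _ _))
  · exact ((measurable_bellman (measurable_dotProduct mU mU)
      (measurable_dotProduct mV mV)).comp hm0).aestronglyMeasurable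
  · exact (((measurable_bellmanN (measurable_dotProduct mU mU)
      (measurable_dotProduct mV mV)).comp hm0).const_mul _).aestronglyMeasurable

end Embedding

/-! ### The pairing of the Riesz transforms with finite sums -/

theorem tensorFun_ground (α : Fin d → ℝ) (hα : ∀ i, -(1 / 2 : ℝ) ≤ α i) :
    ∃ C : ℝ, 0 < C ∧ ∀ x, tensorFun α none 0 x = C * Real.exp (-(1 / 2) * ∑ i, x i ^ 2) := by
  have hG : ∀ i, 0 < Real.Gamma (α i + 1) := fun i =>
    Real.Gamma_pos_of_pos (by linarith [hα i])
  refine ⟨∏ i, Real.sqrt (2 / Real.Gamma (α i + 1)),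
    Finset.prod_pos fun i _ => Real.sqrt_pos.2 (div_pos two_pos (hG i)), fun x => ?_⟩
  have h : ∀ i, tensorFactor α none 0 i (x i) =
      Real.sqrt (2 / Real.Gamma (α i + 1)) * Real.exp (-(1 / 2) * x i ^ 2) := by
    intro i
    have h2 : laguerrePoly (α i) 0 (x i ^ 2) = 1 := by simp [laguerrePoly, (hG i).ne']
    have h3 : -x i ^ 2 / 2 = -(1 / 2) * x i ^ 2 := by ring
    simp [tensorFactor, laguerreFun, h2, h3]
  rw [tensorFun]
  simp only [h]
  rw [Finset.prod_mul_distrib, ← Real.exp_sum, Finset.mul_sum]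

/-- The multiples of the ground state are Poisson extensions, since `ℓ_0` is a multiple of the
Gaussian. -/
theorem exists_ground_ext {α : Fin d → ℝ} (hα : ∀ i, -(1 / 2 : ℝ) ≤ α i) (ε : ℝ) :
    ∃ F : PoissonExt α none, ∀ t x, F.w t x = ε * groundState α t x := by
  obtain ⟨C, hC, h⟩ := tensorFun_ground α hα
  obtain ⟨F, hF, -⟩ := exists_poissonExt hα none 0
  refine ⟨PoissonExt.lin {()} (fun _ => ε * C⁻¹) fun _ => F, fun t x => ?_⟩
  simp only [PoissonExt.lin, Finset.sum_singleton, hF, h, groundState, groundRate]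
  field_simp

/-- A family of extensions with the ground state adjoined as a further component. -/
def withGround {α : Fin d → ℝ} {K : Type*} {o : K → Option (Fin d)} (G : PoissonExt α none)
    (F : ∀ i, PoissonExt α (o i)) : ∀ i : Option K, PoissonExt α (i.elim none o)
  | none => G
  | some i => F i

section WithGround

variable {α : Fin d → ℝ} {K : Type*} [Fintype K] {o : K → Option (Fin d)} {G : PoissonExt α none}
  {ε : ℝ} {F : ∀ i, PoissonExt α (o i)}

theorem withGround_dotProduct (hG : ∀ t x, G.w t x = ε * groundState α t x) (t : ℝ)
    (x : Fin d → ℝ) : ((fun i => (withGround G F i).w t x) ⬝ᵥ fun i => (withGround G F i).w t x) =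
      (ε * groundState α t x) ^ 2 + ∑ i, (F i).w t x ^ 2 := by
  rw [dotProduct, Fintype.sum_option]
  simp only [withGround, hG, sq]

theorem nondegenerate_withGround (hG : ∀ t x, G.w t x = ε * groundState α t x) :
    Nondegenerate ε (withGround G F) := fun t x => by
  rw [withGround_dotProduct hG]
  exact le_add_of_nonneg_right (Finset.sum_nonneg fun _ _ => sq_nonneg _)

/-- The ground state component only increases the energy. -/
theorem le_poissonEnergy_withGround (t : ℝ) (x : Fin d → ℝ) :
    (∑ i, (F i).wt t x ^ 2) + ∑ j, ∑ i, ((F i).wx j t x ^ 2 + (x j * (F i).w t x) ^ 2) ≤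
      poissonEnergy (withGround G F) t x := by
  have h : ∀ a : ℝ, ∀ f : K → ℝ, ∑ i, f i ^ 2 ≤ a * a + ∑ i, f i * f i := fun a f => by
    simp only [sq]; linarith [mul_self_nonneg a]
  have h1 := h (G.wt t x) fun i => (F i).wt t x
  have h2 : ∑ j, ∑ i, (F i).wx j t x ^ 2 ≤
      ∑ j, (G.wx j t x * G.wx j t x + ∑ i, (F i).wx j t x * (F i).wx j t x) :=
    Finset.sum_le_sum fun j _ => h (G.wx j t x) fun i => (F i).wx j t x
  have h3 : ∑ j, ∑ i, (x j * (F i).w t x) ^ 2 ≤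
      (∑ j, x j ^ 2) * (G.w t x * G.w t x + ∑ i, (F i).w t x * (F i).w t x) := by
    rw [Finset.sum_mul]
    refine Finset.sum_le_sum fun j _ => ?_
    simp only [mul_pow]
    rw [← Finset.mul_sum]
    exact mul_le_mul_of_nonneg_left (h _ _) (sq_nonneg _)
  simp only [poissonEnergy, dotProduct, Fintype.sum_option, withGround]
  simp only [Finset.sum_add_distrib] at h2 ⊢
  linarith

end WithGround

/-- The finite sum `∑ k, c k • ℓ_k^α` (for `o = none`) or `∑ k, c k • δ_i ℓ_k^α`
(for `o = some i`). -/
def tensorSum (α : Fin d → ℝ) (o : Option (Fin d)) :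
    ((Fin d → ℕ) →₀ ℝ) →ₗ[ℝ] ((Fin d → ℝ) → ℝ) :=
  Finsupp.linearCombination ℝ (tensorFun α o)

theorem tensorSum_apply (α : Fin d → ℝ) (o : Option (Fin d)) (c : (Fin d → ℕ) →₀ ℝ)
    (x : Fin d → ℝ) : tensorSum α o c x = ∑ k ∈ c.support, c k * tensorFun α o k x := by
  simp [tensorSum, Finsupp.linearCombination_apply, Finsupp.sum, Finset.sum_apply]

/-- The bilinear form `∑ i, ⟨R_i f, g_i⟩` for `f = ∑ k, c k • ℓ_k` and `g_i = ∑ k, e i k • δ_i ℓ_k`,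
in terms of the coefficients. -/
def rieszForm (α : Fin d → ℝ) (c : (Fin d → ℕ) →₀ ℝ) (e : Fin d → (Fin d → ℕ) →₀ ℝ) : ℝ :=
  ∑ i, ∑ k ∈ c.support, laguerreEigenvalue α k ^ (-(1 / 2) : ℝ) * c k * e i k * (4 * k i)

theorem laguerreEigenvalue_pos (hd : 0 < d) {α : Fin d → ℝ} (hα : ∀ i, -(1 / 2 : ℝ) ≤ α i)
    (k : Fin d → ℕ) : 0 < laguerreEigenvalue α k := by
  refine Finset.sum_pos (fun i _ => ?_) ⟨⟨0, hd⟩, Finset.mem_univ _⟩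
  have := hα i
  have : (0 : ℝ) ≤ k i := Nat.cast_nonneg _
  linarith

theorem integral_mul_exp_neg {ρ : ℝ} (hρ : 0 < ρ) :
    ∫ t in Set.Ioi (0 : ℝ), t * Real.exp (-(t * ρ)) = 1 / ρ ^ 2 := by
  have h := Real.integral_rpow_mul_exp_neg_mul_Ioi (a := 2) two_pos hρ
  have h1 : (2 : ℝ) - 1 = 1 := by norm_num
  simp only [h1, Real.rpow_one, Real.Gamma_two, mul_one, Real.rpow_two] at h
  rw [one_div_pow] at h
  rw [← h]
  simp only [mul_comm ρ]

theorem integrable_mul_exp_neg {ρ : ℝ} (hρ : 0 < ρ) :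
    Integrable (fun t : ℝ => t * Real.exp (-(t * ρ))) (volume.restrict (Set.Ioi (0 : ℝ))) := by
  have := integrableOn_rpow_mul_exp_neg_mul_rpow (p := 1) (s := 1) (b := ρ)
    (by norm_num) one_pos hρ
  simpa [IntegrableOn, mul_comm ρ] using this

/-- `∑ i, δ_i u * ∂_t v_i` for the Poisson extensions `u` and `v_i` of `f = ∑ k, c k • ℓ_k` and
`g_i = ∑ k, e i k • δ_i ℓ_k`. -/
def pairingDensity (α : Fin d → ℝ) (c : (Fin d → ℕ) →₀ ℝ) (e : Fin d → (Fin d → ℕ) →₀ ℝ) (t : ℝ)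
    (x : Fin d → ℝ) : ℝ :=
  ∑ i, (∑ k ∈ c.support, c k * (Real.exp (-(t * Real.sqrt (laguerreEigenvalue α k))) *
      tensorFun α (some i) k x)) *
    ∑ l ∈ (e i).support, e i l * (-Real.sqrt (laguerreEigenvalue α l) *
      (Real.exp (-(t * Real.sqrt (laguerreEigenvalue α l))) * tensorFun α (some i) l x))

/-- `∑ i, ⟨R_i f, g_i⟩ = -4 ∑ i, ∫∫ t δ_i u ∂_t v_i`, where `u` and `v_i` are the Poisson
extensions of `f` and `g_i`. By orthogonality only `k = l` contributes, and `∫ t e^{-2 t √λ} dt = 1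
/ (4 λ)`. -/
theorem integral_pairing (hd : 0 < d) {α : Fin d → ℝ} (hα : ∀ i, -(1 / 2 : ℝ) ≤ α i)
    (c : (Fin d → ℕ) →₀ ℝ) (e : Fin d → (Fin d → ℕ) →₀ ℝ) :
    Integrable (fun z : ℝ × (Fin d → ℝ) => z.1 * pairingDensity α c e z.1 z.2)
      ((volume.restrict (Set.Ioi (0 : ℝ))).prod (laguerreMeasure α)) ∧
    ∫ z, z.1 * pairingDensity α c e z.1 z.2
      ∂((volume.restrict (Set.Ioi (0 : ℝ))).prod (laguerreMeasure α)) =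
      -(1 / 4) * rieszForm α c e := by
  set ρ : (Fin d → ℕ) → ℝ := fun k => Real.sqrt (laguerreEigenvalue α k) with hρ
  have hρ0 : ∀ k, 0 < ρ k := fun k => Real.sqrt_pos.2 (laguerreEigenvalue_pos hd hα k)
  have hΨ : (fun z : ℝ × (Fin d → ℝ) => z.1 * pairingDensity α c e z.1 z.2) =
      fun z => ∑ i, ∑ k ∈ c.support, ∑ l ∈ (e i).support,
        (c k * e i l * -ρ l) * ((z.1 * Real.exp (-(z.1 * (ρ k + ρ l)))) *
          (tensorFun α (some i) k z.2 * tensorFun α (some i) l z.2)) := by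
    funext z
    simp only [pairingDensity]
    rw [Finset.mul_sum]
    refine Finset.sum_congr rfl fun i _ => ?_
    rw [Finset.sum_mul_sum, Finset.mul_sum]
    refine Finset.sum_congr rfl fun k _ => ?_
    rw [Finset.mul_sum]
    refine Finset.sum_congr rfl fun l _ => ?_
    rw [mul_add, neg_add, Real.exp_add]
    ring
  have hterm : ∀ i k l, Integrable (fun z : ℝ × (Fin d → ℝ) => (c k * e i l * -ρ l) *
      ((z.1 * Real.exp (-(z.1 * (ρ k + ρ l)))) *
        (tensorFun α (some i) k z.2 * tensorFun α (some i) l z.2)))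
      ((volume.restrict (Set.Ioi (0 : ℝ))).prod (laguerreMeasure α)) := fun i k l =>
    ((integrable_mul_exp_neg (add_pos (hρ0 k) (hρ0 l))).mul_prod
      (integrable_tensorFun_mul hα (some i) (some i) k l)).const_mul _
  have hl : ∀ i k, Integrable (fun z : ℝ × (Fin d → ℝ) => ∑ l ∈ (e i).support,
      (c k * e i l * -ρ l) * ((z.1 * Real.exp (-(z.1 * (ρ k + ρ l)))) *
        (tensorFun α (some i) k z.2 * tensorFun α (some i) l z.2)))
      ((volume.restrict (Set.Ioi (0 : ℝ))).prod (laguerreMeasure α)) := fun i k =>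
    integrable_finsetSum _ fun l _ => hterm i k l
  have hk : ∀ i, Integrable (fun z : ℝ × (Fin d → ℝ) => ∑ k ∈ c.support, ∑ l ∈ (e i).support,
      (c k * e i l * -ρ l) * ((z.1 * Real.exp (-(z.1 * (ρ k + ρ l)))) *
        (tensorFun α (some i) k z.2 * tensorFun α (some i) l z.2)))
      ((volume.restrict (Set.Ioi (0 : ℝ))).prod (laguerreMeasure α)) := fun i =>
    integrable_finsetSum _ fun k _ => hl i k
  rw [hΨ]
  refine ⟨integrable_finsetSum _ fun i _ => hk i, ?_⟩
  rw [integral_finsetSum _ fun i _ => hk i, rieszForm, Finset.mul_sum]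
  refine Finset.sum_congr rfl fun i _ => ?_
  rw [integral_finsetSum _ fun k _ => hl i k, Finset.mul_sum]
  refine Finset.sum_congr rfl fun k _ => ?_
  rw [integral_finsetSum _ fun l _ => hterm i k l]
  have hval : ∀ l, ∫ z : ℝ × (Fin d → ℝ), (c k * e i l * -ρ l) *
      ((z.1 * Real.exp (-(z.1 * (ρ k + ρ l)))) *
        (tensorFun α (some i) k z.2 * tensorFun α (some i) l z.2))
      ∂((volume.restrict (Set.Ioi (0 : ℝ))).prod (laguerreMeasure α)) =
      if k = l then (c k * e i k * -ρ k) * (1 / (ρ k + ρ k) ^ 2 * (4 * k i)) else 0 := by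
    intro l
    rw [integral_const_mul, integral_prod_mul (fun t : ℝ => t * Real.exp (-(t * (ρ k + ρ l))))
      (fun x => tensorFun α (some i) k x * tensorFun α (some i) l x),
      integral_mul_exp_neg (add_pos (hρ0 k) (hρ0 l)), integral_tensorFun_mul hα]
    split_ifs with h
    · subst h; rfl
    · simp
  simp only [hval]
  rw [Finset.sum_ite_eq]
  have hpow : laguerreEigenvalue α k ^ (-(1 / 2) : ℝ) = (ρ k)⁻¹ := by
    change _ = (Real.sqrt (laguerreEigenvalue α k))⁻¹
    rw [Real.rpow_neg (laguerreEigenvalue_pos hd hα k).le, Real.sqrt_eq_rpow]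
  rw [hpow]
  have h0 := (hρ0 k).ne'
  split_ifs with h
  · field_simp
    ring
  · rw [Finsupp.notMem_support_iff.1 h]; ring

/-! ### The bilinear estimate on finite sums -/

/-- The first-order relation `δ_i ℓ_k = tensorFun α (some i) k`, for the Poisson extension. -/
theorem PoissonExt.wx_add_mul {α : Fin d → ℝ} {k : Fin d → ℕ} {ρ : ℝ} {F : PoissonExt α none}
    (hF : ∀ t x, F.w t x = Real.exp (-(t * ρ)) * tensorFun α none k x) (i : Fin d) (t : ℝ)
    (x : Fin d → ℝ) :
    F.wx i t x + x i * F.w t x = Real.exp (-(t * ρ)) * tensorFun α (some i) k x := by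
  have h := (F.deriv_x i t x).deriv
  simp only [hF, deriv_const_mul_field] at h
  rw [← h, hF, ← laguerreDelta_tensor, laguerreDelta, tensorFun_none]
  ring

/-- Cauchy–Schwarz for `∑ i, δ_i u * ∂_t v_i`; the factor `2` comes from splitting `δ_i = ∂_i + x_i`
into the two parts that the energy contains. -/
theorem sq_sum_mul_le_energy {a b c : Fin d → ℝ} {A B : ℝ}
    (ha : ∑ i, (b i ^ 2 + c i ^ 2) ≤ A) (hb : ∑ i, a i ^ 2 ≤ B) :
    (∑ i, (b i + c i) * a i) ^ 2 ≤ 2 * (A * B) := by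
  have h1 : (∑ i, (b i + c i) * a i) ^ 2 ≤ (∑ i, (b i + c i) ^ 2) * ∑ i, a i ^ 2 :=
    Finset.sum_mul_sq_le_sq_mul_sq _ _ _
  have h2 : ∑ i, (b i + c i) ^ 2 ≤ 2 * A := by
    calc ∑ i, (b i + c i) ^ 2 ≤ ∑ i, 2 * (b i ^ 2 + c i ^ 2) :=
          Finset.sum_le_sum fun i _ => by nlinarith [sq_nonneg (b i - c i)]
      _ ≤ 2 * A := by rw [← Finset.mul_sum]; linarith
  have h3 : 0 ≤ ∑ i, a i ^ 2 := Finset.sum_nonneg fun i _ => sq_nonneg _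
  have h4 : 0 ≤ ∑ i, (b i + c i) ^ 2 := Finset.sum_nonneg fun i _ => sq_nonneg _
  calc _ ≤ _ := h1
    _ ≤ 2 * A * B := mul_le_mul h2 hb h3 (h4.trans h2)
    _ = _ := by ring

/-- The squared length of a family of finite sums, plus the square of `ε` times the ground state. -/
def regSq (α : Fin d → ℝ) {K : Type*} [Fintype K] (o : K → Option (Fin d))
    (c : K → (Fin d → ℕ) →₀ ℝ) (ε : ℝ) (x : Fin d → ℝ) : ℝ :=
  (ε * groundState α 0 x) ^ 2 + ∑ i, tensorSum α (o i) (c i) x ^ 2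

/-- The data for the bilinear embedding: the Poisson extensions of `f` and of the `g_i`, each with
`ε` times the ground state adjoined, and the density `Ψ` of their pairing. -/
theorem exists_family (hd : 0 < d) {α : Fin d → ℝ} (hα : ∀ i, -(1 / 2 : ℝ) ≤ α i)
    (c : (Fin d → ℕ) →₀ ℝ) (e : Fin d → (Fin d → ℕ) →₀ ℝ) {ε : ℝ} :
    ∃ (U : ∀ i : Option Unit, PoissonExt α (i.elim none fun _ => none))
      (V : ∀ i : Option (Fin d), PoissonExt α (i.elim none some)) (Ψ : ℝ → (Fin d → ℝ) → ℝ),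
      Nondegenerate ε U ∧ Nondegenerate ε V ∧
      Integrable (fun z : ℝ × (Fin d → ℝ) => z.1 * Ψ z.1 z.2)
        ((volume.restrict (Set.Ioi (0 : ℝ))).prod (laguerreMeasure α)) ∧
      ∫ z, z.1 * Ψ z.1 z.2 ∂((volume.restrict (Set.Ioi (0 : ℝ))).prod (laguerreMeasure α)) =
        -(1 / 4) * rieszForm α c e ∧
      (∀ t x, Ψ t x ^ 2 ≤ 2 * (poissonEnergy U t x * poissonEnergy V t x)) ∧
      (∀ x, ((fun i => (U i).w 0 x) ⬝ᵥ fun i => (U i).w 0 x) =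
        regSq α (fun _ : Unit => none) (fun _ => c) ε x) ∧
      ∀ x, ((fun i => (V i).w 0 x) ⬝ᵥ fun i => (V i).w 0 x) = regSq α some e ε x := by
  obtain ⟨G, hG⟩ := exists_ground_ext hα ε
  choose F hF hFt using fun o k => exists_poissonExt hα o k
  set U := withGround G fun _ : Unit => PoissonExt.lin c.support c (F none) with hU
  set V := withGround G fun i : Fin d => PoissonExt.lin (e i).support (e i) (F (some i)) with hV
  obtain ⟨hi, hval⟩ := integral_pairing hd hα c e
  refine ⟨U, V, pairingDensity α c e, nondegenerate_withGround hG, nondegenerate_withGround hG, hi,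
    hval, ?_, ?_, ?_⟩
  · intro t x
    have hu := le_poissonEnergy_withGround (G := G)
      (F := fun _ : Unit => PoissonExt.lin c.support c (F none)) t x
    have hv := le_poissonEnergy_withGround (G := G)
      (F := fun i : Fin d => PoissonExt.lin (e i).support (e i) (F (some i))) t x
    set u := PoissonExt.lin c.support c (F none) with hu'
    set v := fun i : Fin d => PoissonExt.lin (e i).support (e i) (F (some i)) with hv'
    have key := sq_sum_mul_le_energy (a := fun i => (v i).wt t x) (b := fun i => u.wx i t x)
      (c := fun i => x i * u.w t x) (A := poissonEnergy U t x) (B := poissonEnergy V t x) ?_ ?_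
    · convert key using 2
      refine Finset.sum_congr rfl fun i _ => ?_
      congr 1
      · simp only [hu', PoissonExt.lin]
        rw [Finset.mul_sum, ← Finset.sum_add_distrib]
        refine Finset.sum_congr rfl fun k _ => ?_
        rw [← PoissonExt.wx_add_mul (hF none k)]
        ring
      · simp only [hv', PoissonExt.lin, hFt, hF]
    · refine le_trans ?_ hu
      simp only [Finset.univ_unique, Finset.sum_singleton]
      exact le_add_of_nonneg_left (sq_nonneg _)
    · refine le_trans ?_ hv
      exact le_add_of_nonneg_right (Finset.sum_nonneg fun _ _ => Finset.sum_nonneg fun _ _ =>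
        add_nonneg (sq_nonneg _) (sq_nonneg _))
  · intro x
    rw [hU, withGround_dotProduct hG]
    simp [regSq, PoissonExt.lin, hF, tensorSum_apply]
  · intro x
    rw [hV, withGround_dotProduct hG]
    simp [regSq, PoissonExt.lin, hF, tensorSum_apply]

section Regularization

variable {α : Fin d → ℝ} {K K' : Type*} [Fintype K] [Fintype K'] {o : K → Option (Fin d)}
  {o' : K' → Option (Fin d)} {c : K → (Fin d → ℕ) →₀ ℝ} {c' : K' → (Fin d → ℕ) →₀ ℝ}

theorem continuous_tensorSum (α : Fin d → ℝ) (o : Option (Fin d)) (c : (Fin d → ℕ) →₀ ℝ) :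
    Continuous (tensorSum α o c) := by
  have : tensorSum α o c = fun x => ∑ k ∈ c.support, c k * tensorFun α o k x :=
    funext fun x => tensorSum_apply α o c x
  rw [this]
  exact continuous_finsetSum _ fun k _ => (continuous_tensorFun α o k).const_mul _

theorem gaussBound_tensorSum (α : Fin d → ℝ) (o : Option (Fin d)) (c : (Fin d → ℕ) →₀ ℝ) :
    GaussBound (1 / 2) (tensorSum α o c) := by
  have : tensorSum α o c = fun x => ∑ k ∈ c.support, c k * tensorFun α o k x :=
    funext fun x => tensorSum_apply α o c x
  rw [this]
  exact GaussBound.sum _ fun k _ => (gaussBound_tensorFun α o k).const_mul _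

theorem continuous_groundState (α : Fin d → ℝ) (t : ℝ) : Continuous (groundState α t) := by
  unfold groundState; fun_prop

theorem gaussBound_groundState (α : Fin d → ℝ) : GaussBound (1 / 2) (groundState α 0) :=
  ⟨0, le_rfl, fun x _ => by simp [groundState]⟩

theorem continuous_regSq (ε : ℝ) : Continuous (regSq α o c ε) := by
  have h := continuous_groundState α 0
  have h' := fun i => continuous_tensorSum α (o i) (c i)
  unfold regSq
  fun_prop

theorem regSq_nonneg (ε : ℝ) (x : Fin d → ℝ) : 0 ≤ regSq α o c ε x :=
  add_nonneg (sq_nonneg _) (Finset.sum_nonneg fun _ _ => sq_nonneg _)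

theorem gaussBound_regSq (ε : ℝ) : GaussBound 1 (regSq α o c ε) := by
  have h1 : (1 : ℝ) = 1 / 2 + 1 / 2 := by norm_num
  unfold regSq
  simp only [sq]
  rw [h1]
  exact (((gaussBound_groundState α).const_mul ε).mul ((gaussBound_groundState α).const_mul ε)).add
    (GaussBound.sum _ fun i _ => (gaussBound_tensorSum α _ _).mul (gaussBound_tensorSum α _ _))

theorem integrable_regSq_rpow (hα : ∀ i, -(1 / 2 : ℝ) ≤ α i) (ε : ℝ) {r : ℝ} (hr : 0 < r) :
    Integrable (fun x => regSq α o c ε x ^ r) (laguerreMeasure α) := by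
  have h := (gaussBound_regSq (α := α) (o := o) (c := c) ε).rpow hr.le
  simp only [abs_of_nonneg (regSq_nonneg _ _)] at h
  exact h.integrable hα (by linarith)
    ((continuous_regSq ε).rpow_const fun _ => Or.inr hr.le).aestronglyMeasurable

theorem integral_bellmanN_regSq (hα : ∀ i, -(1 / 2 : ℝ) ≤ α i) (ε : ℝ) {q : ℝ} (hq : 1 < q) :
    ∫ x, bellmanN q (regSq α o c ε x) (regSq α o' c' ε x) ∂laguerreMeasure α =
      (∫ x, regSq α o c ε x ^ (q / (q - 1) / 2) ∂laguerreMeasure α) +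
        ∫ x, regSq α o' c' ε x ^ (q / 2) ∂laguerreMeasure α := by
  have : 0 < q - 1 := by linarith
  exact integral_add (integrable_regSq_rpow hα ε (by positivity))
    (integrable_regSq_rpow hα ε (by positivity))

theorem tendsto_integral_regSq (hα : ∀ i, -(1 / 2 : ℝ) ≤ α i) {r : ℝ} (hr : 0 < r) :
    Tendsto (fun ε => ∫ x, regSq α o c ε x ^ r ∂laguerreMeasure α) (𝓝[>] 0)
      (𝓝 (∫ x, regSq α o c 0 x ^ r ∂laguerreMeasure α)) := by
  refine tendsto_integral_filter_of_dominated_convergence (fun x => regSq α o c 1 x ^ r)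
    (Eventually.of_forall fun ε => (integrable_regSq_rpow hα ε hr).aestronglyMeasurable) ?_
    (integrable_regSq_rpow hα 1 hr) (ae_of_all _ fun x => ?_)
  · filter_upwards [Ioc_mem_nhdsGT one_pos] with ε hε
    refine ae_of_all _ fun x => ?_
    rw [Real.norm_of_nonneg (Real.rpow_nonneg (regSq_nonneg _ _) _)]
    refine Real.rpow_le_rpow (regSq_nonneg _ _) ?_ hr.le
    have h0 := groundState_pos α 0 x
    have h2 := mul_pos hε.1 h0
    unfold regSq
    gcongr
    exact hε.2
  · have : Continuous fun ε => regSq α o c ε x ^ r := by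
      refine Continuous.rpow_const ?_ fun _ => Or.inr hr.le
      unfold regSq
      fun_prop
    exact this.continuousAt.mono_left nhdsWithin_le_nhds

end Regularization

/-- The bilinear embedding in the limit `ε → 0`. The Bellman function is the one for the smaller of
the two exponents, hence `f` and `g` change roles when `p < 2`. -/
theorem abs_rieszForm_le_add (hd : 0 < d) {α : Fin d → ℝ} (hα : ∀ i, -(1 / 2 : ℝ) ≤ α i)
    {p q : ℝ} (hpq : p.HolderConjugate q) (c : (Fin d → ℕ) →₀ ℝ) (e : Fin d → (Fin d → ℕ) →₀ ℝ) :
    |rieszForm α c e| ≤ 27 / 2 * (max p q - 1) *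
      ((∫ x, (tensorSum α none c x ^ 2) ^ (p / 2) ∂laguerreMeasure α) +
        ∫ x, (∑ i, tensorSum α (some i) (e i) x ^ 2) ^ (q / 2) ∂laguerreMeasure α) := by
  have hp := hpq.lt
  have hq := hpq.symm.lt
  have hp0 : 0 < p - 1 := by linarith
  have hq0 : 0 < q - 1 := by linarith
  have hpe := hpq.conjugate_eq
  have hqe := hpq.symm.conjugate_eq
  have hA := tendsto_integral_regSq (α := α) (o := fun _ : Unit => none) (c := fun _ => c) hα
    (r := p / 2) (by linarith)
  have hB := tendsto_integral_regSq (α := α) (o := some) (c := e) hα (r := q / 2) (by linarith)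
  have h0 : ∀ x, regSq α (fun _ : Unit => none) (fun _ => c) 0 x = tensorSum α none c x ^ 2 :=
    fun x => by simp [regSq]
  have h0' : ∀ x, regSq α some e 0 x = ∑ i, tensorSum α (some i) (e i) x ^ 2 :=
    fun x => by simp [regSq]
  simp only [h0, h0'] at hA hB
  refine ge_of_tendsto ((hA.add hB).const_mul (27 / 2 * (max p q - 1))) ?_
  filter_upwards [self_mem_nhdsWithin] with ε hε
  obtain ⟨U, V, Ψ, hU, hV, hi, hval, hΨ, hUw, hVw⟩ := exists_family (ε := ε) hd hα c e
  -- For `q ≤ 2` the constant `1 / (q - 1)` of the embedding is `p - 1`.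
  have hprod : (p - 1) * (q - 1) = 1 := by
    rw [hqe]; field_simp; ring
  rcases le_total q 2 with h2 | h2
  · have hm : max p q = p := max_eq_left (by nlinarith)
    have := bilinear_embedding hd hα hq h2 hε U V hU hV hi hΨ
    simp only [hUw, hVw] at this
    rw [integral_bellmanN_regSq hα ε hq, hval, abs_mul, ← hqe] at this
    have h := mul_le_mul_of_nonneg_left this hp0.le
    rw [hm]
    rw [abs_neg, abs_of_pos (by norm_num : (0 : ℝ) < 1 / 4)] at h
    have h' : (p - 1) * ((q - 1) / 3 * (1 / 4 * |rieszForm α c e|)) =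
        (p - 1) * (q - 1) * (|rieszForm α c e| / 12) := by ring
    rw [h', hprod] at h
    linarith
  · have hm : max p q = q := max_eq_right (by nlinarith)
    have hp2 : p ≤ 2 := by nlinarith
    have := bilinear_embedding hd hα hp hp2 hε V U hV hU hi fun t x => by
      rw [mul_comm (poissonEnergy V t x)]; exact hΨ t x
    simp only [hUw, hVw] at this
    rw [integral_bellmanN_regSq hα ε hp, hval, abs_mul, ← hpe] at this
    have h := mul_le_mul_of_nonneg_left this hq0.le
    rw [hm]
    rw [abs_neg, abs_of_pos (by norm_num : (0 : ℝ) < 1 / 4)] at h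
    have h' : (q - 1) * ((p - 1) / 3 * (1 / 4 * |rieszForm α c e|)) =
        (p - 1) * (q - 1) * (|rieszForm α c e| / 12) := by ring
    rw [h', hprod] at h
    linarith

/-- The bilinear form is bounded by the product of the norms. The pairs with `‖f‖_p ≤ A`,
`‖g‖_q ≤ B` reduce to `A = B = 1` by scaling. -/
theorem abs_rieszForm_le (hd : 0 < d) {α : Fin d → ℝ} (hα : ∀ i, -(1 / 2 : ℝ) ≤ α i)
    {p q : ℝ} (hpq : p.HolderConjugate q) (c : (Fin d → ℕ) →₀ ℝ) (e : Fin d → (Fin d → ℕ) →₀ ℝ)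
    {A B : ℝ} (hA : 0 < A) (hB : 0 < B)
    (hcA : ∫ x, (tensorSum α none c x ^ 2) ^ (p / 2) ∂laguerreMeasure α ≤ A ^ p)
    (heB : ∫ x, (∑ i, tensorSum α (some i) (e i) x ^ 2) ^ (q / 2) ∂laguerreMeasure α ≤ B ^ q) :
    |rieszForm α c e| ≤ 27 * (max p q - 1) * A * B := by
  have hm : 0 < max p q - 1 := by linarith [hpq.lt, le_max_left p q]
  have h := abs_rieszForm_le_add hd hα hpq (A⁻¹ • c) fun i => B⁻¹ • e i
  have h1 : rieszForm α (A⁻¹ • c) (fun i => B⁻¹ • e i) = (A * B)⁻¹ * rieszForm α c e := by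
    rw [rieszForm, rieszForm, Finset.mul_sum]
    refine Finset.sum_congr rfl fun i _ => ?_
    rw [Finsupp.support_smul_eq (inv_pos.2 hA).ne', Finset.mul_sum]
    refine Finset.sum_congr rfl fun k _ => ?_
    simp only [Finsupp.smul_apply, smul_eq_mul]
    rw [mul_inv]
    ring
  have hs : ∀ {s r X : ℝ}, 0 < s → 0 ≤ X → ((s⁻¹) ^ 2 * X) ^ (r / 2) = (s ^ r)⁻¹ * X ^ (r / 2) := by
    intro s r X hs hX
    rw [Real.mul_rpow (by positivity) hX, ← Real.rpow_natCast, ← Real.rpow_mul (by positivity),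
      Real.inv_rpow hs.le]
    congr 3
    push_cast; ring
  have h2 : ∫ x, (tensorSum α none (A⁻¹ • c) x ^ 2) ^ (p / 2) ∂laguerreMeasure α ≤ 1 := by
    simp only [map_smul, Pi.smul_apply, smul_eq_mul, mul_pow]
    simp only [hs hA (sq_nonneg _)]
    rw [integral_const_mul, inv_mul_le_one₀ (Real.rpow_pos_of_pos hA p)]
    exact hcA
  have h3 : ∫ x, (∑ i, tensorSum α (some i) (B⁻¹ • e i) x ^ 2) ^ (q / 2) ∂laguerreMeasure α ≤ 1 := by
    simp only [map_smul, Pi.smul_apply, smul_eq_mul, mul_pow, ← Finset.mul_sum]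
    simp only [hs hB (Finset.sum_nonneg fun _ _ => sq_nonneg _)]
    rw [integral_const_mul, inv_mul_le_one₀ (Real.rpow_pos_of_pos hB q)]
    exact heB
  rw [h1, abs_mul, abs_of_pos (by positivity), inv_mul_le_iff₀ (by positivity)] at h
  refine h.trans ?_
  have h4 : 27 / 2 * (max p q - 1) * ((∫ x, (tensorSum α none (A⁻¹ • c) x ^ 2) ^ (p / 2)
      ∂laguerreMeasure α) + ∫ x, (∑ i, tensorSum α (some i) (B⁻¹ • e i) x ^ 2) ^ (q / 2)
      ∂laguerreMeasure α) ≤ 27 / 2 * (max p q - 1) * 2 := by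
    gcongr; linarith
  calc _ ≤ A * B * (27 / 2 * (max p q - 1) * 2) :=
        mul_le_mul_of_nonneg_left h4 (by positivity)
    _ = _ := by ring

/-- `R_i f = ∑ k, λ_k^{-1/2} c k • δ_i ℓ_k` for `f = ∑ k, c k • ℓ_k`. -/
def rieszSum (α : Fin d → ℝ) (i : Fin d) : ((Fin d → ℕ) →₀ ℝ) →ₗ[ℝ] ((Fin d → ℝ) → ℝ) :=
  Finsupp.linearCombination ℝ fun k => laguerreEigenvalue α k ^ (-(1 / 2) : ℝ) •
    tensorFun α (some i) k

theorem rieszSum_apply (α : Fin d → ℝ) (i : Fin d) (c : (Fin d → ℕ) →₀ ℝ) (x : Fin d → ℝ) :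
    rieszSum α i c x = ∑ k ∈ c.support, laguerreEigenvalue α k ^ (-(1 / 2) : ℝ) * c k *
      tensorFun α (some i) k x := by
  simp [rieszSum, Finsupp.linearCombination_apply, Finsupp.sum, Finset.sum_apply, mul_left_comm,
    mul_assoc]

theorem exists_tensorSum_eq_rieszSum (α : Fin d → ℝ) (i : Fin d) (c : (Fin d → ℕ) →₀ ℝ) :
    ∃ c', rieszSum α i c = tensorSum α (some i) c' := by
  refine ⟨∑ k ∈ c.support, Finsupp.single k (laguerreEigenvalue α k ^ (-(1 / 2) : ℝ) * c k), ?_⟩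
  funext x
  rw [rieszSum_apply, map_sum, Finset.sum_apply]
  simp only [tensorSum, Finsupp.linearCombination_single, Pi.smul_apply, smul_eq_mul]

theorem integral_rieszSum_mul {α : Fin d → ℝ} (hα : ∀ i, -(1 / 2 : ℝ) ≤ α i) (i : Fin d)
    (c e : (Fin d → ℕ) →₀ ℝ) :
    ∫ x, rieszSum α i c x * tensorSum α (some i) e x ∂laguerreMeasure α =
      ∑ k ∈ c.support, laguerreEigenvalue α k ^ (-(1 / 2) : ℝ) * c k * e k * (4 * k i) := by
  have h : ∀ x, rieszSum α i c x * tensorSum α (some i) e x = ∑ k ∈ c.support, ∑ l ∈ e.support,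
      laguerreEigenvalue α k ^ (-(1 / 2) : ℝ) * c k * e l *
        (tensorFun α (some i) k x * tensorFun α (some i) l x) := by
    intro x
    rw [rieszSum_apply, tensorSum_apply, Finset.sum_mul_sum]
    refine Finset.sum_congr rfl fun k _ => Finset.sum_congr rfl fun l _ => ?_
    ring
  have hi := fun k l => (integrable_tensorFun_mul hα (some i) (some i) k l).const_mul
    (laguerreEigenvalue α k ^ (-(1 / 2) : ℝ) * c k * e l)
  simp only [h]
  rw [integral_finsetSum _ fun k _ => integrable_finsetSum _ fun l _ => hi k l]
  refine Finset.sum_congr rfl fun k _ => ?_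
  rw [integral_finsetSum _ fun l _ => hi k l]
  simp only [integral_const_mul, integral_tensorFun_mul hα, mul_ite, mul_zero]
  rw [Finset.sum_ite_eq]
  split_ifs with hk
  · rfl
  · rw [Finsupp.notMem_support_iff.1 hk]; ring

/-! ### Density of even polynomials in weighted spaces -/

/-- The even polynomial `P(x_1², …, x_d²)`. -/
def evenPoly (P : MvPolynomial (Fin d) ℝ) (x : Fin d → ℝ) : ℝ :=
  MvPolynomial.eval (fun i => x i ^ 2) P

theorem continuous_evenPoly (P : MvPolynomial (Fin d) ℝ) : Continuous (evenPoly P) :=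
  (MvPolynomial.continuous_eval P).comp (by fun_prop)

theorem evenPoly_C (a : ℝ) : evenPoly (d := d) (MvPolynomial.C a) = fun _ => a := by
  funext x; simp [evenPoly]

theorem evenPoly_add (P Q : MvPolynomial (Fin d) ℝ) :
    evenPoly (P + Q) = fun x => evenPoly P x + evenPoly Q x := by
  funext x; simp [evenPoly]

theorem evenPoly_mul (P Q : MvPolynomial (Fin d) ℝ) :
    evenPoly (P * Q) = fun x => evenPoly P x * evenPoly Q x := by
  funext x; simp [evenPoly]

theorem evenPoly_X (i : Fin d) : evenPoly (MvPolynomial.X i) = fun x => x i ^ 2 := by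
  funext x; simp [evenPoly]

theorem gaussBound_evenPoly (P : MvPolynomial (Fin d) ℝ) : GaussBound 0 (evenPoly P) := by
  induction P using MvPolynomial.induction_on with
  | C a => rw [evenPoly_C]; exact gaussBound_const a
  | add P Q hP hQ => rw [evenPoly_add]; exact hP.add hQ
  | mul_X P i hP =>
    have hX : GaussBound (d := d) 0 fun x => x i ^ 2 := by
      obtain ⟨A, hA, h⟩ := exists_pow_le_exp 2
      refine ⟨A, hA, fun x hx => ?_⟩
      rw [abs_of_nonneg (sq_nonneg _)]
      have h1 : x i ≤ ∑ j, x j :=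
        Finset.single_le_sum (fun j _ => (hx j).le) (Finset.mem_univ i)
      refine (h (x i) (hx i).le).trans ?_
      simp only [neg_zero, zero_mul, Real.exp_zero, mul_one]
      gcongr
    rw [evenPoly_mul, evenPoly_X]
    simpa using hP.mul hX

/-- `f` is a limit of even polynomials in `L^p(ρ)`. -/
def EvenPolyLimit (p : ℝ≥0∞) (ρ : Measure (Fin d → ℝ)) (f : (Fin d → ℝ) → ℝ) : Prop :=
  AEStronglyMeasurable f ρ ∧ ∀ ε : ℝ≥0∞, ε ≠ 0 → ∃ P, eLpNorm (f - evenPoly P) p ρ ≤ ε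

section Density

variable {p : ℝ≥0∞} {ρ : Measure (Fin d → ℝ)} {f g : (Fin d → ℝ) → ℝ}

theorem EvenPolyLimit.add (hp : 1 ≤ p) (hf : EvenPolyLimit p ρ f) (hg : EvenPolyLimit p ρ g) :
    EvenPolyLimit p ρ (f + g) := by
  refine ⟨hf.1.add hg.1, fun ε hε => ?_⟩
  have hε' : ε / 2 ≠ 0 := (ENNReal.half_pos hε).ne'
  obtain ⟨P, hP⟩ := hf.2 _ hε'
  obtain ⟨Q, hQ⟩ := hg.2 _ hε'
  refine ⟨P + Q, ?_⟩
  have h : f + g - evenPoly (P + Q) = (f - evenPoly P) + (g - evenPoly Q) := by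
    funext x; simp [evenPoly]; ring
  rw [h, ← ENNReal.add_halves ε]
  exact (eLpNorm_add_le (hf.1.sub (continuous_evenPoly P).aestronglyMeasurable)
    (hg.1.sub (continuous_evenPoly Q).aestronglyMeasurable) hp).trans (add_le_add hP hQ)

theorem EvenPolyLimit.of_eLpNorm_le (hp : 1 ≤ p) (hf : AEStronglyMeasurable f ρ)
    (h : ∀ ε : ℝ≥0∞, ε ≠ 0 → ∃ g, EvenPolyLimit p ρ g ∧ eLpNorm (f - g) p ρ ≤ ε) :
    EvenPolyLimit p ρ f := by
  refine ⟨hf, fun ε hε => ?_⟩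
  have hε' : ε / 2 ≠ 0 := (ENNReal.half_pos hε).ne'
  obtain ⟨g, hg, hfg⟩ := h _ hε'
  obtain ⟨P, hP⟩ := hg.2 _ hε'
  refine ⟨P, ?_⟩
  rw [← sub_add_sub_cancel f g, ← ENNReal.add_halves ε]
  exact (eLpNorm_add_le (hf.sub hg.1)
    (hg.1.sub (continuous_evenPoly P).aestronglyMeasurable) hp).trans (add_le_add hfg hP)

theorem EvenPolyLimit.of_abs_sub_le (hp : 1 ≤ p) (hf : AEStronglyMeasurable f ρ)
    {H : (Fin d → ℝ) → ℝ} (hH : MemLp H p ρ)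
    (h : ∀ δ : ℝ, 0 < δ → ∃ g, EvenPolyLimit p ρ g ∧ ∀ᵐ x ∂ρ, |f x - g x| ≤ δ * |H x|) :
    EvenPolyLimit p ρ f := by
  refine EvenPolyLimit.of_eLpNorm_le hp hf fun ε hε => ?_
  obtain ⟨δ, hδ, hδε⟩ : ∃ δ : ℝ, 0 < δ ∧ ENNReal.ofReal δ * eLpNorm H p ρ ≤ ε := by
    obtain ⟨c, hc, hc'⟩ := ENNReal.exists_nnreal_pos_mul_lt hH.2.ne hε
    exact ⟨c, hc, by simpa using hc'.le⟩
  obtain ⟨g, hg, hfg⟩ := h δ hδ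
  exact ⟨g, hg, (eLpNorm_le_mul_eLpNorm_of_ae_le_mul (by simpa using hfg) p).trans hδε⟩

theorem abs_cos_sub_sum_le (y : ℝ) (N : ℕ) :
    |Real.cos y - ∑ n ∈ Finset.range N, (-1) ^ n * y ^ (2 * n) / (2 * n).factorial| ≤
      2 * Real.exp (2 * |y|) * (1 / 4) ^ N := by
  have h := norm_sub_le_of_geometric_bound_of_hasSum (r := 1 / 4) (C := Real.exp (2 * |y|))
    (by norm_num) (fun n => ?_) (Real.hasSum_cos y) N
  · rw [abs_sub_comm, ← Real.norm_eq_abs]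
    refine h.trans ?_
    have : 0 < Real.exp (2 * |y|) * (1 / 4) ^ N := by positivity
    rw [div_le_iff₀ (by norm_num)]
    linarith
  · have h1 := Real.pow_div_factorial_le_exp (2 * |y|) (by positivity) (2 * n)
    rw [norm_div, norm_mul, norm_pow, norm_neg, norm_one, one_pow, one_mul, norm_pow,
      Real.norm_eq_abs, Real.norm_of_nonneg (by positivity)]
    rw [mul_pow, pow_mul 2, mul_div_assoc] at h1
    calc |y| ^ (2 * n) / (2 * n).factorial
        = (2 ^ 2) ^ n * (|y| ^ (2 * n) / (2 * n).factorial) * (1 / 4) ^ n := by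
          rw [mul_right_comm, ← mul_pow]; norm_num
      _ ≤ _ := by gcongr

theorem memLp_of_gaussBound_zero (hpos : ∀ᵐ x ∂ρ, ∀ i, 0 < x i)
    (hexp : ∀ A : ℝ, MemLp (fun x => Real.exp (A * (1 + ∑ i, x i))) p ρ)
    (hf : AEStronglyMeasurable f ρ) (hb : GaussBound 0 f) : MemLp f p ρ := by
  obtain ⟨A, _, h⟩ := hb
  refine (hexp A).of_le hf ?_
  filter_upwards [hpos] with x hx
  simpa using h x hx

/-- Multiplication by `cos (a x_i)` preserves the bounded multipliers that map even polynomials to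
limits of even polynomials: the Taylor series of the cosine is even. -/
theorem EvenPolyLimit.cos_mul (hp : 1 ≤ p) (hpos : ∀ᵐ x ∂ρ, ∀ i, 0 < x i)
    (hexp : ∀ A : ℝ, MemLp (fun x => Real.exp (A * (1 + ∑ i, x i))) p ρ)
    {m : (Fin d → ℝ) → ℝ} (hm : Continuous m) (hb : GaussBound 0 m)
    (h : ∀ Q, EvenPolyLimit p ρ fun x => m x * evenPoly Q x) (a : ℝ) (i : Fin d)
    (Q : MvPolynomial (Fin d) ℝ) :
    EvenPolyLimit p ρ fun x => (m x * Real.cos (a * x i)) * evenPoly Q x := by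
  have hE : GaussBound (d := d) 0 fun x => Real.exp (2 * |a| * x i) := by
    refine ⟨2 * |a|, by positivity, fun x hx => ?_⟩
    rw [abs_of_pos (Real.exp_pos _)]
    have h1 : x i ≤ ∑ j, x j :=
      Finset.single_le_sum (fun j _ => (hx j).le) (Finset.mem_univ i)
    simp only [neg_zero, zero_mul, Real.exp_zero, mul_one]
    gcongr
    linarith
  have hQ := continuous_evenPoly Q
  have hH : MemLp (fun x => m x * Real.exp (2 * |a| * x i) * evenPoly Q x) p ρ := by
    refine memLp_of_gaussBound_zero hpos hexp (by fun_prop : Continuous _).aestronglyMeasurable ?_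
    simpa using (hb.mul hE).mul (gaussBound_evenPoly Q)
  refine EvenPolyLimit.of_abs_sub_le hp (by fun_prop : Continuous _).aestronglyMeasurable hH
    fun δ hδ => ?_
  obtain ⟨N, hN⟩ := exists_pow_lt_of_lt_one (half_pos hδ) (by norm_num : (1 / 4 : ℝ) < 1)
  refine ⟨_, h ((∑ n ∈ Finset.range N, MvPolynomial.C ((-1) ^ n * a ^ (2 * n) /
    (2 * n).factorial) * MvPolynomial.X i ^ n) * Q), ?_⟩
  filter_upwards [hpos] with x hx
  have hT : evenPoly ((∑ n ∈ Finset.range N, MvPolynomial.C ((-1) ^ n * a ^ (2 * n) /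
      (2 * n).factorial) * MvPolynomial.X i ^ n) * Q) x = (∑ n ∈ Finset.range N,
        (-1) ^ n * (a * x i) ^ (2 * n) / (2 * n).factorial) * evenPoly Q x := by
    simp only [evenPoly, map_mul, map_sum, map_pow, MvPolynomial.eval_C, MvPolynomial.eval_X]
    congr 1
    refine Finset.sum_congr rfl fun n _ => ?_
    rw [← pow_mul, mul_pow]
    ring
  have hc := abs_cos_sub_sum_le (a * x i) N
  rw [abs_mul, abs_of_pos (hx i), ← mul_assoc] at hc
  rw [hT, ← mul_assoc (m x), ← sub_mul, ← mul_sub, abs_mul, abs_mul, abs_mul, abs_mul,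
    abs_of_pos (Real.exp_pos _)]
  calc _ ≤ |m x| * (2 * Real.exp (2 * |a| * x i) * (1 / 4) ^ N) * |evenPoly Q x| := by gcongr
    _ ≤ |m x| * (2 * Real.exp (2 * |a| * x i) * (δ / 2)) * |evenPoly Q x| := by gcongr
    _ = _ := by ring

theorem evenPolyLimit_cos_poly (hp : 1 ≤ p) (hpos : ∀ᵐ x ∂ρ, ∀ i, 0 < x i)
    (hexp : ∀ A : ℝ, MemLp (fun x => Real.exp (A * (1 + ∑ i, x i))) p ρ) (a : ℝ)
    (P : MvPolynomial (Fin d) ℝ) (Q : MvPolynomial (Fin d) ℝ) :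
    EvenPolyLimit p ρ fun x => MvPolynomial.eval (fun i => Real.cos (a * x i)) P * evenPoly Q x := by
  have hcont : ∀ P : MvPolynomial (Fin d) ℝ,
      Continuous fun x : Fin d → ℝ => MvPolynomial.eval (fun i => Real.cos (a * x i)) P := fun P =>
    (MvPolynomial.continuous_eval P).comp (by fun_prop)
  have hbound : ∀ P : MvPolynomial (Fin d) ℝ, GaussBound 0
      fun x : Fin d → ℝ => MvPolynomial.eval (fun i => Real.cos (a * x i)) P := by
    intro P
    induction P using MvPolynomial.induction_on with
    | C b => simpa using gaussBound_const b
    | add P R hP hR => simpa using hP.add hR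
    | mul_X P i hP =>
      have hX : GaussBound (d := d) 0 fun x => Real.cos (a * x i) :=
        ⟨0, le_rfl, fun x _ => by simpa using Real.abs_cos_le_one _⟩
      simpa using hP.mul hX
  induction P using MvPolynomial.induction_on generalizing Q with
  | C b =>
    refine ⟨((hcont _).mul (continuous_evenPoly Q)).aestronglyMeasurable, fun ε _ =>
      ⟨MvPolynomial.C b * Q, ?_⟩⟩
    have : ((fun x => MvPolynomial.eval (fun i => Real.cos (a * x i)) (MvPolynomial.C b) *
        evenPoly Q x) - evenPoly (MvPolynomial.C b * Q)) = 0 := by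
      funext x; simp [evenPoly]
    rw [this]
    simp
  | add P R hP hR =>
    convert (hP Q).add hp (hR Q) using 1
    funext x
    simp [add_mul]
  | mul_X P i hP =>
    simpa using EvenPolyLimit.cos_mul hp hpos hexp (hcont P) (hbound P) hP a i Q

/-- If `ρ` has all exponential moments, then the even polynomials are dense in `L^p(ρ)`. A bounded
continuous `f` is the limit of `f(M arccos (cos (x_i / M)))` as `M → ∞`, and these functions are
uniform limits of polynomials in `cos (x_i / M)`. -/
theorem evenPolyLimit_of_memLp [IsFiniteMeasure ρ] (hp : 1 ≤ p) (hp' : p ≠ ⊤)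
    (hpos : ∀ᵐ x ∂ρ, ∀ i, 0 < x i)
    (hexp : ∀ A : ℝ, MemLp (fun x => Real.exp (A * (1 + ∑ i, x i))) p ρ) (hf : MemLp f p ρ) :
    EvenPolyLimit p ρ f := by
  refine EvenPolyLimit.of_eLpNorm_le hp hf.1 fun ε hε => ?_
  obtain ⟨g, hg, hgp⟩ := hf.exists_boundedContinuous_eLpNorm_sub_le hp' hε
  refine ⟨g, ?_, hg⟩
  have hH : MemLp (fun x : Fin d → ℝ => 1 + ∑ i, x i) p ρ := by
    refine memLp_of_gaussBound_zero hpos hexp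
      (by fun_prop : Continuous _).aestronglyMeasurable ⟨1, zero_le_one, fun x hx => ?_⟩
    have hs : 0 ≤ ∑ i, x i := Finset.sum_nonneg fun i _ => (hx i).le
    rw [abs_of_nonneg (by linarith)]
    simpa using (by linarith [Real.add_one_le_exp (1 + ∑ i, x i)] :
      1 + ∑ i, x i ≤ Real.exp (1 + ∑ i, x i))
  refine EvenPolyLimit.of_abs_sub_le hp hgp.1 hH fun δ hδ => ?_
  -- With this `M`, the bound `2 ‖g‖` beyond the first zero of `sin (x_i / M)` is at most `δ x_i`.
  set M : ℝ := (2 * ‖g‖ + 1) / δ with hM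
  have hM0 : 0 < M := by positivity
  have hcont : Continuous fun y : Fin d → ℝ => g fun i => M * Real.arccos (y i) :=
    g.continuous.comp (continuous_pi fun i =>
      continuous_const.mul (Real.continuous_arccos.comp (continuous_apply i)))
  -- Stone–Weierstrass on the cube.
  let A : Subalgebra ℝ C(Fin d → ℝ, ℝ) :=
    (MvPolynomial.aeval fun i : Fin d => (⟨fun y => y i, continuous_apply i⟩ :
      C(Fin d → ℝ, ℝ))).range
  have hA : A.SeparatesPoints := by
    intro x y hxy
    obtain ⟨i, hi⟩ := Function.ne_iff.1 hxy
    exact ⟨fun y => y i, ⟨⟨fun y => y i, continuous_apply i⟩,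
      ⟨MvPolynomial.X i, by simp⟩, rfl⟩, hi⟩
  have hK : IsCompact (Set.univ.pi fun _ : Fin d => Set.Icc (-1 : ℝ) 1) :=
    isCompact_univ_pi fun _ => isCompact_Icc
  obtain ⟨φ, ⟨P, hP⟩, hφ⟩ :=
    ContinuousMap.exists_mem_subalgebra_near_continuous_of_isCompact_of_separatesPoints hA
      ⟨_, hcont⟩ hK hδ
  have hφP : ∀ y, φ y = MvPolynomial.eval y P := by
    intro y
    rw [← hP]
    have : (ContinuousMap.evalAlgHom ℝ ℝ y).comp (MvPolynomial.aeval fun i : Fin d =>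
        (⟨fun y => y i, continuous_apply i⟩ : C(Fin d → ℝ, ℝ))) = MvPolynomial.aeval y := by
      ext i; simp
    have := DFunLike.congr_fun this P
    simpa [MvPolynomial.aeval_eq_eval] using this
  refine ⟨_, evenPolyLimit_cos_poly hp hpos hexp M⁻¹ P 1, ?_⟩
  filter_upwards [hpos] with x hx
  have hs : ∀ i, x i ≤ ∑ j, x j := fun i =>
    Finset.single_le_sum (fun j _ => (hx j).le) (Finset.mem_univ i)
  have hs0 : 0 ≤ ∑ j, x j := Finset.sum_nonneg fun i _ => (hx i).le
  have h1 : |g (fun i => M * Real.arccos (Real.cos (M⁻¹ * x i))) -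
      MvPolynomial.eval (fun i => Real.cos (M⁻¹ * x i)) P| ≤ δ := by
    have := hφ (fun i => Real.cos (M⁻¹ * x i)) fun i _ =>
      ⟨Real.neg_one_le_cos _, Real.cos_le_one _⟩
    rw [hφP, Real.norm_eq_abs, abs_sub_comm] at this
    exact this.le
  have h2 : |g x - g (fun i => M * Real.arccos (Real.cos (M⁻¹ * x i)))| ≤ δ * ∑ j, x j := by
    by_cases hle : ∀ i, M⁻¹ * x i ≤ Real.pi
    · have : (fun i => M * Real.arccos (Real.cos (M⁻¹ * x i))) = x := by
        funext i
        rw [Real.arccos_cos (mul_nonneg (inv_pos.2 hM0).le (hx i).le) (hle i),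
          mul_inv_cancel_left₀ hM0.ne']
      rw [this]
      simpa using mul_nonneg hδ.le hs0
    · push Not at hle
      obtain ⟨i, hi⟩ := hle
      have h3 : M ≤ ∑ j, x j := by
        have : 1 < M⁻¹ * x i := lt_trans (by linarith [Real.pi_gt_three]) hi
        rw [inv_mul_eq_div, one_lt_div hM0] at this
        exact this.le.trans (hs i)
      have h4 := g.norm_coe_le_norm x
      have h5 := g.norm_coe_le_norm fun i => M * Real.arccos (Real.cos (M⁻¹ * x i))
      rw [Real.norm_eq_abs] at h4 h5
      calc _ ≤ ‖g‖ + ‖g‖ := (abs_sub _ _).trans (add_le_add h4 h5)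
        _ ≤ δ * M := by rw [hM, mul_div_cancel₀ _ hδ.ne']; linarith
        _ ≤ _ := by gcongr
  have h6 : evenPoly (1 : MvPolynomial (Fin d) ℝ) x = 1 := by simp [evenPoly]
  rw [h6, mul_one, abs_of_nonneg (by linarith : 0 ≤ 1 + ∑ i, x i)]
  calc _ ≤ |g x - g (fun i => M * Real.arccos (Real.cos (M⁻¹ * x i)))| +
        |g (fun i => M * Real.arccos (Real.cos (M⁻¹ * x i))) -
          MvPolynomial.eval (fun i => Real.cos (M⁻¹ * x i)) P| := abs_sub_le _ _ _
    _ ≤ _ := by linarith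

end Density

/-- Weighted version, obtained by applying `evenPolyLimit_of_memLp` to `f / v` and `|v|^p μ`: if
`v` decays in the sense that `e^{A |x|} v ∈ L^p(μ)` for all `A`, then the functions of `L^p(μ)`
which vanish where `v` does are limits of `P(x_1², …, x_d²) v(x)`. -/
theorem exists_evenPoly_mul_close {p : ℝ} (hp : 1 ≤ p) {μ : Measure (Fin d → ℝ)}
    (hpos : ∀ᵐ x ∂μ, ∀ i, 0 < x i) {v f : (Fin d → ℝ) → ℝ}
    (hv : ∀ A : ℝ, MemLp (fun x => Real.exp (A * (1 + ∑ i, x i)) * v x) (ENNReal.ofReal p) μ)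
    (hf : MemLp f (ENNReal.ofReal p) μ) (hfv : ∀ᵐ x ∂μ, v x = 0 → f x = 0) {ε : ℝ≥0∞}
    (hε : ε ≠ 0) :
    ∃ P, eLpNorm (fun x => f x - evenPoly P x * v x) (ENNReal.ofReal p) μ ≤ ε := by
  have hp0 : 0 < p := by linarith
  have hvm : AEStronglyMeasurable v μ := by simpa using (hv 0).1
  set ρ := μ.withDensity fun x => ‖v x‖ₑ ^ p with hρ
  have hdm : AEMeasurable (fun x => ‖v x‖ₑ ^ p) μ := hvm.enorm.pow_const p
  have hac : ρ ≪ μ := withDensity_absolutelyContinuous _ _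
  -- `g ↦ g v` is an isometry from `L^p(ρ)` to `L^p(μ)`.
  have hnorm : ∀ g : (Fin d → ℝ) → ℝ, eLpNorm g (ENNReal.ofReal p) ρ =
      eLpNorm (fun x => g x * v x) (ENNReal.ofReal p) μ := by
    intro g
    have h0 : ENNReal.ofReal p ≠ 0 := by simpa using hp0
    rw [eLpNorm_eq_lintegral_rpow_enorm_toReal h0 ENNReal.ofReal_ne_top,
      eLpNorm_eq_lintegral_rpow_enorm_toReal h0 ENNReal.ofReal_ne_top, ENNReal.toReal_ofReal hp0.le,
      hρ, lintegral_withDensity_eq_lintegral_mul_non_measurable₀ _ hdm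
        (ae_of_all _ fun x => ENNReal.rpow_lt_top_of_nonneg hp0.le enorm_ne_top)]
    congr 2
    funext x
    simp only [Pi.mul_apply, enorm_mul]
    rw [ENNReal.mul_rpow_of_nonneg _ _ hp0.le, mul_comm]
  have hmem : ∀ g : (Fin d → ℝ) → ℝ, AEStronglyMeasurable g μ →
      MemLp (fun x => g x * v x) (ENNReal.ofReal p) μ → MemLp g (ENNReal.ofReal p) ρ :=
    fun g hg h => ⟨hg.mono_ac hac, by rw [hnorm]; exact h.2⟩
  have hfin : IsFiniteMeasure ρ := by
    have h1 := (hmem (fun _ => 1) aestronglyMeasurable_const (by simpa using hv 0))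
    rw [memLp_const_iff (by simpa using hp0) ENNReal.ofReal_ne_top] at h1
    exact ⟨by simpa using h1⟩
  have hlim := evenPolyLimit_of_memLp (f := fun x => f x / v x) (ρ := ρ)
    (by simpa using hp) ENNReal.ofReal_ne_top (hac.ae_le hpos)
    (fun A => hmem _ (by fun_prop : Continuous _).aestronglyMeasurable (hv A)) (hmem _
      (hf.1.aemeasurable.div hvm.aemeasurable).aestronglyMeasurable (hf.ae_eq ?_))
  · obtain ⟨P, hP⟩ := hlim.2 ε hε
    refine ⟨P, ?_⟩
    rw [hnorm] at hP
    refine (eLpNorm_congr_ae ?_).trans_le hP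
    filter_upwards [hfv] with x hx
    by_cases h : v x = 0
    · simp [h, hx h]
    · simp only [Pi.sub_apply]; field_simp
  · filter_upwards [hfv] with x hx
    by_cases h : v x = 0
    · simp [h, hx h]
    · field_simp

/-! ### Density of the spans of the Laguerre functions and of their derivatives -/

/-- The factor in the variable `x_j` of `e^{-|x|²/2}` (if `o = none`) or of `x_i e^{-|x|²/2}`
(if `o = some i`). -/
def tensorWeightFactor (o : Option (Fin d)) (j : Fin d) (x : ℝ) : ℝ :=
  (if o = some j then x else 1) * Real.exp (-x ^ 2 / 2)

/-- `e^{-|x|²/2}` (for `o = none`) or `x_i e^{-|x|²/2}` (for `o = some i`). -/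
def tensorWeight (o : Option (Fin d)) (x : Fin d → ℝ) : ℝ :=
  ∏ j, tensorWeightFactor o j (x j)

theorem continuous_tensorWeight (o : Option (Fin d)) : Continuous (tensorWeight o) := by
  refine continuous_finsetProd _ fun j _ => ?_
  unfold tensorWeightFactor
  split_ifs <;> fun_prop

theorem gaussBound_tensorWeight (o : Option (Fin d)) : GaussBound (1 / 2) (tensorWeight o) := by
  have h1 : HalfLineBound fun x => 1 * Real.exp (-x ^ 2 / 2) :=
    ⟨0, le_rfl, fun x _ => by simp [abs_of_pos (Real.exp_pos _)]⟩
  have h2 : HalfLineBound fun x => x * Real.exp (-x ^ 2 / 2) := by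
    simpa using h1.id_mul
  refine gaussBound_prod fun j => ?_
  unfold tensorWeightFactor
  split_ifs
  · exact h2
  · exact h1

theorem tensorWeight_ne_zero (o : Option (Fin d)) {x : Fin d → ℝ} (hx : ∀ i, 0 < x i) :
    tensorWeight o x ≠ 0 := by
  refine Finset.prod_ne_zero_iff.2 fun j _ => mul_ne_zero ?_ (Real.exp_pos _).ne'
  split_ifs
  · exact (hx j).ne'
  · exact one_ne_zero

/-- The one-variable case. For `o = some j` it uses that `δ ℓ_m^a` is a multiple of
`x ℓ_{m-1}^{a+1}`. -/
theorem exists_sum_tensorFactor {α : Fin d → ℝ} (hα : ∀ i, -(1 / 2 : ℝ) ≤ α i)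
    (o : Option (Fin d)) (j : Fin d) (n : ℕ) :
    ∃ (N : ℕ) (c : ℕ → ℝ), ∀ (x : ℝ), x ^ (2 * n) * tensorWeightFactor o j x =
      ∑ m ∈ Finset.range N, c m * tensorFactor α o (fun _ => m) j x := by
  unfold tensorWeightFactor tensorFactor
  by_cases h : o = some j
  · simp only [h, if_true]
    obtain ⟨c, hc⟩ := exists_sum_laguerreFun (a := α j + 1) (by linarith [hα j]) n
    refine ⟨n + 2, fun m => c (m - 1) * (-2 * Real.sqrt m)⁻¹, fun x => ?_⟩
    rw [mul_left_comm, hc, Finset.sum_range_succ' _ (n + 1), Finset.mul_sum]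
    have h0 : laguerreDel (α j) 0 x = 0 := by simp [laguerreDel, laguerreQuot]
    rw [h0, mul_zero, add_zero]
    refine Finset.sum_congr rfl fun m _ => ?_
    have : Real.sqrt ((m : ℝ) + 1) ≠ 0 := (Real.sqrt_pos.2 (by positivity)).ne'
    simp only [laguerreDel, laguerreQuot, Nat.add_sub_cancel, Nat.cast_add, Nat.cast_one]
    field_simp
  · simp only [h, if_false, one_mul]
    obtain ⟨c, hc⟩ := exists_sum_laguerreFun (a := α j) (by linarith [hα j]) n
    exact ⟨n + 1, c, hc⟩

theorem exists_evenPoly_mul_tensorWeight {α : Fin d → ℝ} (hα : ∀ i, -(1 / 2 : ℝ) ≤ α i)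
    (o : Option (Fin d)) (P : MvPolynomial (Fin d) ℝ) :
    (fun x => evenPoly P x * tensorWeight o x) ∈ LinearMap.range (tensorSum α o) := by
  induction P using MvPolynomial.induction_on' with
  | monomial u a =>
    choose N c hc using fun j => exists_sum_tensorFactor hα o j (u j)
    have h : (fun x => evenPoly (MvPolynomial.monomial u a) x * tensorWeight o x) =
        ∑ k ∈ Fintype.piFinset fun j => Finset.range (N j),
          (a * ∏ j, c j (k j)) • tensorFun α o k := by
      funext x
      rw [evenPoly, MvPolynomial.eval_monomial, Finsupp.prod_fintype _ _ fun i => pow_zero _,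
        tensorWeight, mul_assoc, ← Finset.prod_mul_distrib]
      simp only [← pow_mul, hc]
      rw [Finset.prod_univ_sum, Finset.mul_sum, Finset.sum_apply]
      refine Finset.sum_congr rfl fun k _ => ?_
      rw [Finset.prod_mul_distrib, Pi.smul_apply, smul_eq_mul, mul_assoc]
      rfl
    rw [h]
    refine Submodule.sum_mem _ fun k _ => Submodule.smul_mem _ _ ⟨Finsupp.single k 1, ?_⟩
    simp [tensorSum]
  | add P Q hP hQ =>
    have h : (fun x => evenPoly (P + Q) x * tensorWeight o x) =
        (fun x => evenPoly P x * tensorWeight o x) + fun x => evenPoly Q x * tensorWeight o x := by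
      funext x; simp [evenPoly, add_mul]
    rw [h]
    exact Submodule.add_mem _ hP hQ

theorem memLp_tensorSum {α : Fin d → ℝ} (hα : ∀ i, -(1 / 2 : ℝ) ≤ α i) (o : Option (Fin d))
    (c : (Fin d → ℕ) →₀ ℝ) {p : ℝ≥0∞} (hp0 : p ≠ 0) (hp : p ≠ ⊤) :
    MemLp (tensorSum α o c) p (laguerreMeasure α) :=
  (gaussBound_tensorSum α o c).memLp hα (by norm_num)
    (continuous_tensorSum α o c).aestronglyMeasurable hp0 hp

theorem GaussBound.exp_mul {c : ℝ} {f : (Fin d → ℝ) → ℝ} (hf : GaussBound c f) (A : ℝ) :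
    GaussBound c fun x => Real.exp (A * (1 + ∑ i, x i)) * f x := by
  have h : GaussBound (d := d) 0 fun x => Real.exp (A * (1 + ∑ i, x i)) := by
    refine ⟨|A|, abs_nonneg _, fun x hx => ?_⟩
    have hs : 0 ≤ ∑ i, x i := Finset.sum_nonneg fun i _ => (hx i).le
    rw [abs_of_pos (Real.exp_pos _)]
    simp only [neg_zero, zero_mul, Real.exp_zero, mul_one]
    gcongr
    exact le_abs_self A
  simpa using h.mul hf

/-- The finite sums of `ℓ_k`, and those of `δ_i ℓ_k`, are dense in `L^p`. -/
theorem exists_tensorSum_close {α : Fin d → ℝ} (hα : ∀ i, -(1 / 2 : ℝ) ≤ α i) (o : Option (Fin d))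
    {p : ℝ} (hp : 1 ≤ p) {f : (Fin d → ℝ) → ℝ} (hf : MemLp f (ENNReal.ofReal p) (laguerreMeasure α))
    {ε : ℝ≥0∞} (hε : ε ≠ 0) :
    ∃ c, eLpNorm (f - tensorSum α o c) (ENNReal.ofReal p) (laguerreMeasure α) ≤ ε := by
  obtain ⟨P, hP⟩ := exists_evenPoly_mul_close (v := tensorWeight o) hp (laguerreMeasure_ae_pos α)
    (fun A => ((gaussBound_tensorWeight o).exp_mul A).memLp hα (by norm_num)
      (Continuous.mul (by fun_prop) (continuous_tensorWeight o)).aestronglyMeasurable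
      (by simp; linarith) ENNReal.ofReal_ne_top) hf
    ((laguerreMeasure_ae_pos α).mono fun x hx h => absurd h (tensorWeight_ne_zero o hx)) hε
  obtain ⟨c, hc⟩ := exists_evenPoly_mul_tensorWeight hα o P
  exact ⟨c, by rw [hc]; exact hP⟩

/-- A function which is orthogonal to all `ℓ_k`, or to all `δ_i ℓ_k`, vanishes. -/
theorem ae_eq_zero_of_integral_tensorFun {α : Fin d → ℝ} (hα : ∀ i, -(1 / 2 : ℝ) ≤ α i)
    (o : Option (Fin d)) {h : (Fin d → ℝ) → ℝ}
    (hi : ∀ G : (Fin d → ℝ) → ℝ, Continuous G → GaussBound (1 / 2) G →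
      Integrable (fun x => h x * G x) (laguerreMeasure α))
    (h0 : ∀ k, ∫ x, h x * tensorFun α o k x ∂laguerreMeasure α = 0) :
    h =ᵐ[laguerreMeasure α] 0 := by
  set v : (Fin d → ℝ) → ℝ := fun x => h x * tensorWeight o x with hv
  have hvi : Integrable v (laguerreMeasure α) :=
    hi _ (continuous_tensorWeight o) (gaussBound_tensorWeight o)
  have hexp : ∀ A : ℝ, MemLp (fun x => Real.exp (A * (1 + ∑ i, x i)) * v x) (ENNReal.ofReal 1)
      (laguerreMeasure α) := by
    intro A
    rw [ENNReal.ofReal_one, memLp_one_iff_integrable]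
    refine (hi _ (Continuous.mul (by fun_prop) (continuous_tensorWeight o))
      ((gaussBound_tensorWeight o).exp_mul A)).congr (ae_of_all _ fun x => ?_)
    change h x * (Real.exp (A * (1 + ∑ i, x i)) * tensorWeight o x) =
      Real.exp (A * (1 + ∑ i, x i)) * (h x * tensorWeight o x)
    ring
  have hzero : ∀ P, ∫ x, evenPoly P x * v x ∂laguerreMeasure α = 0 := by
    intro P
    obtain ⟨c, hc⟩ := exists_evenPoly_mul_tensorWeight hα o P
    have h1 : ∀ x, evenPoly P x * v x = ∑ k ∈ c.support, c k * (h x * tensorFun α o k x) := by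
      intro x
      have := congrFun hc x
      rw [tensorSum_apply] at this
      simp only [hv]
      rw [mul_left_comm, ← this, Finset.mul_sum]
      exact Finset.sum_congr rfl fun k _ => by ring
    simp only [h1]
    rw [integral_finsetSum _ fun k _ => (hi _ (continuous_tensorFun α o k)
      (gaussBound_tensorFun α o k)).const_mul _]
    simp [integral_const_mul, h0]
  have hint : ∫ x, |v x| ∂laguerreMeasure α ≤ 0 := by
    refine le_of_forall_pos_le_add fun ε hε => ?_
    obtain ⟨P, hP⟩ := exists_evenPoly_mul_close (f := fun x => |v x|) le_rfl
      (laguerreMeasure_ae_pos α) hexp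
      (by rw [ENNReal.ofReal_one, memLp_one_iff_integrable]; exact hvi.abs)
      (ae_of_all _ fun x hx => by simp [hx]) (ENNReal.ofReal_pos.2 hε).ne'
    have hPi : Integrable (fun x => evenPoly P x * v x) (laguerreMeasure α) := by
      obtain ⟨c, hc⟩ := exists_evenPoly_mul_tensorWeight hα o P
      refine (hi _ (continuous_tensorSum α o c) (gaussBound_tensorSum α o c)).congr
        (ae_of_all _ fun x => ?_)
      simp only [hc, hv]
      ring
    rw [ENNReal.ofReal_one, eLpNorm_one_eq_lintegral_enorm] at hP
    have h3 : ∫ x, |v x| ∂laguerreMeasure α =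
        ∫ x, (|v x| - evenPoly P x * v x) ∂laguerreMeasure α := by
      rw [integral_sub hvi.abs hPi, hzero, sub_zero]
    rw [h3, zero_add]
    refine (le_abs_self _).trans ((abs_integral_le_integral_abs).trans ?_)
    simp only [← Real.norm_eq_abs (_ - _)]
    rw [integral_norm_eq_lintegral_enorm (f := fun x => |v x| - evenPoly P x * v x)
      (hvi.abs.sub hPi).aestronglyMeasurable]
    exact ENNReal.toReal_le_of_le_ofReal hε.le hP
  have hae := (integral_eq_zero_iff_of_nonneg (fun x => abs_nonneg (v x)) hvi.abs).1
    (le_antisymm hint (integral_nonneg fun x => abs_nonneg _))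
  filter_upwards [hae, laguerreMeasure_ae_pos α] with x hx hpos
  exact (mul_eq_zero.1 (abs_eq_zero.1 hx)).resolve_right (tensorWeight_ne_zero o hpos)

/-! ### The series of the Riesz transforms in `L²` -/

theorem memLp_two_tensorFun {α : Fin d → ℝ} (hα : ∀ i, -(1 / 2 : ℝ) ≤ α i) (o : Option (Fin d))
    (k : Fin d → ℕ) : MemLp (tensorFun α o k) 2 (laguerreMeasure α) :=
  memLp_tensorFun hα o k two_ne_zero ENNReal.ofNat_ne_top

/-- `ℓ_k` (for `o = none`) or `δ_i ℓ_k` (for `o = some i`), as an element of `L²`. -/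
def tensorL2 {α : Fin d → ℝ} (hα : ∀ i, -(1 / 2 : ℝ) ≤ α i) (o : Option (Fin d)) (k : Fin d → ℕ) :
    Lp ℝ 2 (laguerreMeasure α) :=
  (memLp_two_tensorFun hα o k).toLp _

theorem inner_toLp {μ : Measure (Fin d → ℝ)} {f g : (Fin d → ℝ) → ℝ} (hf : MemLp f 2 μ)
    (hg : MemLp g 2 μ) : inner ℝ (hf.toLp f) (hg.toLp g) = ∫ x, f x * g x ∂μ := by
  rw [L2.inner_def]
  refine integral_congr_ae ?_
  filter_upwards [hf.coeFn_toLp, hg.coeFn_toLp] with x h1 h2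
  rw [h1, h2, RCLike.inner_apply, conj_trivial, mul_comm]

theorem inner_tensorL2 {α : Fin d → ℝ} (hα : ∀ i, -(1 / 2 : ℝ) ≤ α i) (o : Option (Fin d))
    (k l : Fin d → ℕ) :
    inner ℝ (tensorL2 hα o k) (tensorL2 hα o l) = if k = l then tensorNormSq o k else 0 := by
  rw [tensorL2, tensorL2, inner_toLp, integral_tensorFun_mul hα]

theorem orthonormal_tensorL2 {α : Fin d → ℝ} (hα : ∀ i, -(1 / 2 : ℝ) ≤ α i) :
    Orthonormal ℝ (tensorL2 hα none) := by
  rw [orthonormal_iff_ite]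
  intro k l
  rw [inner_tensorL2]
  rfl

theorem norm_sq_tensorL2 {α : Fin d → ℝ} (hα : ∀ i, -(1 / 2 : ℝ) ≤ α i) (i : Fin d)
    (k : Fin d → ℕ) : ‖tensorL2 hα (some i) k‖ ^ 2 = 4 * k i := by
  rw [← real_inner_self_eq_norm_sq, inner_tensorL2, if_pos rfl]
  rfl

/-- The coefficient `λ_k^{-1/2} ⟨f, ℓ_k⟩`. -/
def rieszCoeff (α : Fin d → ℝ) (f : (Fin d → ℝ) → ℝ) (k : Fin d → ℕ) : ℝ :=
  laguerreEigenvalue α k ^ (-(1 / 2) : ℝ) *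
    ∫ y, f y * laguerreTensor α k y ∂laguerreMeasure α

theorem rieszTerm_eq (α : Fin d → ℝ) (i : Fin d) (f : (Fin d → ℝ) → ℝ) (k : Fin d → ℕ) :
    rieszTerm α i f k = rieszCoeff α f k • tensorFun α (some i) k := by
  funext x
  rw [rieszTerm, laguerreDelta_tensor]
  rfl

theorem memLp_rieszTerm {α : Fin d → ℝ} (hα : ∀ i, -(1 / 2 : ℝ) ≤ α i) (i : Fin d)
    (f : (Fin d → ℝ) → ℝ) (k : Fin d → ℕ) : MemLp (rieszTerm α i f k) 2 (laguerreMeasure α) := by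
  rw [rieszTerm_eq]
  exact (memLp_two_tensorFun hα _ k).const_smul _

theorem toLp_rieszTerm {α : Fin d → ℝ} (hα : ∀ i, -(1 / 2 : ℝ) ≤ α i) (i : Fin d)
    (f : (Fin d → ℝ) → ℝ) (k : Fin d → ℕ) :
    (memLp_rieszTerm hα i f k).toLp _ = rieszCoeff α f k • tensorL2 hα (some i) k := by
  rw [tensorL2, ← MemLp.toLp_const_smul]
  exact MemLp.toLp_congr _ _ (by rw [rieszTerm_eq])

/-- Convergence of the series in the sense of `IsRieszTransform` is summability in `L²`. -/
theorem isRieszTransform_iff {α : Fin d → ℝ} (hα : ∀ i, -(1 / 2 : ℝ) ≤ α i) (i : Fin d)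
    (f : (Fin d → ℝ) → ℝ) {g : (Fin d → ℝ) → ℝ} (hg : MemLp g 2 (laguerreMeasure α)) :
    IsRieszTransform α i f g ↔
      HasSum (fun k => rieszCoeff α f k • tensorL2 hα (some i) k) (hg.toLp g) := by
  have h : ∀ s : Finset (Fin d → ℕ),
      ‖(∑ k ∈ s, rieszCoeff α f k • tensorL2 hα (some i) k) - hg.toLp g‖ₑ =
      eLpNorm (fun x => g x - ∑ k ∈ s, rieszTerm α i f k x) 2 (laguerreMeasure α) := by
    intro s
    rw [← enorm_neg, neg_sub, Lp.enorm_def]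
    refine eLpNorm_congr_ae ?_
    simp only [← toLp_rieszTerm]
    have hs : ∀ᵐ x ∂laguerreMeasure α, ∀ k ∈ s,
        (memLp_rieszTerm hα i f k).toLp _ x = rieszTerm α i f k x :=
      (ae_ball_iff s.countable_toSet).2 fun k _ => MemLp.coeFn_toLp _
    filter_upwards [hs, hg.coeFn_toLp, Lp.coeFn_sub (hg.toLp g)
      (∑ k ∈ s, (memLp_rieszTerm hα i f k).toLp _),
      Lp.coeFn_fun_finsetSum s fun k => (memLp_rieszTerm hα i f k).toLp _] with x h1 h2 h3 h4
    rw [h3, Pi.sub_apply, h2, h4, Finset.sum_congr rfl h1]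
  rw [IsRieszTransform, HasSum, tendsto_iff_norm_sub_tendsto_zero, and_iff_right hg]
  simp only [← h]
  rw [← ENNReal.tendsto_toReal_iff (fun _ => enorm_ne_top) ENNReal.zero_ne_top]
  simp only [toReal_enorm, ENNReal.toReal_zero]
  rfl

/-- The terms of the series are orthogonal, and `‖δ_i ℓ_k‖² = 4 k_i ≤ λ_k`, so the sum of their
squared norms is bounded by Bessel's inequality for the `ℓ_k`. -/
theorem summable_riesz {α : Fin d → ℝ} (hα : ∀ i, -(1 / 2 : ℝ) ≤ α i) (i : Fin d)
    {f : (Fin d → ℝ) → ℝ} (hf : MemLp f 2 (laguerreMeasure α)) :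
    Summable fun k => rieszCoeff α f k • tensorL2 hα (some i) k := by
  have hfam : OrthogonalFamily ℝ (fun k => Submodule.span ℝ {tensorL2 hα (some i) k})
      fun k => (Submodule.span ℝ {tensorL2 hα (some i) k}).subtypeₗᵢ := by
    refine OrthogonalFamily.of_pairwise fun k l hkl => ?_
    rw [Function.onFun, Submodule.isOrtho_span]
    rintro _ rfl _ rfl
    rw [inner_tensorL2, if_neg hkl]
  have := (hfam.summable_iff_norm_sq_summable fun k => ⟨rieszCoeff α f k • tensorL2 hα (some i) k,
    Submodule.smul_mem _ _ (Submodule.mem_span_singleton_self _)⟩).2 ?_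
  · exact this
  refine Summable.of_nonneg_of_le (fun k => sq_nonneg _) (fun k => ?_)
    ((orthonormal_tensorL2 hα).inner_products_summable (hf.toLp f))
  have hk : (0 : ℝ) ≤ k i := Nat.cast_nonneg _
  have hlam := laguerreEigenvalue_pos (Fin.pos i) hα k
  have hle : 4 * (k i : ℝ) ≤ laguerreEigenvalue α k := by
    refine le_trans ?_ (Finset.single_le_sum (f := fun i => 4 * (k i : ℝ) + 2 * α i + 2)
      (fun j _ => ?_) (Finset.mem_univ i))
    · linarith [hα i]
    · have : (0 : ℝ) ≤ k j := Nat.cast_nonneg _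
      linarith [hα j]
  have hin : inner ℝ (tensorL2 hα none k) (hf.toLp f) =
      ∫ y, f y * laguerreTensor α k y ∂laguerreMeasure α := by
    rw [tensorL2, inner_toLp, ← tensorFun_none]
    simp only [mul_comm]
  have hpow : (laguerreEigenvalue α k ^ (-(1 / 2) : ℝ)) ^ 2 = (laguerreEigenvalue α k)⁻¹ := by
    rw [← Real.rpow_natCast, ← Real.rpow_mul hlam.le]
    norm_num
    rw [Real.rpow_neg_one]
  simp only [Submodule.coe_norm, norm_smul, mul_pow, norm_sq_tensorL2, hin]
  rw [rieszCoeff, norm_mul, mul_pow, Real.norm_eq_abs, sq_abs, hpow, mul_right_comm]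
  refine mul_le_of_le_one_left (sq_nonneg _) ?_
  rw [inv_mul_le_iff₀ hlam]
  linarith

theorem exists_isRieszTransform {α : Fin d → ℝ} (hα : ∀ i, -(1 / 2 : ℝ) ≤ α i) (i : Fin d)
    {f : (Fin d → ℝ) → ℝ} (hf : MemLp f 2 (laguerreMeasure α)) :
    ∃ g, IsRieszTransform α i f g := by
  obtain ⟨g, hg⟩ := summable_riesz hα i hf
  refine ⟨g, (isRieszTransform_iff hα i f (Lp.memLp g)).2 ?_⟩
  rwa [Lp.toLp_coeFn]

theorem IsRieszTransform.ae_eq {α : Fin d → ℝ} (hα : ∀ i, -(1 / 2 : ℝ) ≤ α i) {i : Fin d}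
    {f g g' : (Fin d → ℝ) → ℝ} (h : IsRieszTransform α i f g) (h' : IsRieszTransform α i f g') :
    g =ᵐ[laguerreMeasure α] g' :=
  (MemLp.toLp_eq_toLp_iff h.1 h'.1).1 (((isRieszTransform_iff hα i f h.1).1 h).unique
    ((isRieszTransform_iff hα i f h'.1).1 h'))

theorem IsRieszTransform.congr {α : Fin d → ℝ} {i : Fin d} {f g g' : (Fin d → ℝ) → ℝ}
    (h : IsRieszTransform α i f g) (hg : g =ᵐ[laguerreMeasure α] g') :
    IsRieszTransform α i f g' := by
  refine ⟨h.1.ae_eq hg, h.2.congr fun s => eLpNorm_congr_ae ?_⟩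
  filter_upwards [hg] with x hx
  rw [hx]

/-- The pairings of `R_i f` with the `δ_i ℓ_k`, which determine it. -/
theorem IsRieszTransform.integral_mul {α : Fin d → ℝ} (hα : ∀ i, -(1 / 2 : ℝ) ≤ α i) {i : Fin d}
    {f g : (Fin d → ℝ) → ℝ} (h : IsRieszTransform α i f g) (k : Fin d → ℕ) :
    ∫ x, g x * tensorFun α (some i) k x ∂laguerreMeasure α = rieszCoeff α f k * (4 * k i) := by
  have h1 := ((isRieszTransform_iff hα i f h.1).1 h).mapL (innerSL ℝ (tensorL2 hα (some i) k))
  have h2 : HasSum (fun l => innerSL ℝ (tensorL2 hα (some i) k)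
      (rieszCoeff α f l • tensorL2 hα (some i) l)) (rieszCoeff α f k * (4 * k i)) := by
    convert hasSum_ite_eq k (rieszCoeff α f k * (4 * k i)) using 1
    funext l
    rw [map_smul, innerSL_apply_apply, inner_tensorL2, smul_eq_mul]
    by_cases hkl : k = l
    · subst hkl; simp [tensorNormSq]
    · simp [hkl, Ne.symm hkl]
  rw [← h1.unique h2, innerSL_apply_apply, tensorL2, inner_toLp]
  simp only [mul_comm]

/-! ### Duality of `L^p` spaces -/

section Duality

variable {X : Type*} [MeasurableSpace X] {μ : Measure X} {E : Type*} [NormedAddCommGroup E]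

theorem Lp_norm_rpow_eq_integral {p : ℝ} (hp : 0 < p) (f : Lp E (ENNReal.ofReal p) μ) :
    ‖f‖ ^ p = ∫ x, ‖f x‖ ^ p ∂μ := by
  have h0 : ENNReal.ofReal p ≠ 0 := by simpa using hp
  have hI : 0 ≤ ∫ x, ‖f x‖ ^ p ∂μ := integral_nonneg fun x => Real.rpow_nonneg (norm_nonneg _) _
  rw [Lp.norm_def, (Lp.memLp f).eLpNorm_eq_integral_rpow_norm h0 ENNReal.ofReal_ne_top,
    ENNReal.toReal_ofReal hp.le, ENNReal.toReal_ofReal (Real.rpow_nonneg hI _),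
    ← Real.rpow_mul hI, inv_mul_cancel₀ hp.ne', Real.rpow_one]

/-- The norm of `F ∈ L^p` is determined by the pairings with a dense subset of `L^q`. -/
theorem norm_le_of_forall_integral_inner [InnerProductSpace ℝ E] {p q : ℝ}
    (hpq : p.HolderConjugate q) [Fact (1 ≤ ENNReal.ofReal p)] [Fact (1 ≤ ENNReal.ofReal q)]
    (F : Lp E (ENNReal.ofReal p) μ) {C : ℝ} {D : Set (Lp E (ENNReal.ofReal q) μ)} (hD : Dense D)
    (h : ∀ g ∈ D, |∫ x, inner ℝ (F x) (g x) ∂μ| ≤ C * ‖g‖) (hC : 0 ≤ C) : ‖F‖ ≤ C := by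
  have hp := hpq.pos
  have hq := hpq.symm.pos
  have hp1 := hpq.lt
  have := hpq.ennrealOfReal
  let B : E →L[ℝ] E →L[ℝ] ℝ := innerSL ℝ
  have hB : ∀ g : Lp E (ENNReal.ofReal q) μ,
      B.lpPairing μ (ENNReal.ofReal p) (ENNReal.ofReal q) F g = ∫ x, inner ℝ (F x) (g x) ∂μ :=
    fun g => B.lpPairing_eq_integral F g
  have hall : ∀ g : Lp E (ENNReal.ofReal q) μ, |∫ x, inner ℝ (F x) (g x) ∂μ| ≤ C * ‖g‖ := by
    simp only [← hB] at h ⊢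
    exact hD.induction h (isClosed_le (by fun_prop) (by fun_prop))
  -- The extremal function for Hölder's inequality.
  set G : X → E := fun x => ‖F x‖ ^ (p - 2) • F x with hG
  have hFm := (Lp.memLp F).1
  have hGm : AEStronglyMeasurable G μ :=
    (hFm.norm.aemeasurable.pow_const _).aestronglyMeasurable.smul hFm
  have hGn : ∀ x, ‖G x‖ = ‖F x‖ ^ (p - 1) := by
    intro x
    rw [hG, norm_smul, Real.norm_of_nonneg (Real.rpow_nonneg (norm_nonneg _) _)]
    rcases (norm_nonneg (F x)).eq_or_lt with h0 | h0
    · rw [← h0, mul_zero, Real.zero_rpow (by linarith)]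
    · rw [← Real.rpow_add_one h0.ne']; congr 1; ring
  have hGq : ∀ x, ‖G x‖ ^ q = ‖F x‖ ^ p := by
    intro x
    rw [hGn, ← Real.rpow_mul (norm_nonneg _), hpq.sub_one_mul_conj]
  have hGi : ∀ x, inner ℝ (F x) (G x) = ‖F x‖ ^ p := by
    intro x
    rw [hG, real_inner_smul_right, real_inner_self_eq_norm_sq]
    rcases (norm_nonneg (F x)).eq_or_lt with h0 | h0
    · rw [← h0, Real.zero_rpow hp.ne']; simp
    · rw [← Real.rpow_natCast, ← Real.rpow_add h0]; congr 1; push_cast; ring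
  have hFint : Integrable (fun x => ‖F x‖ ^ p) μ := by
    have := (Lp.memLp F).integrable_norm_rpow (by simpa using hp) ENNReal.ofReal_ne_top
    rwa [ENNReal.toReal_ofReal hp.le] at this
  have hGmem : MemLp G (ENNReal.ofReal q) μ := by
    rw [← integrable_norm_rpow_iff hGm (by simpa using hq) ENNReal.ofReal_ne_top,
      ENNReal.toReal_ofReal hq.le]
    simpa only [hGq] using hFint
  have h1 : ‖hGmem.toLp G‖ ^ q = ‖F‖ ^ p := by
    rw [Lp_norm_rpow_eq_integral hq, Lp_norm_rpow_eq_integral hp]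
    refine integral_congr_ae ?_
    filter_upwards [hGmem.coeFn_toLp] with x hx
    rw [hx, hGq]
  have h2 : ∫ x, inner ℝ (F x) (hGmem.toLp G x) ∂μ = ‖F‖ ^ p := by
    rw [Lp_norm_rpow_eq_integral hp]
    refine integral_congr_ae ?_
    filter_upwards [hGmem.coeFn_toLp] with x hx
    rw [hx, hGi]
  have h3 : ‖hGmem.toLp G‖ = ‖F‖ ^ (p - 1) := by
    refine (Real.rpow_left_inj (norm_nonneg _) (Real.rpow_nonneg (norm_nonneg _) _) hq.ne').1 ?_
    rw [h1, ← Real.rpow_mul (norm_nonneg _), hpq.sub_one_mul_conj]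
  have h4 := hall (hGmem.toLp G)
  rw [h2, h3, abs_of_nonneg (Real.rpow_nonneg (norm_nonneg _) _)] at h4
  rcases (norm_nonneg F).eq_or_lt with h0 | h0
  · rw [← h0]; exact hC
  · have h5 : ‖F‖ ^ p = ‖F‖ * ‖F‖ ^ (p - 1) := by
      rw [← Real.rpow_one_add' h0.le (by linarith)]; congr 1; ring
    rw [h5] at h4
    exact le_of_mul_le_mul_right h4 (Real.rpow_pos_of_pos h0 _)

end Duality

/-! ### The Riesz transforms on `L^p` -/

/-- The `ℝ^d`-valued function with the given components. -/
def vecFun (G : Fin d → (Fin d → ℝ) → ℝ) (x : Fin d → ℝ) : EuclideanSpace ℝ (Fin d) :=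
  WithLp.toLp 2 fun i => G i x

theorem memLp_vecFun {μ : Measure (Fin d → ℝ)} {p : ℝ≥0∞} {G : Fin d → (Fin d → ℝ) → ℝ}
    (hG : ∀ i, MemLp (G i) p μ) : MemLp (vecFun G) p μ := by
  have h : vecFun G = ∑ i, fun x => G i x • EuclideanSpace.single i (1 : ℝ) := by
    funext x
    ext j
    simp [vecFun, Finset.sum_apply, Pi.single_apply]
  rw [h]
  exact memLp_finsetSum' _ fun i _ =>
    (ContinuousLinearMap.toSpanSingleton ℝ (EuclideanSpace.single i (1 : ℝ))).comp_memLp' (hG i)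

theorem eLpNorm_le_sum_components {μ : Measure (Fin d → ℝ)} {p : ℝ≥0∞} (hp : 1 ≤ p)
    {F : (Fin d → ℝ) → EuclideanSpace ℝ (Fin d)} (hF : AEStronglyMeasurable F μ) :
    eLpNorm F p μ ≤ ∑ i, eLpNorm (fun x => F x i) p μ := by
  have hm : ∀ i, AEStronglyMeasurable (fun x => ‖F x i‖) μ := fun i =>
    ((EuclideanSpace.proj (𝕜 := ℝ) i).continuous.comp_aestronglyMeasurable hF).norm
  calc eLpNorm F p μ ≤ eLpNorm (∑ i, fun x => ‖F x i‖) p μ := by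
        refine eLpNorm_mono_real fun x => ?_
        rw [Finset.sum_apply, EuclideanSpace.norm_eq]
        refine Real.sqrt_le_iff.2 ⟨Finset.sum_nonneg fun _ _ => norm_nonneg _, ?_⟩
        exact Finset.sum_sq_le_sq_sum_of_nonneg fun _ _ => norm_nonneg _
    _ ≤ ∑ i, eLpNorm (fun x => ‖F x i‖) p μ := eLpNorm_sum_le (fun i _ => hm i) hp
    _ = _ := by simp only [eLpNorm_norm]

section Operator

variable {α : Fin d → ℝ} {p : ℝ≥0∞}

theorem memLp_rieszSum (hα : ∀ i, -(1 / 2 : ℝ) ≤ α i) (i : Fin d) (c : (Fin d → ℕ) →₀ ℝ)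
    (hp0 : p ≠ 0) (hp : p ≠ ⊤) : MemLp (rieszSum α i c) p (laguerreMeasure α) := by
  obtain ⟨c', hc'⟩ := exists_tensorSum_eq_rieszSum α i c
  rw [hc']
  exact memLp_tensorSum hα _ c' hp0 hp

/-- The finite sums `∑ k, c k • ℓ_k` as elements of `L^p`. -/
def tensorSumLp (hα : ∀ i, -(1 / 2 : ℝ) ≤ α i) (hp0 : p ≠ 0) (hp : p ≠ ⊤) :
    ((Fin d → ℕ) →₀ ℝ) →ₗ[ℝ] Lp ℝ p (laguerreMeasure α) where
  toFun c := (memLp_tensorSum hα none c hp0 hp).toLp _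
  map_add' c c' := by
    rw [← MemLp.toLp_add]
    exact MemLp.toLp_congr _ _ (by rw [map_add])
  map_smul' r c := by
    rw [RingHom.id_apply, ← MemLp.toLp_const_smul]
    exact MemLp.toLp_congr _ _ (by rw [map_smul])

theorem coeFn_tensorSumLp (hα : ∀ i, -(1 / 2 : ℝ) ≤ α i) (hp0 : p ≠ 0) (hp : p ≠ ⊤)
    (c : (Fin d → ℕ) →₀ ℝ) : tensorSumLp hα hp0 hp c =ᵐ[laguerreMeasure α] tensorSum α none c :=
  (memLp_tensorSum hα none c hp0 hp).coeFn_toLp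

/-- The vector of Riesz transforms on finite sums, with values in `L^p`. -/
def rieszSumLp (hα : ∀ i, -(1 / 2 : ℝ) ≤ α i) (hp0 : p ≠ 0) (hp : p ≠ ⊤) :
    ((Fin d → ℕ) →₀ ℝ) →ₗ[ℝ] Lp (EuclideanSpace ℝ (Fin d)) p (laguerreMeasure α) where
  toFun c := (memLp_vecFun fun i => memLp_rieszSum hα i c hp0 hp).toLp _
  map_add' c c' := by
    rw [← MemLp.toLp_add]
    refine MemLp.toLp_congr _ _ (ae_of_all _ fun x => ?_)
    ext i
    simp [vecFun]
  map_smul' r c := by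
    rw [RingHom.id_apply, ← MemLp.toLp_const_smul]
    refine MemLp.toLp_congr _ _ (ae_of_all _ fun x => ?_)
    ext i
    simp [vecFun]

theorem coeFn_rieszSumLp (hα : ∀ i, -(1 / 2 : ℝ) ≤ α i) (hp0 : p ≠ 0) (hp : p ≠ ⊤)
    (c : (Fin d → ℕ) →₀ ℝ) :
    rieszSumLp hα hp0 hp c =ᵐ[laguerreMeasure α] vecFun fun i => rieszSum α i c :=
  (memLp_vecFun fun i => memLp_rieszSum hα i c hp0 hp).coeFn_toLp

end Operator

section Real

variable {α : Fin d → ℝ} {p q : ℝ}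

theorem ofReal_ne_zero_of_lt (hp : 1 < p) : ENNReal.ofReal p ≠ 0 := by
  simp; linarith

theorem denseRange_tensorSumLp (hα : ∀ i, -(1 / 2 : ℝ) ≤ α i) (hp : 1 < p)
    [Fact (1 ≤ ENNReal.ofReal p)] :
    DenseRange (tensorSumLp hα (ofReal_ne_zero_of_lt hp) ENNReal.ofReal_ne_top) := by
  intro f
  rw [EMetric.mem_closure_iff]
  intro ε hε
  obtain ⟨ε', hε', hlt⟩ := exists_between hε
  obtain ⟨c, hc⟩ := exists_tensorSum_close hα none hp.le (Lp.memLp f) hε'.ne'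
  refine ⟨_, ⟨c, rfl⟩, lt_of_le_of_lt (le_of_eq_of_le ?_ hc) hlt⟩
  rw [Lp.edist_def]
  refine eLpNorm_congr_ae ?_
  filter_upwards [coeFn_tensorSumLp hα (ofReal_ne_zero_of_lt hp) ENNReal.ofReal_ne_top c] with x hx
  rw [Pi.sub_apply, Pi.sub_apply, hx]

/-- Vector-valued finite sums of the `δ_i ℓ_k` are dense in `L^q(ℝ^d)`. -/
theorem dense_vecFun_tensorSum (hα : ∀ i, -(1 / 2 : ℝ) ≤ α i) (hq : 1 < q)
    [Fact (1 ≤ ENNReal.ofReal q)] :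
    Dense (Set.range fun e : Fin d → (Fin d → ℕ) →₀ ℝ =>
      (memLp_vecFun fun i => memLp_tensorSum hα (some i) (e i) (ofReal_ne_zero_of_lt hq)
        ENNReal.ofReal_ne_top).toLp (vecFun fun i => tensorSum α (some i) (e i))) := by
  intro g
  rw [EMetric.mem_closure_iff]
  intro ε hε
  obtain ⟨ε', hε', hlt⟩ := exists_between hε
  have hgm := (Lp.memLp g).1
  have hgi : ∀ i, MemLp (fun x => g x i) (ENNReal.ofReal q) (laguerreMeasure α) := fun i =>
    (EuclideanSpace.proj (𝕜 := ℝ) i).comp_memLp' (Lp.memLp g)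
  have hd0 : ε' / (d + 1) ≠ 0 := (ENNReal.div_pos hε'.ne' (by simp)).ne'
  choose e he using fun i => exists_tensorSum_close hα (some i) hq.le (hgi i) hd0
  have hm := memLp_vecFun fun i => memLp_tensorSum hα (some i) (e i) (ofReal_ne_zero_of_lt hq)
        ENNReal.ofReal_ne_top
  refine ⟨_, ⟨e, rfl⟩, lt_of_le_of_lt ?_ hlt⟩
  rw [Lp.edist_def, eLpNorm_congr_ae (g := ⇑g - vecFun fun i => tensorSum α (some i) (e i))]
  · refine (eLpNorm_le_sum_components Fact.out (hgm.sub hm.1)).trans ?_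
    calc _ ≤ ∑ i : Fin d, ε' / (d + 1) := Finset.sum_le_sum fun i _ => he i
      _ ≤ (d + 1) * (ε' / (d + 1)) := by
          rw [Finset.sum_const, Finset.card_univ, Fintype.card_fin, nsmul_eq_mul]
          gcongr
          exact le_self_add
      _ ≤ ε' := ENNReal.mul_div_le
  · filter_upwards [hm.coeFn_toLp] with x hx
    rw [Pi.sub_apply, Pi.sub_apply, hx]

/-- The bound on finite sums, by duality from `abs_rieszForm_le`. For `d = 0` the target space is
trivial. -/
theorem norm_rieszSumLp_le (hα : ∀ i, -(1 / 2 : ℝ) ≤ α i) (hpq : p.HolderConjugate q)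
    [Fact (1 ≤ ENNReal.ofReal p)] (c : (Fin d → ℕ) →₀ ℝ) :
    ‖rieszSumLp hα (ofReal_ne_zero_of_lt hpq.lt) ENNReal.ofReal_ne_top c‖ ≤
      27 * (max p q - 1) *
        ‖tensorSumLp hα (ofReal_ne_zero_of_lt hpq.lt) ENNReal.ofReal_ne_top c‖ := by
  have hK : 0 < max p q - 1 := by linarith [hpq.lt, le_max_left p q]
  have : Fact (1 ≤ ENNReal.ofReal q) := ⟨by simpa using hpq.symm.lt.le⟩
  rcases Nat.eq_zero_or_pos d with rfl | hd
  · have h0 : rieszSumLp hα (ofReal_ne_zero_of_lt hpq.lt) ENNReal.ofReal_ne_top c = 0 :=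
      Lp.ext (ae_of_all _ fun x => Subsingleton.elim _ _)
    rw [h0, norm_zero]
    positivity
  refine norm_le_of_forall_integral_inner hpq _ (dense_vecFun_tensorSum hα hpq.symm.lt) ?_
    (by positivity)
  rintro _ ⟨e, rfl⟩
  set f := tensorSumLp hα (ofReal_ne_zero_of_lt hpq.lt) ENNReal.ofReal_ne_top c with hf
  have hm := memLp_vecFun fun i => memLp_tensorSum hα (some i) (e i)
    (ofReal_ne_zero_of_lt hpq.symm.lt) ENNReal.ofReal_ne_top
  set g := hm.toLp _ with hg
  have hint : ∫ x, inner ℝ (rieszSumLp hα (ofReal_ne_zero_of_lt hpq.lt) ENNReal.ofReal_ne_top c x)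
      (g x) ∂laguerreMeasure α = rieszForm α c e := by
    have h1 : ∀ i, Integrable (fun x => rieszSum α i c x * tensorSum α (some i) (e i) x)
        (laguerreMeasure α) := by
      intro i
      obtain ⟨c', hc'⟩ := exists_tensorSum_eq_rieszSum α i c
      rw [hc']
      exact ((gaussBound_tensorSum α _ c').mul (gaussBound_tensorSum α _ (e i))).integrable hα
        (by norm_num)
        ((continuous_tensorSum α _ c').mul (continuous_tensorSum α _ (e i))).aestronglyMeasurable
    rw [rieszForm]
    simp only [← integral_rieszSum_mul hα]
    rw [← integral_finsetSum _ fun i _ => h1 i]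
    refine integral_congr_ae ?_
    filter_upwards [coeFn_rieszSumLp hα (ofReal_ne_zero_of_lt hpq.lt) ENNReal.ofReal_ne_top c,
      hm.coeFn_toLp] with x hx hx'
    rw [hx, hx']
    simp [vecFun, PiLp.inner_apply, mul_comm]
  have hfi : ∫ x, (tensorSum α none c x ^ 2) ^ (p / 2) ∂laguerreMeasure α = ‖f‖ ^ p := by
    rw [Lp_norm_rpow_eq_integral hpq.pos]
    refine integral_congr_ae ?_
    filter_upwards [coeFn_tensorSumLp hα (ofReal_ne_zero_of_lt hpq.lt) ENNReal.ofReal_ne_top c]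
      with x hx
    rw [hx, ← sq_abs, ← Real.rpow_natCast, ← Real.rpow_mul (abs_nonneg _), Real.norm_eq_abs]
    congr 1
    push_cast; ring
  have hgi : ∫ x, (∑ i, tensorSum α (some i) (e i) x ^ 2) ^ (q / 2) ∂laguerreMeasure α =
      ‖g‖ ^ q := by
    rw [Lp_norm_rpow_eq_integral hpq.symm.pos]
    refine integral_congr_ae ?_
    filter_upwards [hm.coeFn_toLp] with x hx
    have h0 : 0 ≤ ∑ i, tensorSum α (some i) (e i) x ^ 2 := Finset.sum_nonneg fun _ _ => sq_nonneg _
    rw [hx, EuclideanSpace.norm_eq, Real.sqrt_eq_rpow]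
    simp only [vecFun, Real.norm_eq_abs, sq_abs]
    rw [← Real.rpow_mul h0]
    congr 1; ring
  -- `abs_rieszForm_le` needs positive bounds for the norms; let them decrease to the norms.
  have hlim : Tendsto (fun η : ℝ => 27 * (max p q - 1) * (‖f‖ + η) * (‖g‖ + η)) (𝓝[>] 0)
      (𝓝 (27 * (max p q - 1) * (‖f‖ + 0) * (‖g‖ + 0))) :=
    (by fun_prop : Continuous fun η : ℝ => 27 * (max p q - 1) * (‖f‖ + η) * (‖g‖ + η)).tendsto 0
      |>.mono_left nhdsWithin_le_nhds
  rw [add_zero, add_zero] at hlim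
  refine ge_of_tendsto hlim ?_
  filter_upwards [self_mem_nhdsWithin] with η hη
  have hη' : 0 < η := hη
  rw [hint]
  refine abs_rieszForm_le hd hα hpq c e (by positivity) (by positivity) ?_ ?_
  · rw [hfi]
    exact Real.rpow_le_rpow (norm_nonneg _) (by linarith) hpq.nonneg
  · rw [hgi]
    exact Real.rpow_le_rpow (norm_nonneg _) (by linarith) hpq.symm.nonneg

theorem integral_tensorSum_mul_tensor (hα : ∀ i, -(1 / 2 : ℝ) ≤ α i) (c : (Fin d → ℕ) →₀ ℝ)
    (k : Fin d → ℕ) :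
    ∫ x, tensorSum α none c x * tensorFun α none k x ∂laguerreMeasure α = c k := by
  simp only [tensorSum_apply, Finset.sum_mul, mul_assoc]
  rw [integral_finsetSum _ fun l _ => (integrable_tensorFun_mul hα none none l k).const_mul _]
  simp only [integral_const_mul, integral_tensorFun_mul hα, mul_ite, mul_zero]
  rw [Finset.sum_ite_eq']
  split_ifs with hk
  · simp [tensorNormSq]
  · rw [Finsupp.notMem_support_iff.1 hk]

theorem integral_rieszSum_mul_tensor (hα : ∀ i, -(1 / 2 : ℝ) ≤ α i) (i : Fin d)
    (c : (Fin d → ℕ) →₀ ℝ) (k : Fin d → ℕ) :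
    ∫ x, rieszSum α i c x * tensorFun α (some i) k x ∂laguerreMeasure α =
      laguerreEigenvalue α k ^ (-(1 / 2) : ℝ) * c k * (4 * k i) := by
  have h := integral_rieszSum_mul hα i c (Finsupp.single k 1)
  have h1 : tensorSum α (some i) (Finsupp.single k 1) = tensorFun α (some i) k := by
    simp [tensorSum]
  rw [h1] at h
  rw [h, Finset.sum_eq_single k]
  · simp
  · intro l _ hl
    simp [hl]
  · intro hk
    simp [Finsupp.notMem_support_iff.1 hk]

/-- The bounded extension of the vector of Riesz transforms from finite sums to `L^p`. -/
def rieszLp (hα : ∀ i, -(1 / 2 : ℝ) ≤ α i) (hp : 1 < p) [Fact (1 ≤ ENNReal.ofReal p)] :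
    Lp ℝ (ENNReal.ofReal p) (laguerreMeasure α) →L[ℝ]
      Lp (EuclideanSpace ℝ (Fin d)) (ENNReal.ofReal p) (laguerreMeasure α) :=
  (rieszSumLp hα (ofReal_ne_zero_of_lt hp) ENNReal.ofReal_ne_top).extendOfNorm
    (tensorSumLp hα (ofReal_ne_zero_of_lt hp) ENNReal.ofReal_ne_top)

theorem rieszLp_tensorSumLp (hα : ∀ i, -(1 / 2 : ℝ) ≤ α i) (hp : 1 < p)
    [Fact (1 ≤ ENNReal.ofReal p)] (c : (Fin d → ℕ) →₀ ℝ) :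
    rieszLp hα hp (tensorSumLp hα (ofReal_ne_zero_of_lt hp) ENNReal.ofReal_ne_top c) =
      rieszSumLp hα (ofReal_ne_zero_of_lt hp) ENNReal.ofReal_ne_top c :=
  LinearMap.extendOfNorm_eq (denseRange_tensorSumLp hα hp)
    ⟨_, norm_rieszSumLp_le hα (Real.HolderConjugate.conjExponent hp)⟩ c

theorem norm_rieszLp_le (hα : ∀ i, -(1 / 2 : ℝ) ≤ α i) (hp : 1 < p)
    [Fact (1 ≤ ENNReal.ofReal p)] (f : Lp ℝ (ENNReal.ofReal p) (laguerreMeasure α)) :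
    ‖rieszLp hα hp f‖ ≤ 27 * (max p (p / (p - 1)) - 1) * ‖f‖ :=
  LinearMap.norm_extendOfNorm_apply_le (denseRange_tensorSumLp hα hp) _
    (norm_rieszSumLp_le hα (Real.HolderConjugate.conjExponent hp)) f

/-- The pairings of the extension with the `δ_i ℓ_k`: the formula for finite sums persists by
continuity. -/
theorem integral_rieszLp_mul (hα : ∀ i, -(1 / 2 : ℝ) ≤ α i) (hp : 1 < p)
    [Fact (1 ≤ ENNReal.ofReal p)] (f : Lp ℝ (ENNReal.ofReal p) (laguerreMeasure α)) (i : Fin d)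
    (k : Fin d → ℕ) :
    ∫ x, rieszLp hα hp f x i * tensorFun α (some i) k x ∂laguerreMeasure α =
      rieszCoeff α f k * (4 * k i) := by
  have hpq := Real.HolderConjugate.conjExponent hp
  have hq := hpq.symm.lt
  have : Fact (1 ≤ ENNReal.ofReal (Real.conjExponent p)) := ⟨by simpa using hq.le⟩
  have := hpq.ennrealOfReal
  have hmem := fun o => memLp_tensorFun (p := ENNReal.ofReal (Real.conjExponent p)) hα o k
    (ofReal_ne_zero_of_lt hq) ENNReal.ofReal_ne_top
  -- Both sides are continuous linear functionals of `f`.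
  let B : ℝ →L[ℝ] EuclideanSpace ℝ (Fin d) →L[ℝ] ℝ :=
    (ContinuousLinearMap.mul ℝ ℝ).flip.flip.bilinearComp (.id ℝ ℝ) (EuclideanSpace.proj i)
  let L1 := B.lpPairing (laguerreMeasure α) (ENNReal.ofReal (Real.conjExponent p))
    (ENNReal.ofReal p) ((hmem (some i)).toLp _)
  let L2 := (ContinuousLinearMap.mul ℝ ℝ).lpPairing (laguerreMeasure α)
    (ENNReal.ofReal (Real.conjExponent p)) (ENNReal.ofReal p) ((hmem none).toLp _)
  have h1 : ∀ g, L1 g = ∫ x, g x i * tensorFun α (some i) k x ∂laguerreMeasure α := by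
    intro g
    refine (B.lpPairing_eq_integral _ g).trans (integral_congr_ae ?_)
    filter_upwards [(hmem (some i)).coeFn_toLp] with x hx
    rw [hx]
    simp [B, mul_comm]
  have h2 : ∀ g, L2 g = ∫ x, g x * laguerreTensor α k x ∂laguerreMeasure α := by
    intro g
    refine ((ContinuousLinearMap.mul ℝ ℝ).lpPairing_eq_integral _ g).trans (integral_congr_ae ?_)
    filter_upwards [(hmem none).coeFn_toLp] with x hx
    rw [hx, tensorFun_none]
    simp [mul_comm]
  rw [← h1, rieszCoeff, ← h2]
  refine (denseRange_tensorSumLp hα hp).induction_on f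
    (isClosed_eq (by fun_prop) (by fun_prop)) fun c => ?_
  rw [rieszLp_tensorSumLp, h1, h2, ← tensorFun_none]
  have h3 := integral_rieszSum_mul_tensor hα i c k
  rw [← integral_tensorSum_mul_tensor hα c k] at h3
  convert h3 using 1
  · refine integral_congr_ae ?_
    filter_upwards [coeFn_rieszSumLp hα (ofReal_ne_zero_of_lt hp) ENNReal.ofReal_ne_top c]
      with x hx
    rw [hx]
    rfl
  · congr 2
    refine integral_congr_ae ?_
    filter_upwards [coeFn_tensorSumLp hα (ofReal_ne_zero_of_lt hp) ENNReal.ofReal_ne_top c]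
      with x hx
    rw [hx]

/-- The extension agrees with the series on `L^p ∩ L²`: both have the same pairings with the
`δ_i ℓ_k`, and these determine a sum of functions in `L²` and in `L^p`. -/
theorem isVectorRieszTransform_rieszLp (hα : ∀ i, -(1 / 2 : ℝ) ≤ α i) (hp : 1 < p)
    [Fact (1 ≤ ENNReal.ofReal p)] :
    IsVectorRieszTransform α (ENNReal.ofReal p) (rieszLp hα hp) := by
  intro f hf i
  obtain ⟨g, hg⟩ := exists_isRieszTransform hα i hf
  refine hg.congr ?_
  have hpq := Real.HolderConjugate.conjExponent hp
  have := hpq.ennrealOfReal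
  have hT : MemLp (fun x => rieszLp hα hp f x i) (ENNReal.ofReal p) (laguerreMeasure α) :=
    (EuclideanSpace.proj (𝕜 := ℝ) i).comp_memLp' (Lp.memLp _)
  have hi1 : ∀ G : (Fin d → ℝ) → ℝ, Continuous G → GaussBound (1 / 2) G →
      Integrable (fun x => g x * G x) (laguerreMeasure α) := fun G hG hb =>
    hg.1.integrable_mul (hb.memLp hα (by norm_num) hG.aestronglyMeasurable two_ne_zero
      ENNReal.ofNat_ne_top : MemLp G 2 _)
  have hi2 : ∀ G : (Fin d → ℝ) → ℝ, Continuous G → GaussBound (1 / 2) G →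
      Integrable (fun x => rieszLp hα hp f x i * G x) (laguerreMeasure α) := fun G hG hb =>
    hT.integrable_mul (hb.memLp hα (by norm_num) hG.aestronglyMeasurable
      (ofReal_ne_zero_of_lt hpq.symm.lt) ENNReal.ofReal_ne_top)
  have h0 := ae_eq_zero_of_integral_tensorFun hα (some i)
    (h := fun x => g x - rieszLp hα hp f x i)
    (fun G hG hb => by simpa only [sub_mul] using! (hi1 G hG hb).sub (hi2 G hG hb)) fun k => by
      simp only [sub_mul]
      rw [integral_sub (hi1 _ (continuous_tensorFun α _ k) (gaussBound_tensorFun α _ k))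
        (hi2 _ (continuous_tensorFun α _ k) (gaussBound_tensorFun α _ k)), hg.integral_mul hα,
        integral_rieszLp_mul, sub_self]
  filter_upwards [h0] with x hx
  exact sub_eq_zero.1 hx

/-- An extension is determined by its values on finite sums, which are dense. -/
theorem IsVectorRieszTransform.eq_rieszLp (hα : ∀ i, -(1 / 2 : ℝ) ≤ α i) (hp : 1 < p)
    [Fact (1 ≤ ENNReal.ofReal p)]
    {R : Lp ℝ (ENNReal.ofReal p) (laguerreMeasure α) →L[ℝ]
      Lp (EuclideanSpace ℝ (Fin d)) (ENNReal.ofReal p) (laguerreMeasure α)}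
    (hR : IsVectorRieszTransform α (ENNReal.ofReal p) R) : R = rieszLp hα hp := by
  refine DFunLike.coe_injective ((denseRange_tensorSumLp hα hp).equalizer R.continuous
    (rieszLp hα hp).continuous (funext fun c => ?_))
  have hmem : MemLp (tensorSumLp hα (ofReal_ne_zero_of_lt hp) ENNReal.ofReal_ne_top c) 2
      (laguerreMeasure α) :=
    (memLp_tensorSum hα none c two_ne_zero ENNReal.ofNat_ne_top).ae_eq
      (coeFn_tensorSumLp hα _ _ c).symm
  have h := fun i => (hR _ hmem i).ae_eq hα (isVectorRieszTransform_rieszLp hα hp _ hmem i)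
  refine Lp.ext ?_
  filter_upwards [ae_all_iff.2 h] with x hx
  ext i
  exact hx i

end Real

end

theorem theorem5p6 {d : ℕ} (α : Fin d → ℝ) (hα : ∀ i, -(1 / 2 : ℝ) ≤ α i)
    (p : ℝ) (hp : 1 < p) [Fact (1 ≤ ENNReal.ofReal p)] :
    (∀ f : (Fin d → ℝ) → ℝ, MemLp f 2 (laguerreMeasure α) →
      ∀ i, ∃ g, IsRieszTransform α i f g) ∧
    (∃! R : Lp ℝ (ENNReal.ofReal p) (laguerreMeasure α) →L[ℝ]
        Lp (EuclideanSpace ℝ (Fin d)) (ENNReal.ofReal p) (laguerreMeasure α),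
      IsVectorRieszTransform α (ENNReal.ofReal p) R) ∧
    ∀ R : Lp ℝ (ENNReal.ofReal p) (laguerreMeasure α) →L[ℝ]
        Lp (EuclideanSpace ℝ (Fin d)) (ENNReal.ofReal p) (laguerreMeasure α),
      IsVectorRieszTransform α (ENNReal.ofReal p) R →
        ∀ f, ‖R f‖ ≤ 48 * (max p (p / (p - 1)) - 1) * ‖f‖ := by
  refine ⟨fun f hf i => exists_isRieszTransform hα i hf, ⟨rieszLp hα hp,
    isVectorRieszTransform_rieszLp hα hp, fun R hR => hR.eq_rieszLp hα hp⟩, fun R hR f => ?_⟩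
  rw [hR.eq_rieszLp hα hp]
  refine (norm_rieszLp_le hα hp f).trans ?_
  have : 0 < max p (p / (p - 1)) - 1 := by linarith [le_max_left p (p / (p - 1))]
  gcongr
  norm_num
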